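/- **Setting.** Let $K\ge 1$ and $F\ge 0$. An $F$-carrier parallel many-to-one interference channel with users $1,\dots,K$ consists, for each carrier $k=1,\dots,F$, of standard Borel alphabets $\mathcal X_i^{(k)}\neq\emptyset$, $\mathcal Y_i^{(k)}$ ($1\le i\le K$), $\mathcal V^{(k)}$ (so finite, countable and Euclidean alphabets are included) and of the following data: for $i\ge2$ the output $Y_i^{(k)}$ is generated from $X_i^{(k)}$ by a transition kernel $p_{Y_i^{(k)}|X_i^{(k)}}$, and $Y_2^{(k)},\dots,Y_K^{(k)}$ are conditionally independent given the inputs; an interference variable $V^{(k)}$ is generated by a kernel $p_{V^{(k)}|X_2^{(k)},\dots,X_K^{(k)}}$ (with an arbitrary dependence between $V^{(k)}$ and $(Y_2^{(k)},\dots,Y_K^{(k)})$ given the inputs); and $Y_1^{(k)}=f_1^{(k)}(X_1^{(k)},V^{(k)})$ with $f_1^{(k)}$ measurable and $V^{(k)}$ a function of $(Y_1^{(k)},X_1^{(k)})$. Given the inputs, different carriers and different channel uses are independent. *Noisy interference condition.* For each $k$, $V^{(k)}$ is a stochastically degraded version of $(Y_2^{(k)},\dots,Y_K^{(k)})$: there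 is a Markov kernel $D^{(k)}$ such that $p_{V^{(k)}|X_2^{(k)},\dots,X_K^{(k)}}$ is the composition of $\prod_{i\ge2}p_{Y_i^{(k)}|X_i^{(k)}}$ with $D^{(k)}$. *Codes and constraints.* A code of length $T\ge1$ has independent uniform messages $W_i\in\mathcal W_i$ ($\mathcal W_i$ finite and nonempty), encoders $\mathcal W_i\to\big(\prod_k\mathcal X_i^{(k)}\big)^T$ and measurable decoders $\big(\prod_k\mathcal Y_i^{(k)}\big)^T\to\mathcal W_i$; its rates are $R_i=\frac1T\log|\mathcal W_i|$ (natural logarithms throughout), and its error probability is the probability that some $W_i$ is decoded wrongly. Codebooks may be constrained: given measurable costs $b_i^{(k)}:\mathcal X_i^{(k)}\to[0,\infty]$ and sets $\mathcal Q_i\subseteq[0,\infty]^F$ that are closed under decreasing coordinates, the vector $\big(E\big[\frac1T\sum_\tau b_i^{(k)}(X_i^{(k)}(\tau))\big]\big)_{k}$ has to lie in $\mathcal Q_i$ for every $i$ (for instance, a bound on the total average power or on the average power per carrier; $\mathcal Q_i=[0,\infty]^F$ for all $i$ means no constraint). A rate tuple is achievable if there is a sequence of codes satisfying the constraint, all of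 exactly these rates, with error probability tending to $0$; $C_\Sigma\in[0,\infty]$ is the supremum of $\sum_iR_i$ over the closure of the set of achievable tuples. *Separate random coding, treating interference as noise.* Let $N\ge1$ and let $p=(p_{s,i}^{(k)})$ be probability laws on the $\mathcal X_i^{(k)}$, for time slots $s=1,\dots,N$. Write $I_p(X_i^{(k)};Y_i^{(k)})$ for the mutual information on carrier $k$ averaged over the $N$ slots, where in slot $s$ the inputs $X_j^{(k)}\sim p_{s,j}^{(k)}$ are independent. Call $p$ feasible if for every $i$ the vector over $k$ of the expected costs averaged over the slots lies in $\mathcal Q_i$. Given rates $r_i^{(k)}\ge0$, user $i$ has for each carrier $k$ a separate random codebook of $\lceil e^{Tr_i^{(k)}}\rceil$ words of length $T$, with all symbols of all codebooks independent and with laws $p_{s,i}^{(k)}$ used periodically in time, and a separate message on each carrier; the decoder of user $i$ for carrier $k$ uses only the output $Y_i^{(k)T}$ and user $i$'s codebook on carrier $k$ (and the channel and $p$). The scheme is reliable if, for suitable measurable decoding rules, the error probability averaged over the random codebooks tends to $0$ as $T\to\infty$. **Corollary (separability).** Assume that every carrier satisfies the noisy interference condition. Then: 1. $C_\Sigma=\sup_{N}\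 \sup_{p\text{ feasible}}\ \sum_{k=1}^F\sum_{i=1}^K I_p(X_i^{(k)};Y_i^{(k)})$. 2. For all $p$ and all rates with $r_i^{(k)}=0$ or $r_i^{(k)}<I_p(X_i^{(k)};Y_i^{(k)})$ for every $i,k$, separate random coding with interference treated as noise is reliable. 3. Separate random coding with interference treated as noise achieves sum-capacity: for every $R<C_\Sigma$ there are $N$, a feasible $p$ and rates with $\sum_{k,i}r_i^{(k)}>R$ for which the scheme is reliable and the random codebooks satisfy the constraint with probability tending to $1$. 4. Independence across carriers is optimal: if the vector inputs $\vec X_1,\dots,\vec X_K$, $\vec X_i=(X_i^{(1)},\dots,X_i^{(F)})$, are independent with arbitrary laws, then $\sum_iI(\vec X_i;\vec Y_i)\le\sum_k\sum_iI(X_i^{(k)};Y_i^{(k)})$, where the right side is evaluated for inputs with the same laws on each carrier (all $X_i^{(k)}$ independent). 5. If there is no constraint, then 1 and 3 hold with a single slot, $N=1$; in particular $$C_\Sigma=\sup\sum_{k=1}^F\sum_{i=1}^KI(X_i^{(k)};Y_i^{(k)}),$$ the supremum being over all product laws $\prod_{i,k}p_{X_i^{(k)}}$. If moreover all input alphabets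 are finite, then the supremum is attained, so that $C_\Sigma=\sum_k\sum_iI(X_i^{(k)};Y_i^{(k)})$ for an optimal input distribution that is independent across users and carriers. -/

import Mathlib

open MeasureTheory ProbabilityTheory Filter Topology
open scoped ENNReal NNReal

noncomputable section

namespace ParallelIC

/-! ### Mutual information and memoryless interference channels -/

/-- The mutual information (in nats) of a pair of random variables with joint law `ρ`. -/
def mutualInfo {α β : Type*} [MeasurableSpace α] [MeasurableSpace β]
    (ρ : Measure (α × β)) : ℝ≥0∞ :=
  InformationTheory.klDiv ρ (ρ.fst.prod ρ.snd)

section Channel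

variable {ι : Type*} [Fintype ι] {X Y : ι → Type*}
  [∀ i, MeasurableSpace (X i)] [∀ i, MeasurableSpace (Y i)]

/-- `I(X_i; Y_i)` for the interference channel `W` with users `ι` (a kernel from the tuple of all
inputs to the tuple of all outputs), when the inputs are independent across users, `X_j ∼ p j`.
All signals of the other users are averaged out, that is, interference is treated as noise. -/
def userInfo (W : Kernel (∀ i, X i) (∀ i, Y i)) (p : ∀ i, ProbabilityMeasure (X i)) (i : ι) :
    ℝ≥0∞ :=
  mutualInfo (((Measure.pi fun j => (p j : Measure (X j))) ⊗ₘ W).map fun z => (z.1 i, z.2 i))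

/-- The law of the outputs during `T` uses of the memoryless channel `W`, given the inputs. -/
def blockLaw (W : Kernel (∀ i, X i) (∀ i, Y i)) {T : ℕ} (x : Fin T → ∀ i, X i) :
    Measure (Fin T → ∀ i, Y i) :=
  Measure.pi fun τ => W (x τ)

/-- The average probability of error of encoders `enc` and decoders `dec`: the probability, for
independent and uniformly distributed messages, that some receiver decodes its message wrongly. -/
def errorProb (W : Kernel (∀ i, X i) (∀ i, Y i)) {T : ℕ} {M : ι → Type*} [∀ i, Fintype (M i)]
    [DecidableEq ι]
    (enc : ∀ i, M i → Fin T → X i) (dec : ∀ i, (Fin T → Y i) → M i) : ℝ≥0∞ :=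
  (Fintype.card (∀ i, M i) : ℝ≥0∞)⁻¹ *
    ∑ w : ∀ i, M i, blockLaw W (fun τ i => enc i (w i) τ)
      {y | ∃ i, dec i (fun τ => y τ i) ≠ w i}

/-- A code of length `T` for an interference channel with inputs `X` and outputs `Y`. -/
structure Code (X Y : ι → Type*) [∀ i, MeasurableSpace (Y i)] (T : ℕ) where
  /-- the number of messages of each user -/
  numMsg : ι → ℕ
  numMsg_pos : ∀ i, 0 < numMsg i
  enc : ∀ i, Fin (numMsg i) → Fin T → X i
  dec : ∀ i, (Fin T → Y i) → Fin (numMsg i)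
  measurable_dec : ∀ i, Measurable (dec i)

/-- The rate (in nats per channel use) of user `i`. -/
def Code.rate {T : ℕ} (c : Code X Y T) (i : ι) : ℝ :=
  Real.log (c.numMsg i) / T

end Channel

/-! ### Many-to-one interference channels -/

/-- A discrete memoryless many-to-one interference channel with the `m + 1` users
`0, 1, …, m`, in which only receiver `0` faces interference: the output of receiver `j + 1` is
generated from the input of transmitter `j + 1` by `direct j`, and the output of receiver `0` is
`f X₀ V`, where `V` is generated from the inputs of the transmitters `1, …, m` and can be recovered
from the output and the input of user `0`.  The kernel `joint` is the joint law of `V` and the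
outputs of the receivers `1, …, m`; these outputs are conditionally independent given the inputs,
but `V` may depend on them in any way. -/
structure ManyToOne {m : ℕ} (X Y : Fin (m + 1) → Type*) (V : Type*)
    [∀ i, MeasurableSpace (X i)] [∀ i, MeasurableSpace (Y i)] [MeasurableSpace V] where
  direct : ∀ j : Fin m, Kernel (X j.succ) (Y j.succ)
  joint : Kernel (∀ j : Fin m, X j.succ) (V × ∀ j : Fin m, Y j.succ)
  markov_direct : ∀ j, IsMarkovKernel (direct j)
  markov_joint : IsMarkovKernel joint
  joint_snd : ∀ x, (joint x).map Prod.snd = Measure.pi fun j => direct j (x j)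
  f : X 0 → V → Y 0
  measurable_f : Measurable (Function.uncurry f)
  /-- the interference as a function of the output and the input of user `0` -/
  inv : Y 0 → X 0 → V
  inv_f : ∀ x v, inv (f x v) x = v

namespace ManyToOne

variable {m : ℕ} {X Y : Fin (m + 1) → Type*} {V : Type*}
  [∀ i, MeasurableSpace (X i)] [∀ i, MeasurableSpace (Y i)] [MeasurableSpace V]

/-- The tuple of all outputs, as a function of the input of user `0`, of the interference and of the
outputs of the other users. -/
def assemble (C : ManyToOne X Y V) (z : X 0 × (V × ∀ j : Fin m, Y j.succ)) : ∀ i, Y i :=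
  Fin.cons (C.f z.1 z.2.1) z.2.2

theorem measurable_assemble (C : ManyToOne X Y V) : Measurable C.assemble := by
  refine measurable_pi_iff.2 fun i => ?_
  refine Fin.cases ?_ (fun j => ?_) i
  · exact C.measurable_f.comp (measurable_fst.prodMk (measurable_fst.comp measurable_snd))
  · exact (measurable_pi_apply j).comp (measurable_snd.comp measurable_snd)

/-- The channel as a kernel from all inputs to all outputs. -/
def kernel (C : ManyToOne X Y V) : Kernel (∀ i, X i) (∀ i, Y i) where
  toFun x := (C.joint fun j => x j.succ).map fun vy => C.assemble (x 0, vy)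
  measurable' := by
    have := C.markov_joint
    have h0 : Measurable fun x : ∀ i, X i => x 0 := measurable_pi_apply 0
    have h1 : Measurable fun (x : ∀ i, X i) (j : Fin m) => x j.succ :=
      measurable_pi_iff.2 fun j => measurable_pi_apply _
    have key : (fun x : ∀ i, X i =>
        (C.joint fun j => x j.succ).map fun vy => C.assemble (x 0, vy)) =
        fun x => ((Kernel.deterministic _ h0 ×ₖ C.joint.comap _ h1).map C.assemble) x := by
      funext x
      rw [Kernel.map_apply _ C.measurable_assemble, Kernel.prod_apply,
        Kernel.deterministic_apply, Kernel.comap_apply, Measure.dirac_prod,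
        Measure.map_map C.measurable_assemble measurable_prodMk_left]
      rfl
    rw [key]
    exact Kernel.measurable _

instance (C : ManyToOne X Y V) : IsMarkovKernel C.kernel := by
  have := C.markov_joint
  refine ⟨fun x => ?_⟩
  exact Measure.isProbabilityMeasure_map
    (C.measurable_assemble.comp measurable_prodMk_left).aemeasurable

/-- The noisy interference condition: the interference is a stochastically degraded version of the
outputs of the receivers that face no interference, with respect to the inputs of their
transmitters. -/
def Degraded (C : ManyToOne X Y V) : Prop :=
  ∃ D : Kernel (∀ j : Fin m, Y j.succ) V, IsMarkovKernel D ∧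
    C.joint.map Prod.fst = D ∘ₖ C.joint.map Prod.snd

end ManyToOne

/-! ### Parallel channels -/

section Parallel

variable {ι : Type*} [Fintype ι] {κ : Type*} [Fintype κ] {X Y : ι → κ → Type*}
  [∀ i k, MeasurableSpace (X i k)] [∀ i k, MeasurableSpace (Y i k)]

/-- The parallel channel with carriers `κ`: given the (vector) inputs, the outputs on the carriers
are independent, and those on carrier `k` are generated from the inputs on carrier `k` by `W k`. -/
def parallel (W : ∀ k, Kernel (∀ i, X i k) (∀ i, Y i k)) [∀ k, IsMarkovKernel (W k)] :
    Kernel (∀ i, ∀ k, X i k) (∀ i, ∀ k, Y i k) where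
  toFun x := (Measure.pi fun k => W k fun i => x i k).map fun y i k => y k i
  measurable' := by
    have h : Measurable fun x : ∀ i, ∀ k, X i k => Measure.pi fun k => W k fun i => x i k := by
      refine Measurable.measure_of_isPiSystem_of_isProbabilityMeasure
        generateFrom_pi.symm isPiSystem_pi ?_
      rintro s ⟨t, ht, rfl⟩
      simp only [Measure.pi_pi]
      refine Finset.measurable_prod _ fun k _ => ?_
      exact (Kernel.measurable_coe (W k) (ht k (Set.mem_univ k))).comp
        (measurable_pi_iff.2 fun i => (measurable_pi_apply k).comp (measurable_pi_apply i))
    refine (Measure.measurable_map _ ?_).comp h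
    exact measurable_pi_iff.2 fun i => measurable_pi_iff.2 fun k =>
      (measurable_pi_apply i).comp (measurable_pi_apply k)

/-- A constraint on the codebooks: each input symbol on each carrier has a cost, and for user `i`
the vector of the average costs on the carriers has to lie in `region i`, where lowering the costs
is always allowed (for example: the sum over the carriers of the average powers is at most `P i`, or
the average power on carrier `k` is at most `P i k`, or no constraint at all). -/
structure CostConstraint (X : ι → κ → Type*) [∀ i k, MeasurableSpace (X i k)] where
  cost : ∀ i k, X i k → ℝ≥0∞
  measurable_cost : ∀ i k, Measurable (cost i k)
  region : ι → Set (κ → ℝ≥0∞)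
  isLowerSet_region : ∀ i, IsLowerSet (region i)

namespace CostConstraint

/-- The vector of the costs on the carriers of a codebook of user `i`, averaged over the (uniformly
distributed) message and over time. -/
def codebookCost (Q : CostConstraint X) (i : ι) {M : Type*} [Fintype M] {T : ℕ}
    (c : M → Fin T → ∀ k, X i k) (k : κ) : ℝ≥0∞ :=
  ((Fintype.card M : ℝ≥0∞) * T)⁻¹ * ∑ w, ∑ τ, Q.cost i k (c w τ k)

/-- `p s i k` is the law of the input of user `i` on carrier `k` in time slot `s`, where the slots
`0, …, N` are used equally often.  Such input laws are feasible if their expected costs, averaged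
over the time slots, satisfy the constraint. -/
def Feasible (Q : CostConstraint X) {N : ℕ}
    (p : Fin (N + 1) → ∀ i k, ProbabilityMeasure (X i k)) : Prop :=
  ∀ i, (fun k => ((N + 1 : ℕ) : ℝ≥0∞)⁻¹ * ∑ s, ∫⁻ x, Q.cost i k x ∂(p s i k : Measure (X i k)))
    ∈ Q.region i

end CostConstraint

variable [DecidableEq ι] [DecidableEq κ]

/-- A rate tuple is achievable for the parallel channel under the constraint `Q` if there is a
sequence of codes of exactly these rates, with codebooks that satisfy the constraint, whose average
probability of error tends to zero. -/
def Achievable (W : ∀ k, Kernel (∀ i, X i k) (∀ i, Y i k)) [∀ k, IsMarkovKernel (W k)]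
    (Q : CostConstraint X) (R : ι → ℝ) : Prop :=
  ∃ (T : ℕ → ℕ) (c : ∀ n, Code (fun i => ∀ k, X i k) (fun i => ∀ k, Y i k) (T n)),
    (∀ n, 0 < T n) ∧ (∀ n i, (c n).rate i = R i) ∧
    (∀ n i, Q.codebookCost i ((c n).enc i) ∈ Q.region i) ∧
    Tendsto (fun n => errorProb (parallel W) (c n).enc (c n).dec) atTop (𝓝 0)

/-- The sum-capacity: the supremum of the sum-rates over the capacity region, which is the closure
of the set of the achievable rate tuples. -/
def sumCapacity (W : ∀ k, Kernel (∀ i, X i k) (∀ i, Y i k)) [∀ k, IsMarkovKernel (W k)]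
    (Q : CostConstraint X) : ℝ≥0∞ :=
  ⨆ R ∈ closure {R : ι → ℝ | Achievable W Q R}, ENNReal.ofReal (∑ i, R i)

/-- The mutual information `I(X_i; Y_i)` on carrier `k`, averaged over the time slots, for input
laws `p` under which all inputs are independent across users, carriers and time. -/
def carrierInfo (W : ∀ k, Kernel (∀ i, X i k) (∀ i, Y i k)) {N : ℕ}
    (p : Fin (N + 1) → ∀ i k, ProbabilityMeasure (X i k)) (i : ι) (k : κ) : ℝ≥0∞ :=
  ((N + 1 : ℕ) : ℝ≥0∞)⁻¹ * ∑ s, userInfo (W k) (fun j => p s j k) i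

/-! ### Separate random coding, treating interference as noise -/

/-- The number of messages in a code of length `T` and of rate (at least) `r`. -/
def msgCount (T : ℕ) (r : ℝ≥0) : ℕ := ⌈Real.exp (T * r)⌉₊

/-- Codebooks of length `T`, one for each user and each carrier, of the rates `r i k`. -/
abbrev Codebooks (X : ι → κ → Type*) (r : ι → κ → ℝ≥0) (T : ℕ) : Type _ :=
  ∀ i k, Fin (msgCount T (r i k)) → Fin T → X i k

/-- Decoding rules for separate coding with interference treated as noise: the decoder of user `i`
for carrier `k` sees only the output of receiver `i` on this carrier, and knows, besides the input
laws and the channel, only the codebook of user `i` on this carrier. -/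
abbrev TINDecoders (X Y : ι → κ → Type*) (r : ι → κ → ℝ≥0) (T : ℕ) : Type _ :=
  ∀ i k, (Fin (msgCount T (r i k)) → Fin T → X i k) → (Fin T → Y i k) →
    Fin (msgCount T (r i k))

/-- The law of the random codebooks: all symbols of all codewords are independent, and symbol `τ` of
a codeword of user `i` on carrier `k` has the law `p s i k` with `s = τ` modulo `N + 1`. -/
def randomCodebooks {N : ℕ} (p : Fin (N + 1) → ∀ i k, ProbabilityMeasure (X i k))
    (r : ι → κ → ℝ≥0) (T : ℕ) : Measure (Codebooks X r T) :=
  Measure.pi fun i => Measure.pi fun k => Measure.pi fun _ => Measure.pi fun τ : Fin T =>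
    (p (Fin.ofNat (N + 1) τ) i k : Measure (X i k))

/-- The encoders of separate coding: the message of user `i` is a tuple of messages, one for each
carrier, and each of them is encoded with the codebook of its carrier. -/
def separateEnc {r : ι → κ → ℝ≥0} {T : ℕ} (c : Codebooks X r T) (i : ι)
    (w : ∀ k, Fin (msgCount T (r i k))) (τ : Fin T) (k : κ) : X i k :=
  c i k (w k) τ

/-- The decoders of separate coding with interference treated as noise. -/
def separateDec {r : ι → κ → ℝ≥0} {T : ℕ} (δ : TINDecoders X Y r T) (c : Codebooks X r T) (i : ι)
    (y : Fin T → ∀ k, Y i k) (k : κ) : Fin (msgCount T (r i k)) :=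
  δ i k (c i k) fun τ => y τ k

/-- Separate random coding from the input laws `p` at the rates `r i k`, with interference treated
as noise, is reliable: for suitable decoding rules, the probability of error, averaged over the
random codebooks, tends to zero. -/
def ReliableTIN (W : ∀ k, Kernel (∀ i, X i k) (∀ i, Y i k)) [∀ k, IsMarkovKernel (W k)] {N : ℕ}
    (p : Fin (N + 1) → ∀ i k, ProbabilityMeasure (X i k)) (r : ι → κ → ℝ≥0) : Prop :=
  ∃ δ : ∀ T, TINDecoders X Y r T,
    (∀ T i k, Measurable (Function.uncurry (δ T i k))) ∧
    Tendsto (fun T => ∫⁻ c, errorProb (parallel W) (separateEnc c) (separateDec (δ T) c)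
      ∂(randomCodebooks p r T)) atTop (𝓝 0)

/-- The random codebooks satisfy the constraint with probability tending to one. -/
def MeetsConstraint (Q : CostConstraint X) {N : ℕ}
    (p : Fin (N + 1) → ∀ i k, ProbabilityMeasure (X i k)) (r : ι → κ → ℝ≥0) : Prop :=
  Tendsto (fun T => randomCodebooks p r T
    {c | ¬ ∀ i, Q.codebookCost i (separateEnc c i) ∈ Q.region i}) atTop (𝓝 0)

end Parallel

/-- The law of the component on carrier `k` of a vector input. -/
def carrierMarginal {κ : Type*} {X : κ → Type*} [∀ k, MeasurableSpace (X k)]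
    (q : ProbabilityMeasure (∀ k, X k)) (k : κ) : ProbabilityMeasure (X k) :=
  q.map (measurable_pi_apply k).aemeasurable

end ParallelIC

end

open ParallelIC

/-!
For independent inputs, the compensation identity and the subadditivity over carriers show that user
`i ≥ 1` loses the total correlation of its outputs: `I(X⃗_i; Y⃗_i) + TC(Y⃗_i) ≤ ∑_k I(X_i; Y_i)`.
User `0` may gain over the separate carriers, but by no more than the total correlation of the
interference. On every carrier the interference is a degraded version of the outputs of the other
users, so by data processing its total correlation is at most `∑_{i ≥ 1} TC(Y⃗_i)`. The gain is
covered by the losses. Applied to the `T · F` uses of carriers by a block code, with Fano's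
inequality, this is the converse.

Conversely, on a single carrier the score of a codeword is the sum of truncated log-likelihood
ratios. Its mean is close to the mutual information (also when this is infinite) and its variance
per letter is bounded, so Chebyshev's inequality and a union bound over the wrong codewords bound
the error. The law of large numbers gives the constraint only if there is some slack, which is
obtained by adding to many repetitions of the given time slots one slot with cheap deterministic
inputs. For finite input alphabets, the mutual informations are continuous in the input laws, which
form a compact space.
-/

noncomputable section

namespace ParallelIC

open InformationTheory

/-! ### Finite products of measures and of kernels -/

section Pi

variable {ι : Type*} [Fintype ι] {A B : ι → Type*}
  [∀ i, MeasurableSpace (A i)] [∀ i, MeasurableSpace (B i)]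

lemma lintegral_prod_pi (μ : ∀ i, Measure (A i)) [∀ i, IsProbabilityMeasure (μ i)]
    {f : ∀ i, A i → ℝ≥0∞} (hf : ∀ i, Measurable (f i)) :
    ∫⁻ x, ∏ i, f i (x i) ∂(Measure.pi μ) = ∏ i, ∫⁻ a, f i a ∂(μ i) := by
  refine (lintegral_prod_eq_prod_lintegral_of_indepFun Finset.univ
    (fun i (x : ∀ i, A i) => f i (x i))
    (iIndepFun_pi fun i => (hf i).aemeasurable)
    fun i => (hf i).comp (measurable_pi_apply i)).trans ?_
  exact Finset.prod_congr rfl fun i _ => (measurePreserving_eval μ i).lintegral_comp (hf i)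

lemma map_eval_pi (μ : ∀ i, Measure (A i)) [∀ i, IsProbabilityMeasure (μ i)] (i : ι) :
    (Measure.pi μ).map (fun x => x i) = μ i :=
  (measurePreserving_eval μ i).map_eq

instance isProbabilityMeasure_map_eval (P : Measure (∀ i, A i)) [IsProbabilityMeasure P] (i : ι) :
    IsProbabilityMeasure (P.map fun x => x i) :=
  Measure.isProbabilityMeasure_map (measurable_pi_apply i).aemeasurable

/-- The product of finitely many Markov kernels: the channel that applies `κ i` to coordinate `i`,
independently over `i`. -/
def piKernel (κ : ∀ i, Kernel (A i) (B i)) [∀ i, IsMarkovKernel (κ i)] :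
    Kernel (∀ i, A i) (∀ i, B i) where
  toFun x := Measure.pi fun i => κ i (x i)
  measurable' := by
    refine Measurable.measure_of_isPiSystem_of_isProbabilityMeasure
      generateFrom_pi.symm isPiSystem_pi ?_
    rintro s ⟨t, ht, rfl⟩
    simp only [Measure.pi_pi]
    exact Finset.measurable_prod _ fun i _ =>
      ((κ i).measurable_coe (ht i (Set.mem_univ i))).comp (measurable_pi_apply i)

lemma piKernel_apply (κ : ∀ i, Kernel (A i) (B i)) [∀ i, IsMarkovKernel (κ i)] (x : ∀ i, A i) :
    piKernel κ x = Measure.pi fun i => κ i (x i) := rfl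

instance (κ : ∀ i, Kernel (A i) (B i)) [∀ i, IsMarkovKernel (κ i)] :
    IsMarkovKernel (piKernel κ) :=
  ⟨fun x => by rw [piKernel_apply]; infer_instance⟩

lemma piKernel_map_eval (κ : ∀ i, Kernel (A i) (B i)) [∀ i, IsMarkovKernel (κ i)] (i : ι) :
    (piKernel κ).map (fun y => y i) = (κ i).comap (fun x => x i) (measurable_pi_apply i) := by
  ext1 x
  rw [Kernel.map_apply _ (measurable_pi_apply i), piKernel_apply, map_eval_pi, Kernel.comap_apply]

lemma piKernel_comp_pi (κ : ∀ i, Kernel (A i) (B i)) [∀ i, IsMarkovKernel (κ i)]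
    (μ : ∀ i, Measure (A i)) [∀ i, IsProbabilityMeasure (μ i)] :
    piKernel κ ∘ₘ Measure.pi μ = Measure.pi fun i => κ i ∘ₘ μ i := by
  refine (Measure.pi_eq fun s hs => ?_).symm
  simp only [Measure.bind_apply (MeasurableSet.univ_pi hs) (Kernel.aemeasurable _), piKernel_apply,
    Measure.pi_pi, lintegral_prod_pi μ fun i => (κ i).measurable_coe (hs i),
    Measure.bind_apply (hs _) (Kernel.aemeasurable _)]

lemma comp_map_eq_comap_comp {α β γ : Type*} [MeasurableSpace α] [MeasurableSpace β]
    [MeasurableSpace γ] (μ : Measure α) {f : α → β} (hf : Measurable f) (κ : Kernel β γ) :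
    κ ∘ₘ μ.map f = κ.comap f hf ∘ₘ μ := by
  rw [← Measure.deterministic_comp_eq_map hf, Measure.comp_assoc,
    Kernel.comp_deterministic_eq_comap]

lemma map_eval_piKernel_comp (κ : ∀ i, Kernel (A i) (B i)) [∀ i, IsMarkovKernel (κ i)]
    (P : Measure (∀ i, A i)) (i : ι) :
    (piKernel κ ∘ₘ P).map (fun y => y i) = κ i ∘ₘ P.map fun x => x i := by
  rw [Measure.map_comp _ _ (measurable_pi_apply i), piKernel_map_eval,
    comp_map_eq_comap_comp _ (measurable_pi_apply i)]

omit [Fintype ι] in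
lemma measurable_pi_prodMk :
    Measurable fun (z : (∀ i, A i) × ∀ i, B i) i => (z.1 i, z.2 i) := by
  fun_prop

lemma pi_compProd_piKernel (κ : ∀ i, Kernel (A i) (B i)) [∀ i, IsMarkovKernel (κ i)]
    (μ : ∀ i, Measure (A i)) [∀ i, IsProbabilityMeasure (μ i)] :
    (Measure.pi μ ⊗ₘ piKernel κ).map (fun z i => (z.1 i, z.2 i)) =
      Measure.pi fun i => μ i ⊗ₘ κ i := by
  refine (Measure.pi_eq fun s hs => ?_).symm
  have hfibre : ∀ x : ∀ i, A i, piKernel κ x (Prod.mk x ⁻¹' ((fun z i => (z.1 i, z.2 i)) ⁻¹'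
      Set.univ.pi s)) = ∏ i, κ i (x i) (Prod.mk (x i) ⁻¹' s i) := fun x => by
    rw [piKernel_apply, ← Measure.pi_pi]
    rfl
  rw [Measure.map_apply measurable_pi_prodMk (MeasurableSet.univ_pi hs),
    Measure.compProd_apply (measurable_pi_prodMk (MeasurableSet.univ_pi hs))]
  simp only [hfibre, Measure.compProd_apply (hs _)]
  exact lintegral_prod_pi μ fun i => Kernel.measurable_kernel_prodMk_left (hs i)

lemma pi_prod_pi (μ : ∀ i, Measure (A i)) [∀ i, IsProbabilityMeasure (μ i)]
    (ν : ∀ i, Measure (B i)) [∀ i, IsProbabilityMeasure (ν i)] :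
    ((Measure.pi μ).prod (Measure.pi ν)).map (fun z i => (z.1 i, z.2 i)) =
      Measure.pi fun i => (μ i).prod (ν i) := by
  have hconst : piKernel (fun i => Kernel.const (A i) (ν i)) = Kernel.const _ (Measure.pi ν) := by
    ext1
    simp [piKernel_apply]
  simpa [hconst, Measure.compProd_const] using
    pi_compProd_piKernel (fun i => Kernel.const (A i) (ν i)) μ

lemma pi_prod_map_update [DecidableEq ι] (μ : ∀ i, Measure (A i))
    [∀ i, IsProbabilityMeasure (μ i)] (i : ι) :
    ((Measure.pi μ).prod (μ i)).map (fun z => Function.update z.1 i z.2) = Measure.pi μ := by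
  obtain ⟨x₀⟩ : Nonempty (∀ i, A i) := (Measure.pi μ).nonempty_of_neZero
  refine Measure.ext_of_lintegral _ fun f hf => ?_
  have hfu : Measurable fun z : (∀ j, A j) × A i => f (Function.update z.1 i z.2) :=
    hf.comp measurable_update'
  rw [lintegral_map hf measurable_update', lintegral_prod _ hfu.aemeasurable,
    lintegral_eq_lmarginal_univ x₀, lintegral_eq_lmarginal_univ x₀,
    lmarginal_erase' _ hf (Finset.mem_univ i),
    lmarginal_erase' _ hfu.lintegral_prod_right' (Finset.mem_univ i)]
  simp

lemma lintegral_pi_update [DecidableEq ι] (μ : ∀ i, Measure (A i))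
    [∀ i, IsProbabilityMeasure (μ i)] (i : ι) {f : (∀ i, A i) → ℝ≥0∞} (hf : Measurable f) :
    ∫⁻ x, f x ∂(Measure.pi μ) =
      ∫⁻ a, ∫⁻ x, f (Function.update x i a) ∂(Measure.pi μ) ∂(μ i) := by
  conv_lhs => rw [← pi_prod_map_update μ i]
  rw [lintegral_map hf measurable_update']
  exact lintegral_prod_symm' _ (hf.comp measurable_update')

end Pi

section PiPi

variable {ι κ : Type*} {X : ι → κ → Type*} [∀ i k, MeasurableSpace (X i k)]

lemma measurable_swap_pi : Measurable fun (x : ∀ k i, X i k) i k => x k i := by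
  fun_prop

lemma measurable_curry_pi : Measurable fun (x : ∀ z : ι × κ, X z.1 z.2) i k => x (i, k) :=
  measurable_pi_iff.2 fun i => measurable_pi_iff.2 fun k =>
    measurable_pi_apply (X := fun z : ι × κ => X z.1 z.2) (i, k)

variable [Fintype ι] [Fintype κ]

lemma pi_pi_eq (μ : ∀ i k, Measure (X i k)) [∀ i k, IsProbabilityMeasure (μ i k)]
    {ν : Measure (∀ i k, X i k)}
    (h : ∀ s : ∀ i k, Set (X i k), (∀ i k, MeasurableSet (s i k)) →
      ν (Set.univ.pi fun i => Set.univ.pi (s i)) = ∏ i, ∏ k, μ i k (s i k)) :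
    Measure.pi (fun i => Measure.pi (μ i)) = ν := by
  classical
  refine Measure.pi_eq_generateFrom (C := fun i => Set.pi Set.univ ''
    Set.pi Set.univ fun k => {s : Set (X i k) | MeasurableSet s}) (fun i => generateFrom_pi)
    (fun i => isPiSystem_pi) (fun i => ?_) fun s hs => ?_
  · exact ⟨fun _ => Set.univ, fun _ => ⟨fun _ => Set.univ, by simp, by simp⟩,
      fun _ => measure_lt_top _ _, Set.iUnion_const _⟩
  · choose t ht hts using hs
    obtain rfl : (fun i => Set.univ.pi (t i)) = s := funext hts
    simp only [Measure.pi_pi, h t fun i k => ht i k (Set.mem_univ k)]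

lemma pi_pi_map_swap (μ : ∀ i k, Measure (X i k)) [∀ i k, IsProbabilityMeasure (μ i k)] :
    (Measure.pi fun k => Measure.pi fun i => μ i k).map (fun x i k => x k i) =
      Measure.pi fun i => Measure.pi (μ i) := by
  refine (pi_pi_eq μ fun s hs => ?_).symm
  have hpre : (fun (x : ∀ k i, X i k) i k => x k i) ⁻¹'
      (Set.univ.pi fun i => Set.univ.pi (s i)) =
        Set.univ.pi fun k => Set.univ.pi fun i => s i k := by
    ext x
    simpa using forall_comm
  rw [Measure.map_apply measurable_swap_pi
    (.univ_pi fun i => .univ_pi fun k => hs i k), hpre]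
  simp only [Measure.pi_pi]
  exact Finset.prod_comm

lemma pi_map_curry (μ : ∀ i k, Measure (X i k)) [∀ i k, IsProbabilityMeasure (μ i k)] :
    (Measure.pi fun z : ι × κ => μ z.1 z.2).map (fun x i k => x (i, k)) =
      Measure.pi fun i => Measure.pi (μ i) := by
  refine (pi_pi_eq μ fun s hs => ?_).symm
  have hpre : (fun (x : ∀ z : ι × κ, X z.1 z.2) i k => x (i, k)) ⁻¹'
      (Set.univ.pi fun i => Set.univ.pi (s i)) = Set.univ.pi fun z : ι × κ => s z.1 z.2 := by
    ext x
    simp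
  rw [Measure.map_apply measurable_curry_pi (.univ_pi fun i => .univ_pi fun k => hs i k), hpre]
  simp only [Measure.pi_pi]
  exact Fintype.prod_prod_type _

end PiPi

/-! ### Kullback-Leibler divergence -/

section KL

variable {α β γ : Type*} [MeasurableSpace α] [MeasurableSpace β] [MeasurableSpace γ]

lemma klDiv_of_integrable_llr {μ ν : Measure α} [IsProbabilityMeasure μ]
    [IsProbabilityMeasure ν] (hac : μ ≪ ν) (hint : Integrable (llr μ ν) μ) :
    klDiv μ ν = ENNReal.ofReal (∫ x, llr μ ν x ∂μ) := by
  simp [klDiv_of_ac_of_integrable hac hint]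

lemma integral_llr_nonneg {μ ν : Measure α} [IsProbabilityMeasure μ] [IsProbabilityMeasure ν]
    (hac : μ ≪ ν) : 0 ≤ ∫ x, llr μ ν x ∂μ :=
  toReal_klDiv_of_measure_eq hac (by simp) ▸ ENNReal.toReal_nonneg

lemma absolutelyContinuous_withDensity_of_ae_ne_zero {μ ξ : Measure α} {d : α → ℝ≥0∞}
    (hd : Measurable d) (hac : μ ≪ ξ) (hpos : ∀ᵐ x ∂μ, d x ≠ 0) : μ ≪ ξ.withDensity d := by
  intro s hs
  rw [withDensity_apply_eq_zero hd] at hs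
  refine measure_mono_null_ae ?_ (hac hs)
  filter_upwards [hpos] with x hx hxs using ⟨hx, hxs⟩

section ChangeOfReference

variable {μ ξ : Measure α} [IsProbabilityMeasure μ] [IsProbabilityMeasure ξ] {d : α → ℝ≥0∞}
  [IsProbabilityMeasure (ξ.withDensity d)]

lemma llr_ae_eq_llr_withDensity_add (hd : Measurable d) (hac : μ ≪ ξ.withDensity d) :
    llr μ ξ =ᵐ[μ] fun x => llr μ (ξ.withDensity d) x + Real.log (d x).toReal := by
  have hacξ : μ ≪ ξ := hac.trans (withDensity_absolutelyContinuous _ _)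
  filter_upwards [hacξ (Measure.rnDeriv_withDensity ξ hd),
    hacξ (Measure.rnDeriv_mul_rnDeriv (κ := ξ) hac), Measure.rnDeriv_pos hacξ,
    hacξ (Measure.rnDeriv_lt_top μ ξ)] with x hdx hchain hpos htop
  have hne : (μ.rnDeriv ξ x).toReal ≠ 0 := (ENNReal.toReal_pos hpos.ne' htop.ne).ne'
  rw [Pi.mul_apply, hdx] at hchain
  rw [← hchain, ENNReal.toReal_mul] at hne
  simp only [llr]
  obtain ⟨hne₁, hne₂⟩ := mul_ne_zero_iff.1 hne
  rw [← hchain, ENNReal.toReal_mul, Real.log_mul hne₁ hne₂]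

theorem klDiv_eq_klDiv_withDensity_add (hd : Measurable d) (hpos : ∀ᵐ x ∂μ, d x ≠ 0)
    (hint : Integrable (fun x => Real.log (d x).toReal) μ)
    (hnonneg : 0 ≤ ∫ x, Real.log (d x).toReal ∂μ) :
    klDiv μ ξ = klDiv μ (ξ.withDensity d) + ENNReal.ofReal (∫ x, Real.log (d x).toReal ∂μ) := by
  by_cases hac : μ ≪ ξ
  swap
  · rw [klDiv_of_not_ac hac, klDiv_of_not_ac
      fun h => hac (h.trans (withDensity_absolutelyContinuous _ _)), top_add]
  have hac' : μ ≪ ξ.withDensity d := absolutelyContinuous_withDensity_of_ae_ne_zero hd hac hpos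
  have hllr := llr_ae_eq_llr_withDensity_add hd hac'
  have hint_iff : Integrable (llr μ ξ) μ ↔ Integrable (llr μ (ξ.withDensity d)) μ :=
    (integrable_congr hllr).trans (integrable_add_iff_integrable_left hint)
  by_cases hllr_int : Integrable (llr μ (ξ.withDensity d)) μ
  · rw [klDiv_of_integrable_llr hac (hint_iff.2 hllr_int), klDiv_of_integrable_llr hac' hllr_int,
      integral_congr_ae hllr, integral_add hllr_int hint,
      ENNReal.ofReal_add (integral_llr_nonneg hac') hnonneg]
  · rw [klDiv_of_not_integrable (mt hint_iff.1 hllr_int), klDiv_of_not_integrable hllr_int, top_add]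

end ChangeOfReference

theorem klDiv_eq_klDiv_withDensity_add_sum {κ : Type*} [Fintype κ] {Y : κ → Type*}
    [∀ k, MeasurableSpace (Y k)] {μ ξ : Measure α} [IsProbabilityMeasure μ]
    [IsProbabilityMeasure ξ] {g : ∀ k, α → Y k} (hg : ∀ k, Measurable (g k))
    (Q : ∀ k, Measure (Y k)) [∀ k, IsProbabilityMeasure (Q k)]
    (hfin : ∀ k, klDiv (μ.map (g k)) (Q k) ≠ ∞)
    [IsProbabilityMeasure (ξ.withDensity fun x => ∏ k, (μ.map (g k)).rnDeriv (Q k) (g k x))] :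
    klDiv μ ξ = klDiv μ (ξ.withDensity fun x => ∏ k, (μ.map (g k)).rnDeriv (Q k) (g k x)) +
      ∑ k, klDiv (μ.map (g k)) (Q k) := by
  have (k : κ) : IsProbabilityMeasure (μ.map (g k)) :=
    Measure.isProbabilityMeasure_map (hg k).aemeasurable
  choose hac hint using fun k => klDiv_ne_top_iff.1 (hfin k)
  have hpos : ∀ᵐ x ∂μ, ∀ k, 0 < (μ.map (g k)).rnDeriv (Q k) (g k x) :=
    ae_all_iff.2 fun k => ae_of_ae_map (hg k).aemeasurable (Measure.rnDeriv_pos (hac k))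
  have htop : ∀ᵐ x ∂μ, ∀ k, (μ.map (g k)).rnDeriv (Q k) (g k x) < ∞ :=
    ae_all_iff.2 fun k => ae_of_ae_map (hg k).aemeasurable (hac k (Measure.rnDeriv_lt_top _ _))
  have hd : Measurable fun x => ∏ k, (μ.map (g k)).rnDeriv (Q k) (g k x) := by fun_prop
  have hd_ne : ∀ᵐ x ∂μ, ∏ k, (μ.map (g k)).rnDeriv (Q k) (g k x) ≠ 0 := by
    filter_upwards [hpos] with x hx using Finset.prod_ne_zero_iff.2 fun k _ => (hx k).ne'
  have hlog : (fun x => Real.log (∏ k, (μ.map (g k)).rnDeriv (Q k) (g k x)).toReal) =ᵐ[μ]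
      fun x => ∑ k, llr (μ.map (g k)) (Q k) (g k x) := by
    filter_upwards [hpos, htop] with x hx hx'
    rw [ENNReal.toReal_prod,
      Real.log_prod fun k _ => (ENNReal.toReal_pos (hx k).ne' (hx' k).ne).ne']
    rfl
  have hint_comp (k : κ) : Integrable (fun x => llr (μ.map (g k)) (Q k) (g k x)) μ :=
    (hint k).comp_measurable (hg k)
  have hintegral : ∫ x, Real.log (∏ k, (μ.map (g k)).rnDeriv (Q k) (g k x)).toReal ∂μ =
      ∑ k, ∫ y, llr (μ.map (g k)) (Q k) y ∂(μ.map (g k)) := by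
    rw [integral_congr_ae hlog, integral_finsetSum _ fun k _ => hint_comp k]
    exact Finset.sum_congr rfl fun k _ => (integral_map (hg k).aemeasurable
      (measurable_llr _ _).aestronglyMeasurable).symm
  have hnonneg (k : κ) (_ : k ∈ Finset.univ) := integral_llr_nonneg (hac k)
  rw [klDiv_eq_klDiv_withDensity_add hd hd_ne
    ((integrable_congr hlog).2 (integrable_finsetSum _ fun k _ => hint_comp k))
    (hintegral ▸ Finset.sum_nonneg hnonneg), hintegral, ENNReal.ofReal_sum_of_nonneg hnonneg]
  simp only [klDiv_of_integrable_llr (hac _) (hint _)]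

section Kernel

variable [MeasurableSpace.CountableOrCountablyGenerated α β]

lemma klDiv_apply_eq_ite (κ η : Kernel α β) [IsFiniteKernel κ] [IsFiniteKernel η] (a : α)
    [Decidable (κ a ≪ η a)] :
    klDiv (κ a) (η a) = if κ a ≪ η a then
      ∫⁻ b, ENNReal.ofReal (klFun (Kernel.rnDeriv κ η a b).toReal) ∂(η a) else ∞ := by
  split_ifs with h
  · rw [klDiv_eq_lintegral_klFun_of_ac h]
    refine lintegral_congr_ae ?_
    filter_upwards [Kernel.rnDeriv_eq_rnDeriv_measure (κ := κ) (η := η) (a := a)] with b hb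
    rw [hb]
  · exact klDiv_of_not_ac h

lemma measurable_klDiv_apply (κ η : Kernel α β) [IsFiniteKernel κ] [IsFiniteKernel η] :
    Measurable fun a => klDiv (κ a) (η a) := by
  classical
  simp only [klDiv_apply_eq_ite]
  refine Measurable.ite (Kernel.measurableSet_absolutelyContinuous κ η) ?_ measurable_const
  refine Measurable.lintegral_kernel_prod_right (f := fun a b =>
    ENNReal.ofReal (klFun (Kernel.rnDeriv κ η a b).toReal)) ?_
  exact ENNReal.measurable_ofReal.comp (measurable_klFun.comp
    (Kernel.measurable_rnDeriv κ η).ennreal_toReal)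

lemma rnDeriv_compProd_ae_eq {μ : Measure α} [IsFiniteMeasure μ] {κ η : Kernel α β}
    [IsFiniteKernel κ] [IsFiniteKernel η] (hac : ∀ᵐ a ∂μ, κ a ≪ η a) :
    (μ ⊗ₘ κ).rnDeriv (μ ⊗ₘ η) =ᵐ[μ ⊗ₘ η] fun z => Kernel.rnDeriv κ η z.1 z.2 := by
  have hm := Kernel.measurable_rnDeriv κ η
  have hdens : μ ⊗ₘ κ = (μ ⊗ₘ η).withDensity fun z => Kernel.rnDeriv κ η z.1 z.2 := by
    rw [← Measure.compProd_withDensity hm]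
    refine Measure.compProd_congr ?_
    filter_upwards [hac] with a ha using (Kernel.withDensity_rnDeriv_eq ha).symm
  conv_lhs => rw [hdens]
  exact Measure.rnDeriv_withDensity _ hm

theorem klDiv_compProd_eq_lintegral (μ : Measure α) [IsFiniteMeasure μ] (κ η : Kernel α β)
    [IsFiniteKernel κ] [IsFiniteKernel η] :
    klDiv (μ ⊗ₘ κ) (μ ⊗ₘ η) = ∫⁻ a, klDiv (κ a) (η a) ∂μ := by
  classical
  by_cases hac : ∀ᵐ a ∂μ, κ a ≪ η a
  · have hm : Measurable fun z : α × β =>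
        ENNReal.ofReal (klFun (Kernel.rnDeriv κ η z.1 z.2).toReal) :=
      ENNReal.measurable_ofReal.comp (measurable_klFun.comp
        (Kernel.measurable_rnDeriv κ η).ennreal_toReal)
    rw [klDiv_eq_lintegral_klFun_of_ac (Measure.absolutelyContinuous_compProd_right_iff.2 hac),
      lintegral_congr_ae ((rnDeriv_compProd_ae_eq hac).mono fun z hz => by rw [hz]),
      Measure.lintegral_compProd hm]
    refine lintegral_congr_ae ?_
    filter_upwards [hac] with a ha
    rw [klDiv_apply_eq_ite, if_pos ha]
  · rw [klDiv_of_not_ac (mt Measure.absolutelyContinuous_compProd_right_iff.1 hac)]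
    by_contra! hne
    refine hac ?_
    filter_upwards [ae_lt_top (measurable_klDiv_apply κ η) hne.symm] with a ha
    exact (klDiv_ne_top_iff.1 ha.ne).1

end Kernel

lemma mutualInfo_compProd (p : Measure α) [IsProbabilityMeasure p] (U : Kernel α β)
    [IsMarkovKernel U] : mutualInfo (p ⊗ₘ U) = klDiv (p ⊗ₘ U) (p.prod (U ∘ₘ p)) := by
  rw [mutualInfo, Measure.fst_compProd, Measure.snd_compProd]

lemma mutualInfo_compProd_eq_lintegral [MeasurableSpace.CountableOrCountablyGenerated α β]
    (p : Measure α) [IsProbabilityMeasure p] (U : Kernel α β) [IsMarkovKernel U] :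
    mutualInfo (p ⊗ₘ U) = ∫⁻ x, klDiv (U x) (U ∘ₘ p) ∂p := by
  rw [mutualInfo_compProd, ← Measure.compProd_const, klDiv_compProd_eq_lintegral]
  rfl

theorem klDiv_compProd_prod (p : Measure α) [IsProbabilityMeasure p] (U : Kernel α β)
    [IsMarkovKernel U] (R : Measure β) [IsProbabilityMeasure R] :
    klDiv (p ⊗ₘ U) (p.prod R) = mutualInfo (p ⊗ₘ U) + klDiv (U ∘ₘ p) R := by
  have hsnd : (p ⊗ₘ U).map Prod.snd = U ∘ₘ p := Measure.snd_compProd p U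
  rw [mutualInfo_compProd]
  by_cases hfin : klDiv (U ∘ₘ p) R = ∞
  · have hle := klDiv_map_le (p ⊗ₘ U) (p.prod R) measurable_snd
    rw [hsnd, Measure.map_snd_prod, measure_univ, one_smul, hfin, top_le_iff] at hle
    rw [hle, hfin, add_top]
  · have hdens : ((p.prod R).withDensity fun z => ∏ _ : Unit, (U ∘ₘ p).rnDeriv R z.2) =
        p.prod (U ∘ₘ p) := by
      conv_rhs => rw [← Measure.withDensity_rnDeriv_eq _ _ (klDiv_ne_top_iff.1 hfin).1]
      simpa using (prod_withDensity_right (Measure.measurable_rnDeriv _ _)).symm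
    rw [← hsnd] at hdens
    have : IsProbabilityMeasure ((p.prod R).withDensity
        fun z => ∏ _ : Unit, ((p ⊗ₘ U).map Prod.snd).rnDeriv R z.2) := by
      rw [hdens, hsnd]
      infer_instance
    have h := klDiv_eq_klDiv_withDensity_add_sum (μ := p ⊗ₘ U) (ξ := p.prod R)
      (fun _ : Unit => measurable_snd) (fun _ => R) fun _ => hsnd ▸ hfin
    simp only [hdens] at h
    simpa only [Fintype.sum_unique, hsnd] using h

lemma mutualInfo_compProd_comap [MeasurableSpace.CountablyGenerated β] (p : Measure γ)
    [IsProbabilityMeasure p] (U : Kernel α β) [IsMarkovKernel U] {e : γ → α}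
    (he : Measurable e) :
    mutualInfo (p ⊗ₘ U.comap e he) = mutualInfo (p.map e ⊗ₘ U) := by
  have : IsProbabilityMeasure (p.map e) := Measure.isProbabilityMeasure_map he.aemeasurable
  rw [mutualInfo_compProd_eq_lintegral, mutualInfo_compProd_eq_lintegral,
    ← comp_map_eq_comap_comp]
  exact (lintegral_map (measurable_klDiv_apply U (Kernel.const α (U ∘ₘ p.map e))) he).symm

end KL

/-! ### Total correlation -/

section Product

variable {κ : Type*} [Fintype κ] {Y Z : κ → Type*} [∀ k, MeasurableSpace (Y k)]
  [∀ k, MeasurableSpace (Z k)]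

lemma prod_indicator_apply {M : κ → Type*} (s : ∀ k, Set (M k)) (d : ∀ k, M k → ℝ≥0∞)
    (y : ∀ k, M k) :
    ∏ k, (s k).indicator (d k) (y k) =
      (Set.univ.pi s).indicator (fun y => ∏ k, d k (y k)) y := by
  by_cases hy : y ∈ Set.univ.pi s
  · rw [Set.indicator_of_mem hy]
    exact Finset.prod_congr rfl fun k _ => Set.indicator_of_mem (hy k (Set.mem_univ k)) _
  · rw [Set.indicator_of_notMem hy]
    obtain ⟨k, hk⟩ : ∃ k, y k ∉ s k := by simpa using hy
    exact Finset.prod_eq_zero (Finset.mem_univ k) (Set.indicator_of_notMem hk _)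

lemma pi_withDensity (Q : ∀ k, Measure (Y k)) [∀ k, IsProbabilityMeasure (Q k)]
    {d : ∀ k, Y k → ℝ≥0∞} (hd : ∀ k, Measurable (d k))
    [∀ k, IsProbabilityMeasure ((Q k).withDensity (d k))] :
    (Measure.pi Q).withDensity (fun y => ∏ k, d k (y k)) =
      Measure.pi fun k => (Q k).withDensity (d k) := by
  refine (Measure.pi_eq fun s hs => ?_).symm
  rw [withDensity_apply _ (.univ_pi hs), ← lintegral_indicator (.univ_pi hs)]
  simp only [← prod_indicator_apply, lintegral_prod_pi Q fun k => (hd k).indicator (hs k),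
    lintegral_indicator (hs _), withDensity_apply _ (hs _)]

/-- The total correlation: the divergence of a joint law from the product of its marginals. -/
def totalCorr (P : Measure (∀ k, Y k)) : ℝ≥0∞ :=
  klDiv P (Measure.pi fun k => P.map fun y => y k)

theorem klDiv_pi_eq (P : Measure (∀ k, Y k)) [IsProbabilityMeasure P]
    (Q : ∀ k, Measure (Y k)) [∀ k, IsProbabilityMeasure (Q k)] :
    klDiv P (Measure.pi Q) = totalCorr P + ∑ k, klDiv (P.map fun y => y k) (Q k) := by
  by_cases hfin : ∀ k, klDiv (P.map fun y => y k) (Q k) ≠ ∞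
  · have hdens (k : κ) : (Q k).withDensity ((P.map fun y => y k).rnDeriv (Q k)) =
        P.map fun y => y k :=
      Measure.withDensity_rnDeriv_eq _ _ (klDiv_ne_top_iff.1 (hfin k)).1
    have (k : κ) :
        IsProbabilityMeasure ((Q k).withDensity ((P.map fun y => y k).rnDeriv (Q k))) := by
      rw [hdens]
      infer_instance
    have hpi : (Measure.pi Q).withDensity
        (fun y => ∏ k, (P.map fun y => y k).rnDeriv (Q k) (y k)) =
          Measure.pi fun k => P.map fun y => y k := by
      rw [pi_withDensity Q fun k => Measure.measurable_rnDeriv _ _]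
      simp only [hdens]
    have : IsProbabilityMeasure ((Measure.pi Q).withDensity
        (fun y => ∏ k, (P.map fun y => y k).rnDeriv (Q k) (y k))) := by
      rw [hpi]
      infer_instance
    rw [klDiv_eq_klDiv_withDensity_add_sum measurable_pi_apply Q hfin, hpi, totalCorr]
  · obtain ⟨k, hk⟩ : ∃ k, klDiv (P.map fun y => y k) (Q k) = ∞ := by simpa using hfin
    have hle := klDiv_map_le P (Measure.pi Q) (measurable_pi_apply k)
    rw [map_eval_pi, hk, top_le_iff] at hle
    rw [hle, ENNReal.sum_eq_top.2 ⟨k, Finset.mem_univ k, hk⟩, add_top]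

lemma totalCorr_pi (P : ∀ k, Measure (Y k)) [∀ k, IsProbabilityMeasure (P k)] :
    totalCorr (Measure.pi P) = 0 := by
  simp only [totalCorr, map_eval_pi, klDiv_self]

lemma klDiv_pi_pi (P Q : ∀ k, Measure (Y k)) [∀ k, IsProbabilityMeasure (P k)]
    [∀ k, IsProbabilityMeasure (Q k)] :
    klDiv (Measure.pi P) (Measure.pi Q) = ∑ k, klDiv (P k) (Q k) := by
  rw [klDiv_pi_eq, totalCorr_pi, zero_add]
  simp only [map_eval_pi]

theorem totalCorr_piKernel_le (P : Measure (∀ k, Y k)) [IsProbabilityMeasure P]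
    (D : ∀ k, Kernel (Y k) (Z k)) [∀ k, IsMarkovKernel (D k)] :
    totalCorr (piKernel D ∘ₘ P) ≤ totalCorr P := by
  simp only [totalCorr, map_eval_piKernel_comp]
  rw [← piKernel_comp_pi]
  exact klDiv_comp_right_le _ _ _

lemma totalCorr_map_le (P : Measure (∀ k, Y k)) [IsProbabilityMeasure P] {f : ∀ k, Y k → Z k}
    (hf : ∀ k, Measurable (f k)) : totalCorr (P.map fun y k => f k (y k)) ≤ totalCorr P := by
  have hfm : Measurable fun (y : ∀ k, Y k) k => f k (y k) := by fun_prop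
  have hmarginal (k : κ) :
      (P.map fun y k => f k (y k)).map (fun z => z k) = (P.map fun y => y k).map (f k) := by
    rw [Measure.map_map (measurable_pi_apply k) hfm, Measure.map_map (hf k) (measurable_pi_apply k)]
    rfl
  have (k : κ) : IsProbabilityMeasure ((P.map fun y => y k).map (f k)) :=
    Measure.isProbabilityMeasure_map (hf k).aemeasurable
  simp only [totalCorr, hmarginal]
  rw [← Measure.pi_map_pi fun k => (hf k).aemeasurable]
  exact klDiv_map_le _ _ hfm

end Product

/-! ### The channels of the single users -/

section UserChannel

variable {ι : Type*} [Fintype ι] [DecidableEq ι] {X Y : ι → Type*}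
  [∀ i, MeasurableSpace (X i)] [∀ i, MeasurableSpace (Y i)]

/-- The channel from the input to the output of user `i`, when the other users send independent
inputs with the laws `p j` and are treated as noise. The input overwrites coordinate `i` of a sample
from `Measure.pi p`, so that no product over the other users is needed. -/
def userChannel (W : Kernel (∀ i, X i) (∀ i, Y i)) (p : ∀ i, Measure (X i)) (i : ι) :
    Kernel (X i) (Y i) :=
  (W.map fun y => y i) ∘ₖ
    ((Kernel.const (X i) (Measure.pi p) ×ₖ Kernel.id).map fun z => Function.update z.1 i z.2)

variable (W : Kernel (∀ i, X i) (∀ i, Y i)) (p : ∀ i, Measure (X i))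
  [∀ i, IsProbabilityMeasure (p i)]

omit [Fintype ι] in
lemma measurable_update_const (i : ι) (a : X i) :
    Measurable fun z : ∀ j, X j => Function.update z i a :=
  measurable_update'.comp measurable_prodMk_right

lemma userChannel_apply (i : ι) (a : X i) :
    userChannel W p i a =
      (W.map fun y => y i) ∘ₘ (Measure.pi p).map fun z => Function.update z i a := by
  rw [userChannel, Kernel.comp_apply, Kernel.map_apply _ measurable_update', Kernel.prod_apply,
    Kernel.const_apply, Kernel.id_apply, Measure.prod_dirac,
    Measure.map_map measurable_update' measurable_prodMk_right]
  rfl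

instance [IsMarkovKernel W] (i : ι) : IsMarkovKernel (userChannel W p i) := by
  have := Kernel.IsMarkovKernel.map W (measurable_pi_apply i)
  have := Kernel.IsMarkovKernel.map (Kernel.const (X i) (Measure.pi p) ×ₖ Kernel.id)
    (measurable_update' (a := i))
  unfold userChannel
  infer_instance

lemma pi_compProd_map_eval [IsMarkovKernel W] (i : ι) :
    (Measure.pi p ⊗ₘ W).map (fun z => (z.1 i, z.2 i)) = p i ⊗ₘ userChannel W p i := by
  have hm : Measurable fun z : (∀ i, X i) × (∀ i, Y i) => (z.1 i, z.2 i) := by fun_prop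
  ext s hs
  rw [Measure.map_apply hm hs, Measure.compProd_apply (hm hs), Measure.compProd_apply hs,
    lintegral_pi_update p i (Kernel.measurable_kernel_prodMk_left (hm hs))]
  refine lintegral_congr fun a => ?_
  rw [userChannel_apply, Measure.bind_apply (measurable_prodMk_left hs) (Kernel.aemeasurable _),
    lintegral_map (Kernel.measurable_coe _ (measurable_prodMk_left hs))
      (measurable_update_const i a)]
  refine lintegral_congr fun z => ?_
  rw [Kernel.map_apply' _ (measurable_pi_apply i) _ (measurable_prodMk_left hs)]
  simp only [Set.preimage_preimage, Function.update_self]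

lemma userInfo_eq_mutualInfo_userChannel [IsMarkovKernel W] (p : ∀ i, ProbabilityMeasure (X i))
    (i : ι) :
    userInfo W p i =
      mutualInfo ((p i : Measure (X i)) ⊗ₘ userChannel W (fun j => (p j : Measure _)) i) := by
  rw [userInfo, pi_compProd_map_eval]

section Encoding

variable {M : ι → Type*} [∀ i, MeasurableSpace (M i)] {e : ∀ i, M i → X i}

lemma userChannel_comap (μ : ∀ i, Measure (M i)) [∀ i, IsProbabilityMeasure (μ i)]
    (he : ∀ i, Measurable (e i)) (hem : Measurable fun (w : ∀ i, M i) i => e i (w i)) (i : ι) :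
    userChannel (W.comap (fun w i => e i (w i)) hem) μ i =
      (userChannel W (fun j => (μ j).map (e j)) i).comap (e i) (he i) := by
  have (j : ι) : IsProbabilityMeasure ((μ j).map (e j)) :=
    Measure.isProbabilityMeasure_map (he j).aemeasurable
  have hupdate (a : M i) (w : ∀ j, M j) :
      (fun j => e j (Function.update w i a j)) =
        Function.update (fun j => e j (w j)) i (e i a) := by
    funext j
    exact Function.apply_update (fun j => e j) w i a j
  ext1 a
  rw [Kernel.comap_apply, userChannel_apply, userChannel_apply,
    ← Measure.pi_map_pi fun j => (he j).aemeasurable, Measure.map_map (measurable_update_const i _)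
      hem, ← Kernel.comap_map_comm _ hem (measurable_pi_apply i), ← comp_map_eq_comap_comp _ hem,
    Measure.map_map hem (measurable_update_const i _)]
  congr 2
  funext w
  exact hupdate a w

omit [DecidableEq ι] in
theorem userInfo_comap [∀ i, MeasurableSpace.CountablyGenerated (Y i)] [IsMarkovKernel W]
    (p : ∀ i, ProbabilityMeasure (M i)) (he : ∀ i, Measurable (e i))
    (hem : Measurable fun (w : ∀ i, M i) i => e i (w i)) (i : ι) :
    userInfo (W.comap (fun w i => e i (w i)) hem) p i =
      userInfo W (fun i => (p i).map (he i).aemeasurable) i := by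
  classical
  have (j : ι) : IsProbabilityMeasure ((p j : Measure (M j)).map (e j)) :=
    Measure.isProbabilityMeasure_map (he j).aemeasurable
  rw [userInfo_eq_mutualInfo_userChannel, userInfo_eq_mutualInfo_userChannel,
    userChannel_comap W _ he, mutualInfo_compProd_comap]
  rfl

end Encoding

end UserChannel

section ParallelKernel

variable {ι κ : Type*} [Fintype κ] {X Y : ι → κ → Type*}
  [∀ i k, MeasurableSpace (X i k)] [∀ i k, MeasurableSpace (Y i k)]
  (W : ∀ k, Kernel (∀ i, X i k) (∀ i, Y i k)) [∀ k, IsMarkovKernel (W k)]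

lemma parallel_apply (x : ∀ i k, X i k) :
    parallel W x = (Measure.pi fun k => W k fun i => x i k).map fun y i k => y k i := rfl

instance : IsMarkovKernel (parallel W) :=
  ⟨fun x => by
    rw [parallel_apply]
    exact Measure.isProbabilityMeasure_map measurable_swap_pi.aemeasurable⟩

lemma parallel_apply_map_eval (x : ∀ i k, X i k) (i : ι) :
    (parallel W x).map (fun y => y i) =
      Measure.pi fun k => (W k fun i => x i k).map fun y => y i := by
  rw [parallel_apply, Measure.map_map (measurable_pi_apply i) measurable_swap_pi,
    ← Measure.pi_map_pi fun k => (measurable_pi_apply i).aemeasurable]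
  rfl

lemma parallel_map_eval_map_eval (i : ι) (k : κ) :
    ((parallel W).map fun y => y i).map (fun y => y k) =
      ((W k).map fun y => y i).comap (fun x i => x i k) (by fun_prop) := by
  ext1 x
  rw [Kernel.map_apply _ (measurable_pi_apply k), Kernel.map_apply _ (measurable_pi_apply i),
    parallel_apply_map_eval, map_eval_pi, Kernel.comap_apply,
    Kernel.map_apply _ (measurable_pi_apply i)]

lemma userChannel_parallel_map_eval [Fintype ι] [DecidableEq ι] (q : ∀ i, Measure (∀ k, X i k))
    [∀ i, IsProbabilityMeasure (q i)] (i : ι) (k : κ) :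
    (userChannel (parallel W) q i).map (fun y => y k) =
      (userChannel (W k) (fun j => (q j).map fun x => x k) i).comap (fun x => x k)
        (measurable_pi_apply k) := by
  have hm : Measurable fun (z : ∀ i k, X i k) i => z i k := by fun_prop
  have hupdate (x : ∀ k, X i k) (z : ∀ i k, X i k) :
      (fun j => Function.update z i x j k) = Function.update (fun j => z j k) i (x k) := by
    funext j
    exact Function.apply_update (fun _ x => x k) z i x j
  ext1 x
  rw [Kernel.map_apply _ (measurable_pi_apply k), Kernel.comap_apply, userChannel_apply,
    userChannel_apply, ← Measure.pi_map_pi fun j => (measurable_pi_apply k).aemeasurable,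
    Measure.map_map (measurable_update_const i _) hm, Measure.map_comp _ _ (measurable_pi_apply k),
    parallel_map_eval_map_eval, ← comp_map_eq_comap_comp _ hm,
    Measure.map_map hm (measurable_update_const i _)]
  congr 2
  funext z
  exact hupdate x z

end ParallelKernel

/-! ### Independence across carriers -/

instance countablyGenerated_pi {κ : Type*} [Countable κ] {Y : κ → Type*}
    [∀ k, MeasurableSpace (Y k)] [∀ k, MeasurableSpace.CountablyGenerated (Y k)] :
    MeasurableSpace.CountablyGenerated (∀ k, Y k) := by
  refine ⟨⋃ k, Set.preimage (fun y : ∀ k, Y k => y k) ''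
    MeasurableSpace.countableGeneratingSet (Y k), Set.countable_iUnion fun k =>
      MeasurableSpace.countable_countableGeneratingSet.image _, ?_⟩
  simp only [← MeasurableSpace.iSup_generateFrom, ← MeasurableSpace.comap_generateFrom,
    MeasurableSpace.generateFrom_countableGeneratingSet]
  rfl

/-- By the compensation identity, the left side is the average divergence of the output law given
the input from the product of the marginal output laws, which splits over the coordinates. -/
theorem mutualInfo_add_totalCorr_comp_le {κ : Type*} [Fintype κ] {X Y : κ → Type*}
    [∀ k, MeasurableSpace (X k)] [∀ k, MeasurableSpace (Y k)]
    [∀ k, MeasurableSpace.CountablyGenerated (Y k)] {U : Kernel (∀ k, X k) (∀ k, Y k)}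
    [IsMarkovKernel U] {Uk : ∀ k, Kernel (X k) (Y k)} [∀ k, IsMarkovKernel (Uk k)]
    (hU : ∀ k, U.map (fun y => y k) = (Uk k).comap (fun x => x k) (measurable_pi_apply k))
    {t : ℝ≥0∞} (ht : ∀ x, totalCorr (U x) ≤ t)
    (q : Measure (∀ k, X k)) [IsProbabilityMeasure q] :
    mutualInfo (q ⊗ₘ U) + totalCorr (U ∘ₘ q) ≤
      t + ∑ k, mutualInfo (q.map (fun x => x k) ⊗ₘ Uk k) := by
  let V (k : κ) : Kernel (∀ k, X k) (Y k) := (Uk k).comap (fun x => x k) (measurable_pi_apply k)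
  have hUV (k : κ) (x : ∀ k, X k) : (U x).map (fun y => y k) = V k x := by
    rw [← Kernel.map_apply _ (measurable_pi_apply k), hU]
  have houtput (k : κ) : (U ∘ₘ q).map (fun y => y k) = V k ∘ₘ q := by
    rw [Measure.map_comp _ _ (measurable_pi_apply k), hU]
  have hsum (x : ∀ k, X k) :
      klDiv (U x) (Measure.pi fun k => V k ∘ₘ q) ≤ t + ∑ k, klDiv (V k x) (V k ∘ₘ q) := by
    rw [klDiv_pi_eq]
    simp only [hUV]
    gcongr
    exact ht x
  have hmeas (k : κ) : Measurable fun x => klDiv (V k x) (V k ∘ₘ q) :=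
    measurable_klDiv_apply (V k) (Kernel.const _ (V k ∘ₘ q))
  calc mutualInfo (q ⊗ₘ U) + totalCorr (U ∘ₘ q)
      = ∫⁻ x, klDiv (U x) (Measure.pi fun k => V k ∘ₘ q) ∂q := by
        simp only [totalCorr, houtput]
        rw [← klDiv_compProd_prod, ← Measure.compProd_const, klDiv_compProd_eq_lintegral]
        rfl
    _ ≤ ∫⁻ x, (t + ∑ k, klDiv (V k x) (V k ∘ₘ q)) ∂q := lintegral_mono hsum
    _ = t + ∑ k, mutualInfo (q ⊗ₘ V k) := by
        rw [lintegral_add_left measurable_const, lintegral_const, measure_univ, mul_one,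
          lintegral_finsetSum _ fun k _ => hmeas k]
        simp only [mutualInfo_compProd_eq_lintegral]
    _ = t + ∑ k, mutualInfo (q.map (fun x => x k) ⊗ₘ Uk k) := by
        simp only [V, mutualInfo_compProd_comap]

lemma userInfo_parallel_add_totalCorr_le {ι : Type*} [Fintype ι] [DecidableEq ι] {κ : Type*}
    [Fintype κ] {X Y : ι → κ → Type*} [∀ i k, MeasurableSpace (X i k)]
    [∀ i k, MeasurableSpace (Y i k)] [∀ i k, MeasurableSpace.CountablyGenerated (Y i k)]
    (W : ∀ k, Kernel (∀ i, X i k) (∀ i, Y i k)) [∀ k, IsMarkovKernel (W k)]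
    (q : ∀ i, ProbabilityMeasure (∀ k, X i k)) (i : ι) {t : ℝ≥0∞}
    (ht : ∀ x, totalCorr (userChannel (parallel W) (fun j => (q j : Measure _)) i x) ≤ t) :
    userInfo (parallel W) q i +
        totalCorr (userChannel (parallel W) (fun j => (q j : Measure _)) i ∘ₘ q i) ≤
      t + ∑ k, userInfo (W k) (fun j => carrierMarginal (q j) k) i := by
  simp only [userInfo_eq_mutualInfo_userChannel]
  exact mutualInfo_add_totalCorr_comp_le (userChannel_parallel_map_eval W _ i) ht _

section PiKernel

variable {ι κ : Type*} [Fintype κ]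

lemma piKernel_comp {A B C : κ → Type*} [∀ k, MeasurableSpace (A k)] [∀ k, MeasurableSpace (B k)]
    [∀ k, MeasurableSpace (C k)] (D : ∀ k, Kernel (B k) (C k)) [∀ k, IsMarkovKernel (D k)]
    (E : ∀ k, Kernel (A k) (B k)) [∀ k, IsMarkovKernel (E k)] :
    piKernel (fun k => D k ∘ₖ E k) = piKernel D ∘ₖ piKernel E := by
  ext1 x
  simp only [Kernel.comp_apply, piKernel_apply, piKernel_comp_pi]

variable [Fintype ι] {A B : ι → κ → Type*} [∀ i k, MeasurableSpace (A i k)]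
  [∀ i k, MeasurableSpace (B i k)]

lemma piKernel_piKernel_map_swap (U : ∀ i k, Kernel (A i k) (B i k))
    [∀ i k, IsMarkovKernel (U i k)] :
    (piKernel fun i => piKernel (U i)).map (fun y k i => y i k) =
      (piKernel fun k => piKernel fun i => U i k).comap (fun x k i => x i k)
        measurable_swap_pi := by
  ext1 x
  rw [Kernel.map_apply _ measurable_swap_pi, Kernel.comap_apply]
  simp only [piKernel_apply]
  exact pi_pi_map_swap fun k i => U i k (x i k)

lemma totalCorr_pi_map_swap_le (P : ∀ i, Measure (∀ k, A i k)) [∀ i, IsProbabilityMeasure (P i)] :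
    totalCorr ((Measure.pi P).map fun y k i => y i k) ≤ ∑ i, totalCorr (P i) := by
  have hmarginal (k : κ) : ((Measure.pi P).map fun y k i => y i k).map (fun y => y k) =
      Measure.pi fun i => (P i).map fun y => y k := by
    rw [Measure.map_map (measurable_pi_apply k) measurable_swap_pi,
      ← Measure.pi_map_pi fun i => (measurable_pi_apply k).aemeasurable]
    rfl
  simp only [totalCorr, hmarginal]
  rw [← pi_pi_map_swap fun (k : κ) i => (P i).map fun y => y k, ← klDiv_pi_pi]
  exact klDiv_map_le _ _ measurable_swap_pi

end PiKernel

lemma pi_map_succ {m : ℕ} {A : Fin (m + 1) → Type*} [∀ i, MeasurableSpace (A i)]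
    (q : ∀ i, Measure (A i)) [∀ i, IsProbabilityMeasure (q i)] :
    (Measure.pi q).map (fun z (j : Fin m) => z j.succ) = Measure.pi fun j => q j.succ :=
  (measurePreserving_snd.comp (measurePreserving_piFinSuccAbove q 0)).map_eq

namespace ManyToOne

section SingleCarrier

variable {m : ℕ} {X Y : Fin (m + 1) → Type*} {V : Type*}
  [∀ i, MeasurableSpace (X i)] [∀ i, MeasurableSpace (Y i)] [MeasurableSpace V]
  (C : ManyToOne X Y V)

instance : IsMarkovKernel C.joint := C.markov_joint

instance (j : Fin m) : IsMarkovKernel (C.direct j) := C.markov_direct j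

instance : IsMarkovKernel (C.joint.map Prod.fst) := Kernel.IsMarkovKernel.map _ measurable_fst

lemma measurable_f_apply (a : X 0) : Measurable (C.f a) :=
  C.measurable_f.comp measurable_prodMk_left

lemma measurable_assemble_prodMk (a : X 0) :
    Measurable fun vy : V × ∀ j : Fin m, Y j.succ => C.assemble (a, vy) :=
  C.measurable_assemble.comp measurable_prodMk_left

lemma joint_map_snd : C.joint.map Prod.snd = piKernel C.direct := by
  ext1 x
  rw [Kernel.map_apply _ measurable_snd, C.joint_snd, piKernel_apply]

lemma kernel_apply_map_eval_zero (x : ∀ i, X i) :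
    (C.kernel x).map (fun y => y 0) =
      ((C.joint.map Prod.fst) fun j => x j.succ).map (C.f (x 0)) := by
  change ((C.joint fun j => x j.succ).map fun vy => C.assemble (x 0, vy)).map _ = _
  rw [Measure.map_map (measurable_pi_apply 0) (C.measurable_assemble_prodMk _),
    Kernel.map_apply _ measurable_fst, Measure.map_map (C.measurable_f_apply _) measurable_fst]
  rfl

lemma kernel_apply_map_eval_succ (x : ∀ i, X i) (j : Fin m) :
    (C.kernel x).map (fun y => y j.succ) = C.direct j (x j.succ) := by
  change ((C.joint fun j => x j.succ).map fun vy => C.assemble (x 0, vy)).map _ = _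
  rw [← map_eval_pi (fun j => C.direct j (x j.succ)) j, ← C.joint_snd,
    Measure.map_map (measurable_pi_apply _) (C.measurable_assemble_prodMk _),
    Measure.map_map (measurable_pi_apply _) measurable_snd]
  rfl

end SingleCarrier

variable {κ : Type*} [Fintype κ] {m : ℕ} {X Y : Fin (m + 1) → κ → Type*} {V : κ → Type*}
  [∀ i k, MeasurableSpace (X i k)] [∀ i k, MeasurableSpace (Y i k)] [∀ k, MeasurableSpace (V k)]
  (C : ∀ k, ManyToOne (fun i => X i k) (fun i => Y i k) (V k))

/-- The joint law of the interference on all carriers, when transmitter `j + 1` sends the vector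
input law `q j`, independently over `j`. -/
def interference (q : ∀ j : Fin m, Measure (∀ k, X j.succ k)) : Measure (∀ k, V k) :=
  piKernel (fun k => (C k).joint.map Prod.fst) ∘ₘ (Measure.pi q).map fun z k j => z j k

instance (q : ∀ j : Fin m, Measure (∀ k, X j.succ k)) [∀ j, IsProbabilityMeasure (q j)] :
    IsProbabilityMeasure (interference C q) := by
  have : IsProbabilityMeasure ((Measure.pi q).map fun z k j => z j k) :=
    Measure.isProbabilityMeasure_map measurable_swap_pi.aemeasurable
  unfold interference
  infer_instance

/-- By degradedness, the interference can be simulated from the outputs of the receivers `1, …, m`,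
carrier by carrier. -/
theorem totalCorr_interference_le (hC : ∀ k, (C k).Degraded)
    (q : ∀ j : Fin m, Measure (∀ k, X j.succ k)) [∀ j, IsProbabilityMeasure (q j)] :
    totalCorr (interference C q) ≤
      ∑ j, totalCorr ((piKernel fun k => (C k).direct j) ∘ₘ q j) := by
  choose D hD hdegraded using hC
  have hsimulate : interference C q = piKernel D ∘ₘ
      (Measure.pi fun j => (piKernel fun k => (C k).direct j) ∘ₘ q j).map fun y k j => y j k := by
    rw [interference, ← piKernel_comp_pi, Measure.map_comp _ _ measurable_swap_pi,
      piKernel_piKernel_map_swap, ← comp_map_eq_comap_comp, Measure.comp_assoc, ← piKernel_comp]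
    simp only [hdegraded, joint_map_snd]
  have : IsProbabilityMeasure ((Measure.pi fun j =>
      (piKernel fun k => (C k).direct j) ∘ₘ q j).map fun y k j => y j k) :=
    Measure.isProbabilityMeasure_map measurable_swap_pi.aemeasurable
  rw [hsimulate]
  exact (totalCorr_piKernel_le _ D).trans (totalCorr_pi_map_swap_le _)

lemma userChannel_parallel_succ (q : ∀ i, Measure (∀ k, X i k)) [∀ i, IsProbabilityMeasure (q i)]
    (j : Fin m) :
    userChannel (parallel fun k => (C k).kernel) q j.succ = piKernel fun k => (C k).direct j := by
  ext1 x
  have hupdate : Measurable fun z : ∀ i k, X i k => Function.update z j.succ x :=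
    measurable_update_const (X := fun i => ∀ k, X i k) j.succ x
  have hconst : ((parallel fun k => (C k).kernel).map fun y => y j.succ).comap
      (fun z => Function.update z j.succ x) hupdate =
        Kernel.const _ (piKernel (fun k => (C k).direct j) x) := by
    ext1 z
    rw [Kernel.comap_apply, Kernel.map_apply _ (measurable_pi_apply _), parallel_apply_map_eval]
    simp only [kernel_apply_map_eval_succ, Function.update_self, Kernel.const_apply,
      piKernel_apply]
  rw [userChannel_apply, comp_map_eq_comap_comp _ hupdate, hconst,
    Measure.const_comp, measure_univ, one_smul]

lemma userChannel_parallel_zero (q : ∀ i, Measure (∀ k, X i k)) [∀ i, IsProbabilityMeasure (q i)]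
    (x : ∀ k, X 0 k) :
    userChannel (parallel fun k => (C k).kernel) q 0 x =
      (interference C fun j => q j.succ).map fun v k => (C k).f (x k) (v k) := by
  have hf (k : κ) : Measurable ((C k).f (x k)) := (C k).measurable_f_apply _
  have hF : Measurable fun (v : ∀ k, V k) k => (C k).f (x k) (v k) := by fun_prop
  have hupdate : Measurable fun z : ∀ i k, X i k => Function.update z 0 x :=
    measurable_update_const (X := fun i => ∀ k, X i k) 0 x
  have hsucc : Measurable fun (z : ∀ i k, X i k) (j : Fin m) => z j.succ := by fun_prop
  rw [userChannel_apply, comp_map_eq_comap_comp _ hupdate, interference,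
    ← pi_map_succ, Measure.map_map measurable_swap_pi hsucc, Measure.map_comp _ _ hF,
    comp_map_eq_comap_comp _ (measurable_swap_pi.comp hsucc)]
  congr 2
  ext1 z
  have (k : κ) : IsProbabilityMeasure (((C k).joint.map Prod.fst fun j => z j.succ k).map
      ((C k).f (x k))) := Measure.isProbabilityMeasure_map (hf k).aemeasurable
  rw [Kernel.comap_apply, Kernel.map_apply _ (measurable_pi_apply _), parallel_apply_map_eval,
    Kernel.comap_apply, Kernel.map_apply _ hF, piKernel_apply,
    Measure.pi_map_pi fun k => (hf k).aemeasurable]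
  simp only [kernel_apply_map_eval_zero, Function.update_self]
  rfl

section SumInfo

variable [∀ i k, MeasurableSpace.CountablyGenerated (Y i k)]
  (q : ∀ i, ProbabilityMeasure (∀ k, X i k))

lemma userInfo_parallel_zero_le :
    userInfo (parallel fun k => (C k).kernel) q 0 ≤
      totalCorr (interference C fun j => (q j.succ : Measure _)) +
        ∑ k, userInfo (C k).kernel (fun j => carrierMarginal (q j) k) 0 := by
  refine le_self_add.trans (userInfo_parallel_add_totalCorr_le (fun k => (C k).kernel) q 0
    fun x => ?_)
  rw [userChannel_parallel_zero]
  exact totalCorr_map_le _ fun k => (C k).measurable_f_apply _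

lemma userInfo_parallel_succ_add_totalCorr_le (j : Fin m) :
    userInfo (parallel fun k => (C k).kernel) q j.succ +
        totalCorr ((piKernel fun k => (C k).direct j) ∘ₘ (q j.succ : Measure _)) ≤
      ∑ k, userInfo (C k).kernel (fun j => carrierMarginal (q j) k) j.succ := by
  have h := userInfo_parallel_add_totalCorr_le (fun k => (C k).kernel) q j.succ (t := 0)
  simp only [userChannel_parallel_succ, zero_add] at h
  exact h fun x => (totalCorr_pi _).le

theorem sum_userInfo_parallel_le (hC : ∀ k, (C k).Degraded) :
    ∑ i, userInfo (parallel fun k => (C k).kernel) q i ≤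
      ∑ k, ∑ i, userInfo (C k).kernel (fun j => carrierMarginal (q j) k) i := by
  set t : Fin m → ℝ≥0∞ :=
    fun j => totalCorr ((piKernel fun k => (C k).direct j) ∘ₘ (q j.succ : Measure _))
  set I := userInfo (parallel fun k => (C k).kernel) q
  set J : Fin (m + 1) → ℝ≥0∞ :=
    fun i => ∑ k, userInfo (C k).kernel (fun j => carrierMarginal (q j) k) i
  have hzero : I 0 ≤ ∑ j, t j + J 0 :=
    (userInfo_parallel_zero_le C q).trans (by gcongr; exact totalCorr_interference_le C hC _)
  have hsucc (j : Fin m) : I j.succ + t j ≤ J j.succ :=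
    userInfo_parallel_succ_add_totalCorr_le C q j
  rw [Finset.sum_comm, Fin.sum_univ_succ, Fin.sum_univ_succ]
  change I 0 + ∑ j : Fin m, I j.succ ≤ J 0 + ∑ j : Fin m, J j.succ
  calc I 0 + ∑ j : Fin m, I j.succ
      ≤ (∑ j, t j + J 0) + ∑ j : Fin m, I j.succ := by gcongr
    _ = J 0 + ∑ j : Fin m, (I j.succ + t j) := by rw [Finset.sum_add_distrib]; ring
    _ ≤ J 0 + ∑ j : Fin m, J j.succ := by gcongr with j; exact hsucc j

end SumInfo

end ManyToOne

/-! ### Fano's inequality -/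

section Fano

variable {α : Type*} [MeasurableSpace α] {μ ν : Measure α} [IsProbabilityMeasure μ]
  [IsProbabilityMeasure ν]

lemma integrable_exp_of_abs_le {g : α → ℝ} (hg : Measurable g) {b : ℝ} (hb : ∀ x, |g x| ≤ b) :
    Integrable (fun x => Real.exp (g x)) ν :=
  Integrable.of_bound (Real.measurable_exp.comp hg).aestronglyMeasurable (Real.exp b)
    (ae_of_all _ fun x => by
      rw [Real.norm_eq_abs, Real.abs_exp]
      exact Real.exp_le_exp.2 ((le_abs_self _).trans (hb x)))

/-- This is one half of the Donsker–Varadhan variational formula. -/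
theorem integral_le_klDiv_add_log (hfin : klDiv μ ν ≠ ∞) {g : α → ℝ} (hg : Measurable g) {b : ℝ}
    (hb : ∀ x, |g x| ≤ b) :
    ∫ x, g x ∂μ ≤ (klDiv μ ν).toReal + Real.log (∫ x, Real.exp (g x) ∂ν) := by
  obtain ⟨hac, hint⟩ := klDiv_ne_top_iff.1 hfin
  have hgμ : Integrable g μ := Integrable.of_bound hg.aestronglyMeasurable b
    (ae_of_all _ fun x => by simpa using hb x)
  have hgν : Integrable (fun x => Real.exp (g x)) ν := integrable_exp_of_abs_le hg hb
  have := isProbabilityMeasure_tilted hgν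
  have htilted := integral_llr_tilted_right hac hgμ hgν hint
  have hnonneg := integral_llr_nonneg (hac.trans (absolutelyContinuous_tilted hgν))
  have hkl := toReal_klDiv_of_measure_eq hac (by simp)
  linarith

lemma measureReal_mul_le_klDiv_add_log (hfin : klDiv μ ν ≠ ∞) {A : Set α} (hA : MeasurableSet A)
    (c : ℝ) :
    μ.real A * c ≤ (klDiv μ ν).toReal + Real.log (1 + ν.real A * (Real.exp c - 1)) := by
  have hexp : ∀ x, Real.exp (A.indicator (fun _ => c) x) =
      1 + A.indicator (fun _ => Real.exp c - 1) x := fun x => by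
    by_cases hx : x ∈ A <;> simp [hx]
  have hbound : ∀ x, |A.indicator (fun _ => c) x| ≤ |c| := fun x => by
    by_cases hx : x ∈ A <;> simp [hx]
  have h := integral_le_klDiv_add_log hfin (measurable_const.indicator hA) hbound
  simp only [hexp] at h
  rwa [integral_add (integrable_const _) ((integrable_const _).indicator hA),
    integral_indicator_const _ hA, integral_indicator_const _ hA, integral_const, probReal_univ,
    smul_eq_mul, smul_eq_mul, smul_eq_mul, one_mul] at h

end Fano

section Uniform

lemma lintegral_uniformOn_univ {M : Type*} [Fintype M] [MeasurableSpace M]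
    [MeasurableSingletonClass M] (f : M → ℝ≥0∞) :
    ∫⁻ w, f w ∂(uniformOn Set.univ) = (Fintype.card M : ℝ≥0∞)⁻¹ * ∑ w, f w := by
  rw [uniformOn, ProbabilityTheory.cond, Measure.restrict_univ, lintegral_smul_measure,
    lintegral_count, tsum_fintype, smul_eq_mul, Measure.count_univ, ENat.card_eq_coe_fintype_card]
  simp

lemma uniformOn_univ_singleton {M : Type*} [Fintype M] [MeasurableSpace M]
    [MeasurableSingletonClass M] (w : M) :
    uniformOn Set.univ {w} = (Fintype.card M : ℝ≥0∞)⁻¹ := by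
  rw [uniformOn_univ, Measure.count_singleton, one_div]

lemma pi_uniformOn_univ {ι : Type*} [Fintype ι] (M : ι → Type*) [∀ i, Finite (M i)]
    [∀ i, MeasurableSpace (M i)] [∀ i, MeasurableSingletonClass (M i)] :
    Measure.pi (fun i => uniformOn (Set.univ : Set (M i))) = uniformOn Set.univ := by
  classical
  have (i : ι) : Fintype (M i) := Fintype.ofFinite _
  refine Measure.ext_of_singleton fun w => ?_
  simp only [Measure.pi_singleton, uniformOn_univ_singleton, Fintype.card_pi, Nat.cast_prod]
  exact (ENNReal.prod_inv_distrib fun i _ j _ _ => Or.inr (ENNReal.natCast_ne_top _)).symm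

lemma uniformOn_univ_prod_setOf_eq {M β : Type*} [Fintype M] [MeasurableSpace M]
    [MeasurableSingletonClass M] [MeasurableSpace β] (ν : Measure β) [IsProbabilityMeasure ν]
    {dec : β → M} (hdec : Measurable dec) :
    ((uniformOn Set.univ).prod ν).real {z | dec z.2 = z.1} = (Fintype.card M : ℝ)⁻¹ := by
  have hA : MeasurableSet {z : M × β | dec z.2 = z.1} :=
    measurableSet_eq_fun (hdec.comp measurable_snd) measurable_fst
  have hsection : ∀ b, (fun w => (w, b)) ⁻¹' {z : M × β | dec z.2 = z.1} = {dec b} := fun b => by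
    ext w
    simp [eq_comm]
  rw [measureReal_def, Measure.prod_apply_symm hA]
  simp only [hsection, uniformOn_univ_singleton, lintegral_const, measure_univ, mul_one,
    ENNReal.toReal_inv, ENNReal.toReal_natCast]

/-- The free parameter `a` replaces the binary entropy of the usual form of Fano's inequality, which
is the infimum over `a` of the remainder. -/
theorem measureReal_setOf_eq_mul_log_le {M β : Type*} [Fintype M] [Nonempty M] [MeasurableSpace M]
    [MeasurableSingletonClass M] [MeasurableSpace β] (ρ : Measure (M × β)) [IsProbabilityMeasure ρ]
    (hfst : ρ.fst = uniformOn Set.univ) (hfin : mutualInfo ρ ≠ ∞) {dec : β → M}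
    (hdec : Measurable dec) {a : ℝ} (ha : 0 < a) :
    ρ.real {z | dec z.2 = z.1} * (Real.log (Fintype.card M) + Real.log a) ≤
      (mutualInfo ρ).toReal + Real.log (1 + a) := by
  have hcard : (1 : ℝ) ≤ Fintype.card M := by exact_mod_cast Fintype.card_pos
  have hA : MeasurableSet {z : M × β | dec z.2 = z.1} :=
    measurableSet_eq_fun (hdec.comp measurable_snd) measurable_fst
  have hexp : Real.exp (Real.log (Fintype.card M) + Real.log a) = Fintype.card M * a := by
    rw [Real.exp_add, Real.exp_log (by linarith), Real.exp_log ha]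
  have htest := measureReal_mul_le_klDiv_add_log hfin hA
    (Real.log (Fintype.card M) + Real.log a)
  rw [hfst, uniformOn_univ_prod_setOf_eq _ hdec, hexp, ← hfst, mul_sub,
    inv_mul_cancel_left₀ (by linarith), mul_one] at htest
  have hinv : (Fintype.card M : ℝ)⁻¹ ≤ 1 := inv_le_one_of_one_le₀ hcard
  have hpos : 0 < (Fintype.card M : ℝ)⁻¹ := by positivity
  exact htest.trans (add_le_add le_rfl (Real.log_le_log (by linarith) (by linarith)))

end Uniform

/-! ### The converse -/

section Block

variable {ι : Type*} {κ : Type*} [Fintype κ] {X Y : ι → κ → Type*}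
  [∀ i k, MeasurableSpace (X i k)] [∀ i k, MeasurableSpace (Y i k)]
  (W : ∀ k, Kernel (∀ i, X i k) (∀ i, Y i k)) [∀ k, IsMarkovKernel (W k)] (T : ℕ)

/-- `T` uses of the parallel channel, regarded as a single use of a parallel channel whose carriers
are the pairs of a time and a carrier. -/
abbrev blockParallel :
    Kernel (∀ i (z : Fin T × κ), X i z.2) (∀ i (z : Fin T × κ), Y i z.2) :=
  parallel (X := fun i (z : Fin T × κ) => X i z.2) (Y := fun i (z : Fin T × κ) => Y i z.2)
    fun z => W z.2

variable {T}

instance (x : Fin T → ∀ i k, X i k) : IsProbabilityMeasure (blockLaw (parallel W) x) := by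
  unfold blockLaw
  infer_instance

lemma blockLaw_map_eval (x : Fin T → ∀ i k, X i k) (i : ι) :
    (blockLaw (parallel W) x).map (fun y τ => y τ i) =
      Measure.pi fun τ => Measure.pi fun k => (W k fun j => x τ j k).map fun y => y i := by
  have (τ : Fin T) : IsProbabilityMeasure ((parallel W (x τ)).map fun y => y i) :=
    Measure.isProbabilityMeasure_map (measurable_pi_apply i).aemeasurable
  rw [blockLaw, Measure.pi_map_pi fun τ => (measurable_pi_apply i).aemeasurable]
  simp only [parallel_apply_map_eval]

lemma blockParallel_apply_map_curry (x : Fin T → ∀ i k, X i k) (i : ι) :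
    (blockParallel W T fun i z => x z.1 i z.2).map (fun y τ k => y i (τ, k)) =
      (blockLaw (parallel W) x).map fun y τ => y τ i := by
  have (τ : Fin T) (k : κ) : IsProbabilityMeasure ((W k fun j => x τ j k).map fun y => y i) :=
    Measure.isProbabilityMeasure_map (measurable_pi_apply i).aemeasurable
  have hcurry : Measurable fun (y : ∀ z : Fin T × κ, Y i z.2) τ k => y (τ, k) :=
    measurable_curry_pi (X := fun (_ : Fin T) k => Y i k)
  rw [blockLaw_map_eval, ← pi_map_curry fun τ k => (W k fun j => x τ j k).map fun y => y i,
    ← parallel_apply_map_eval (X := fun i (z : Fin T × κ) => X i z.2)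
      (Y := fun i (z : Fin T × κ) => Y i z.2) (fun z => W z.2) (fun i z => x z.1 i z.2) i,
    Measure.map_map hcurry (measurable_pi_apply i)]
  rfl

end Block

section CodeLaw

variable {ι κ : Type*} {X Y : ι → κ → Type*}
  [∀ i k, MeasurableSpace (X i k)] [∀ i k, MeasurableSpace (Y i k)] {T : ℕ}
  (c : Code (fun i => ∀ k, X i k) (fun i => ∀ k, Y i k) T)

instance (i : ι) : Nonempty (Fin (c.numMsg i)) := ⟨⟨0, c.numMsg_pos i⟩⟩

/-- The uniform law of the message of user `i`. -/
def messageLaw (i : ι) : ProbabilityMeasure (Fin (c.numMsg i)) :=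
  ⟨uniformOn Set.univ, inferInstance⟩

/-- The law of the input at time `τ` of user `i` on carrier `k`, for uniform messages. -/
def codeLaw (τ : Fin T) (i : ι) (k : κ) : ProbabilityMeasure (X i k) :=
  (messageLaw c i).map (f := fun w => c.enc i w τ k) Measurable.of_discrete.aemeasurable

/-- The law of the codeword of user `i`, for uniform messages. -/
def wordLaw (i : ι) : ProbabilityMeasure (∀ z : Fin T × κ, X i z.2) :=
  (messageLaw c i).map (f := fun w z => c.enc i w z.1 z.2) Measurable.of_discrete.aemeasurable

lemma carrierMarginal_wordLaw (i : ι) (z : Fin T × κ) :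
    carrierMarginal (wordLaw c i) z = codeLaw c z.1 i z.2 :=
  Subtype.ext (Measure.map_map (measurable_pi_apply z) Measurable.of_discrete)

lemma lintegral_codeLaw (τ : Fin T) (i : ι) (k : κ) {f : X i k → ℝ≥0∞} (hf : Measurable f) :
    ∫⁻ x, f x ∂(codeLaw c τ i k : Measure (X i k)) =
      (c.numMsg i : ℝ≥0∞)⁻¹ * ∑ w, f (c.enc i w τ k) := by
  refine (lintegral_map hf Measurable.of_discrete).trans ?_
  exact (lintegral_uniformOn_univ _).trans (by rw [Fintype.card_fin])

lemma inv_mul_sum_lintegral_cost_codeLaw (Q : CostConstraint X) (i : ι) (k : κ) :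
    (T : ℝ≥0∞)⁻¹ * ∑ τ, ∫⁻ x, Q.cost i k x ∂(codeLaw c τ i k : Measure (X i k)) =
      Q.codebookCost i (c.enc i) k := by
  simp only [lintegral_codeLaw c _ i k (Q.measurable_cost i k)]
  rw [← Finset.mul_sum, Finset.sum_comm, CostConstraint.codebookCost, Fintype.card_fin,
    ← mul_assoc, ENNReal.mul_inv (by simp) (by simp), mul_comm (T : ℝ≥0∞)⁻¹]

variable [Fintype ι] [Fintype κ] (W : ∀ k, Kernel (∀ i, X i k) (∀ i, Y i k))
  [∀ k, IsMarkovKernel (W k)]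

/-- The channel from the messages to the outputs during the transmission of a code. -/
def messageChannel : Kernel (∀ i, Fin (c.numMsg i)) (∀ i (z : Fin T × κ), Y i z.2) :=
  (blockParallel W T).comap (fun w i z => c.enc i (w i) z.1 z.2) Measurable.of_discrete

instance : IsMarkovKernel (messageChannel c W) := by
  unfold messageChannel
  infer_instance

lemma userInfo_messageChannel [∀ i k, MeasurableSpace.CountablyGenerated (Y i k)] (i : ι) :
    userInfo (messageChannel c W) (messageLaw c) i =
      userInfo (blockParallel W T) (wordLaw c) i :=
  userInfo_comap (e := fun i w (z : Fin T × κ) => c.enc i w z.1 z.2) (blockParallel W T)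
    (messageLaw c) (fun _ => Measurable.of_discrete)
    Measurable.of_discrete i

variable [DecidableEq ι]

lemma errorProb_le_one : errorProb (parallel W) c.enc c.dec ≤ 1 := by
  rw [errorProb]
  calc _ ≤ (Fintype.card (∀ i, Fin (c.numMsg i)) : ℝ≥0∞)⁻¹ *
        ∑ w : ∀ i, Fin (c.numMsg i), 1 := by
        gcongr
        exact prob_le_one
    _ ≤ 1 := by
        simp only [Finset.sum_const, Finset.card_univ, nsmul_eq_mul, mul_one]
        exact ENNReal.inv_mul_le_one _

lemma messageChannel_setOf_dec_ne_le_errorProb (i : ι) :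
    ((Measure.pi fun j => (messageLaw c j : Measure _)) ⊗ₘ messageChannel c W)
      {z | c.dec i (fun τ k => z.2 i (τ, k)) ≠ z.1 i} ≤
      errorProb (parallel W) c.enc c.dec := by
  have hcurry : Measurable fun (y : ∀ i (z : Fin T × κ), Y i z.2) τ k => y i (τ, k) := by fun_prop
  have heval : Measurable fun (y : Fin T → ∀ i k, Y i k) τ => y τ i := by fun_prop
  have hmeas : MeasurableSet {z : (∀ i, Fin (c.numMsg i)) × (∀ i (z : Fin T × κ), Y i z.2) |
      c.dec i (fun τ k => z.2 i (τ, k)) ≠ z.1 i} :=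
    (measurableSet_eq_fun ((c.measurable_dec i).comp (hcurry.comp measurable_snd))
      (by fun_prop)).compl
  rw [Measure.compProd_apply hmeas]
  simp only [messageLaw, ProbabilityMeasure.coe_mk, pi_uniformOn_univ]
  rw [lintegral_uniformOn_univ, errorProb]
  gcongr with w
  have hwrong : MeasurableSet {y | c.dec i y ≠ w i} :=
    (c.measurable_dec i (measurableSet_singleton (w i))).compl
  have hlaw := congrArg (fun μ => μ {y | c.dec i y ≠ w i})
    (blockParallel_apply_map_curry W (fun τ i => c.enc i (w i) τ) i)
  rw [Measure.map_apply hcurry hwrong, Measure.map_apply heval hwrong] at hlaw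
  exact hlaw.trans_le (measure_mono fun y hy => Exists.intro i hy)

variable [∀ i k, MeasurableSpace.CountablyGenerated (Y i k)]

theorem one_sub_errorProb_mul_log_numMsg_le (i : ι) {a : ℝ} (ha : 1 ≤ a)
    (hfin : userInfo (blockParallel W T) (wordLaw c) i ≠ ∞) :
    (1 - (errorProb (parallel W) c.enc c.dec).toReal) * (Real.log (c.numMsg i) + Real.log a) ≤
      (userInfo (blockParallel W T) (wordLaw c) i).toReal + Real.log (1 + a) := by
  rw [← userInfo_messageChannel, userInfo] at hfin ⊢
  set P := (Measure.pi fun j => (messageLaw c j : Measure _)) ⊗ₘ messageChannel c W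
  set ρ := P.map fun z => (z.1 i, z.2 i)
  have hdec : Measurable fun y : ∀ z : Fin T × κ, Y i z.2 => c.dec i fun τ k => y (τ, k) :=
    (c.measurable_dec i).comp (by fun_prop)
  have hzi : Measurable fun z : (∀ i, Fin (c.numMsg i)) × (∀ i (z : Fin T × κ), Y i z.2) =>
      (z.1 i, z.2 i) := by fun_prop
  have : IsProbabilityMeasure ρ := Measure.isProbabilityMeasure_map hzi.aemeasurable
  have hfst : ρ.fst = uniformOn Set.univ := by
    rw [Measure.fst_map_prodMk (by fun_prop)]
    refine (Measure.map_map (measurable_pi_apply i) measurable_fst).symm.trans ?_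
    exact (congrArg _ (Measure.fst_compProd _ _)).trans (map_eval_pi _ i)
  have hright : MeasurableSet {z : Fin (c.numMsg i) × ∀ z : Fin T × κ, Y i z.2 |
      (c.dec i fun τ k => z.2 (τ, k)) = z.1} :=
    measurableSet_eq_fun (hdec.comp measurable_snd) measurable_fst
  have hwrong : ρ {z | (c.dec i fun τ k => z.2 (τ, k)) = z.1}ᶜ ≤
      errorProb (parallel W) c.enc c.dec := by
    rw [Measure.map_apply hzi hright.compl]
    exact messageChannel_setOf_dec_ne_le_errorProb c W i
  have hwrong' := ENNReal.toReal_mono ((errorProb_le_one c W).trans_lt ENNReal.one_lt_top).ne hwrong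
  have hcompl := probReal_compl_eq_one_sub (μ := ρ) hright
  have hfano := measureReal_setOf_eq_mul_log_le ρ hfst hfin hdec (zero_lt_one.trans_le ha)
  rw [Fintype.card_fin] at hfano
  refine le_trans (mul_le_mul_of_nonneg_right ?_ ?_) hfano
  · rw [← measureReal_def] at hwrong'
    linarith
  · exact add_nonneg (Real.log_nonneg (by exact_mod_cast c.numMsg_pos i)) (Real.log_nonneg ha)

lemma one_sub_errorProb_mul_sum_log_numMsg_le {S : ℝ≥0∞} (hS : S ≠ ∞)
    (hle : ∑ i, userInfo (blockParallel W T) (wordLaw c) i ≤ S) {a : ℝ} (ha : 1 ≤ a) :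
    (1 - (errorProb (parallel W) c.enc c.dec).toReal) * ∑ i, Real.log (c.numMsg i) ≤
      S.toReal + Fintype.card ι * (Real.log (1 + a) -
        (1 - (errorProb (parallel W) c.enc c.dec).toReal) * Real.log a) := by
  have hfin (i : ι) : userInfo (blockParallel W T) (wordLaw c) i ≠ ∞ :=
    ne_top_of_le_ne_top hS
      ((Finset.single_le_sum (fun _ _ => zero_le) (Finset.mem_univ i)).trans hle)
  have hsum := Finset.sum_le_sum fun i (_ : i ∈ Finset.univ) =>
    one_sub_errorProb_mul_log_numMsg_le c W i ha (hfin i)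
  rw [← Finset.mul_sum, Finset.sum_add_distrib, Finset.sum_add_distrib,
    ← ENNReal.toReal_sum fun i _ => hfin i] at hsum
  simp only [Finset.sum_const, Finset.card_univ, nsmul_eq_mul] at hsum
  have := ENNReal.toReal_mono hS hle
  linarith

end CodeLaw

section Converse

/-- The supremum of the sum of the carrierwise mutual informations over all time-shared product
input laws that satisfy the constraint `Q`. -/
def separateSumInfo {ι : Type*} [Fintype ι] {κ : Type*} [Fintype κ] {X Y : ι → κ → Type*}
    [∀ i k, MeasurableSpace (X i k)] [∀ i k, MeasurableSpace (Y i k)]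
    (W : ∀ k, Kernel (∀ i, X i k) (∀ i, Y i k)) (Q : CostConstraint X) : ℝ≥0∞ :=
  ⨆ (N : ℕ) (p : Fin (N + 1) → ∀ i k, ProbabilityMeasure (X i k)) (_ : Q.Feasible p),
    ∑ k, ∑ i, carrierInfo W p i k

lemma le_of_forall_one_sub_mul_le_add_log {e : ℕ → ℝ} (he : Tendsto e atTop (𝓝 0)) {R S c : ℝ}
    (h : ∀ n, ∀ a : ℝ, 1 ≤ a →
      (1 - e n) * R ≤ S + c * (Real.log (1 + a) - (1 - e n) * Real.log a)) :
    R ≤ S := by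
  have hone : Tendsto (fun n => 1 - e n) atTop (𝓝 1) := by
    simpa only [sub_zero] using tendsto_const_nhds.sub he
  have hlim (a : ℝ) (ha : 1 ≤ a) : R ≤ S + c * (Real.log (1 + a) - Real.log a) := by
    have hl : Tendsto _ atTop (𝓝 (1 * R)) := hone.mul_const R
    have hr : Tendsto _ atTop (𝓝 (S + c * (Real.log (1 + a) - 1 * Real.log a))) :=
      (((hone.mul_const (Real.log a)).const_sub (Real.log (1 + a))).const_mul c).const_add S
    simpa only [one_mul] using le_of_tendsto_of_tendsto' hl hr fun n => h n a ha
  have hlog : Tendsto _ atTop (𝓝 (S + c * 0)) :=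
    ((Real.tendsto_log_comp_add_sub_log 1).const_mul c).const_add S
  refine (ge_of_tendsto hlog ?_).trans_eq (by ring)
  filter_upwards [eventually_ge_atTop 1] with a ha
  rw [add_comm a]
  exact hlim a ha

variable {m : ℕ} {κ : Type*} [Fintype κ] {X Y : Fin (m + 1) → κ → Type*} {V : κ → Type*}
  [∀ i k, MeasurableSpace (X i k)] [∀ i k, MeasurableSpace (Y i k)]
  [∀ i k, MeasurableSpace.CountablyGenerated (Y i k)] [∀ k, MeasurableSpace (V k)]
  (C : ∀ k, ManyToOne (fun i => X i k) (fun i => Y i k) (V k)) (hC : ∀ k, (C k).Degraded)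

include hC

lemma sum_userInfo_wordLaw_le {N : ℕ}
    (c : Code (fun i => ∀ k, X i k) (fun i => ∀ k, Y i k) (N + 1)) :
    ∑ i, userInfo (blockParallel (fun k => (C k).kernel) (N + 1)) (wordLaw c) i ≤
      ((N + 1 : ℕ) : ℝ≥0∞) * ∑ k, ∑ i, carrierInfo (fun k => (C k).kernel) (codeLaw c) i k := by
  refine (ManyToOne.sum_userInfo_parallel_le (fun z : Fin (N + 1) × κ => C z.2) (wordLaw c)
    fun z => hC z.2).trans_eq ?_
  simp only [carrierMarginal_wordLaw, carrierInfo, ← Finset.mul_sum]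
  rw [← mul_assoc, ENNReal.mul_inv_cancel (by simp) (by simp), one_mul, Fintype.sum_prod_type,
    Finset.sum_comm]
  exact Finset.sum_congr rfl fun k _ => Finset.sum_comm

variable (Q : CostConstraint X)

lemma sum_userInfo_wordLaw_le_mul_separateSumInfo {T : ℕ} (hT : 0 < T)
    (c : Code (fun i => ∀ k, X i k) (fun i => ∀ k, Y i k) T)
    (hc : ∀ i, Q.codebookCost i (c.enc i) ∈ Q.region i) :
    ∑ i, userInfo (blockParallel (fun k => (C k).kernel) T) (wordLaw c) i ≤
      T * separateSumInfo (fun k => (C k).kernel) Q := by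
  obtain ⟨N, rfl⟩ := Nat.exists_eq_succ_of_ne_zero hT.ne'
  have hfeasible : Q.Feasible (codeLaw c) := fun i => by
    convert hc i using 1
    exact funext fun k => inv_mul_sum_lintegral_cost_codeLaw c Q i k
  refine (sum_userInfo_wordLaw_le C hC c).trans ?_
  gcongr
  exact le_iSup₂_of_le N (codeLaw c) (le_iSup_of_le hfeasible le_rfl)

theorem one_sub_errorProb_mul_sum_rate_le (hfin : separateSumInfo (fun k => (C k).kernel) Q ≠ ∞)
    {T : ℕ} (hT : 0 < T) (c : Code (fun i => ∀ k, X i k) (fun i => ∀ k, Y i k) T)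
    (hc : ∀ i, Q.codebookCost i (c.enc i) ∈ Q.region i) {a : ℝ} (ha : 1 ≤ a) :
    (1 - (errorProb (parallel fun k => (C k).kernel) c.enc c.dec).toReal) * ∑ i, c.rate i ≤
      (separateSumInfo (fun k => (C k).kernel) Q).toReal + (m + 1 : ℕ) * (Real.log (1 + a) -
        (1 - (errorProb (parallel fun k => (C k).kernel) c.enc c.dec).toReal) * Real.log a) := by
  have hbound := one_sub_errorProb_mul_sum_log_numMsg_le c (fun k => (C k).kernel)
    (ENNReal.mul_ne_top (ENNReal.natCast_ne_top T) hfin)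
    (sum_userInfo_wordLaw_le_mul_separateSumInfo C hC Q hT c hc) ha
  set e := (errorProb (parallel fun k => (C k).kernel) c.enc c.dec).toReal
  have he : 0 ≤ e := ENNReal.toReal_nonneg
  have hT1 : (1 : ℝ) ≤ T := by exact_mod_cast hT
  have hrate : ∑ i, Real.log (c.numMsg i) = T * ∑ i, c.rate i := by
    rw [Finset.mul_sum]
    exact Finset.sum_congr rfl fun i _ => (mul_div_cancel₀ _ (by linarith)).symm
  have hremainder : 0 ≤ ((m + 1 : ℕ) : ℝ) * (Real.log (1 + a) - (1 - e) * Real.log a) := by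
    have hlog : Real.log a ≤ Real.log (1 + a) := Real.log_le_log (by linarith) (by linarith)
    have hloga : 0 ≤ e * Real.log a := mul_nonneg he (Real.log_nonneg ha)
    exact mul_nonneg (Nat.cast_nonneg _) (by linarith)
  rw [hrate, ENNReal.toReal_mul, ENNReal.toReal_natCast, Fintype.card_fin] at hbound
  refine le_of_mul_le_mul_left ?_ (zero_lt_one.trans_le hT1)
  linarith [mul_le_mul_of_nonneg_right hT1 hremainder]

theorem sumCapacity_le_separateSumInfo :
    sumCapacity (fun k => (C k).kernel) Q ≤ separateSumInfo (fun k => (C k).kernel) Q := by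
  by_cases hfin : separateSumInfo (fun k => (C k).kernel) Q = ∞
  · exact hfin ▸ le_top
  have hachievable : {R : Fin (m + 1) → ℝ | Achievable (fun k => (C k).kernel) Q R} ⊆
      {R | ∑ i, R i ≤ (separateSumInfo (fun k => (C k).kernel) Q).toReal} := by
    rintro R ⟨T, c, hT, hrate, hcost, herror⟩
    refine le_of_forall_one_sub_mul_le_add_log (c := (m + 1 : ℕ))
      ((ENNReal.tendsto_toReal ENNReal.zero_ne_top).comp herror) fun n a ha => ?_
    simpa only [Function.comp_apply, hrate n] using
      one_sub_errorProb_mul_sum_rate_le C hC Q hfin (hT n) (c n) (hcost n) ha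
  refine iSup₂_le fun R hR => ?_
  have hsum := closure_minimal hachievable (isClosed_le (by fun_prop) continuous_const) hR
  exact (ENNReal.ofReal_le_ofReal hsum).trans ENNReal.ofReal_toReal_le

end Converse

/-! ### Bounded tests -/

section Test

variable {α : Type*} [MeasurableSpace α]

/-- A score for testing a law against `σ`: a bounded measurable function whose exponential has
expectation at most one under `σ`, so that large values are exponentially unlikely under `σ`. The
model is the log-likelihood ratio, which satisfies all of this except for boundedness. -/
structure IsBoundedScore (g : α → ℝ) (σ : Measure α) : Prop where
  measurable : Measurable g
  exists_abs_le : ∃ b, ∀ x, |g x| ≤ b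
  lintegral_exp_le_one : ∫⁻ x, ENNReal.ofReal (Real.exp (g x)) ∂σ ≤ 1

lemma isBoundedScore_zero (σ : Measure α) [IsProbabilityMeasure σ] :
    IsBoundedScore (fun _ => 0) σ :=
  ⟨measurable_const, ⟨0, by simp⟩, by simp⟩

/-- The number `t` truncated to the interval `[b⁻¹, b]`, for `1 ≤ b`; used to make the logarithm of
a density bounded. -/
def truncInv (b t : ℝ) : ℝ := max b⁻¹ (min t b)

lemma measurable_truncInv (b : ℝ) : Measurable (truncInv b) :=
  measurable_const.max (measurable_id.min measurable_const)

lemma truncInv_pos {b : ℝ} (hb : 0 < b) (t : ℝ) : 0 < truncInv b t :=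
  lt_max_of_lt_left (inv_pos.2 hb)

lemma truncInv_of_mem_Icc {b t : ℝ} (ht : t ∈ Set.Icc b⁻¹ b) : truncInv b t = t := by
  rw [truncInv, min_eq_left ht.2, max_eq_right ht.1]

lemma truncInv_of_le {b t : ℝ} (hb : 1 ≤ b) (ht : b ≤ t) : truncInv b t = b := by
  rw [truncInv, min_eq_right ht, max_eq_right ((inv_le_one_of_one_le₀ hb).trans hb)]

lemma truncInv_le_add_inv {b t : ℝ} (hb : 0 ≤ b) (ht : 0 ≤ t) : truncInv b t ≤ t + b⁻¹ :=
  max_le (le_add_of_nonneg_left ht)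
    ((min_le_left _ _).trans (le_add_of_nonneg_right (inv_nonneg.2 hb)))

lemma abs_log_truncInv_le {b : ℝ} (hb : 1 ≤ b) (t : ℝ) :
    |Real.log (truncInv b t)| ≤ Real.log b := by
  have hb0 : 0 < b := zero_lt_one.trans_le hb
  rw [abs_le, ← Real.log_inv]
  exact ⟨Real.log_le_log (inv_pos.2 hb0) (le_max_left _ _), Real.log_le_log (truncInv_pos hb0 t)
    (max_le ((inv_le_one_of_one_le₀ hb).trans hb) (min_le_right _ _))⟩

lemma mul_log_truncInv_sub_add_one_nonneg {b t : ℝ} (hb : Real.exp 1 ≤ b) (ht : 0 ≤ t) :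
    0 ≤ t * Real.log (truncInv b t) - t + 1 := by
  have hb0 : 0 < b := (Real.exp_pos 1).trans_le hb
  rcases le_or_gt t b with htb | htb
  · rcases ht.eq_or_lt with rfl | ht0
    · simp
    · have hlog := mul_le_mul_of_nonneg_left
        (Real.log_le_log ht0 ((le_min le_rfl htb).trans (le_max_right b⁻¹ _))) ht
      have hkl := klFun_nonneg ht
      rw [klFun_apply] at hkl
      rw [truncInv]
      linarith
  · rw [truncInv_of_le ((Real.one_le_exp zero_le_one).trans hb) htb.le]
    have hlog := mul_le_mul_of_nonneg_left ((Real.le_log_iff_exp_le hb0).2 hb) ht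
    linarith

lemma tendsto_mul_log_truncInv_sub_add_one {t : ℝ} (ht : 0 ≤ t) :
    Tendsto (fun b => t * Real.log (truncInv b t) - t + 1) atTop (𝓝 (klFun t)) := by
  rcases ht.eq_or_lt with rfl | ht0
  · simp [klFun_zero]
  · refine tendsto_const_nhds.congr' ?_
    filter_upwards [eventually_ge_atTop t, eventually_ge_atTop t⁻¹] with b htb htb'
    rw [truncInv_of_mem_Icc ⟨inv_le_of_inv_le₀ ht0 htb', htb⟩, klFun_apply]
    ring

variable (ρ σ : Measure α)

lemma measurable_truncInv_rnDeriv (b : ℝ) :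
    Measurable fun x => truncInv b (ρ.rnDeriv σ x).toReal :=
  (measurable_truncInv b).comp (Measure.measurable_rnDeriv ρ σ).ennreal_toReal

lemma integrable_log_truncInv_rnDeriv (μ : Measure α) [IsFiniteMeasure μ] {b : ℝ} (hb : 1 ≤ b) :
    Integrable (fun x => Real.log (truncInv b (ρ.rnDeriv σ x).toReal)) μ :=
  Integrable.of_bound (measurable_truncInv_rnDeriv ρ σ b).log.aestronglyMeasurable _
    (ae_of_all _ fun _ => (Real.norm_eq_abs _).trans_le (abs_log_truncInv_le hb _))

variable [IsProbabilityMeasure ρ] [IsProbabilityMeasure σ]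

lemma lintegral_truncInv_rnDeriv_le {b : ℝ} (hb : 0 ≤ b) :
    ∫⁻ x, ENNReal.ofReal (truncInv b (ρ.rnDeriv σ x).toReal) ∂σ ≤ ENNReal.ofReal (1 + b⁻¹) :=
  calc ∫⁻ x, ENNReal.ofReal (truncInv b (ρ.rnDeriv σ x).toReal) ∂σ
      ≤ ∫⁻ x, (ρ.rnDeriv σ x + ENNReal.ofReal b⁻¹) ∂σ := by
        refine lintegral_mono fun x => ?_
        refine (ENNReal.ofReal_le_ofReal (truncInv_le_add_inv hb ENNReal.toReal_nonneg)).trans ?_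
        rw [ENNReal.ofReal_add ENNReal.toReal_nonneg (inv_nonneg.2 hb)]
        exact add_le_add_left ENNReal.ofReal_toReal_le _
    _ ≤ 1 + ENNReal.ofReal b⁻¹ := by
        rw [lintegral_add_right _ measurable_const, lintegral_const, measure_univ, mul_one]
        exact add_le_add_left (Measure.lintegral_rnDeriv_le.trans_eq measure_univ) _
    _ = ENNReal.ofReal (1 + b⁻¹) := by
        rw [ENNReal.ofReal_add zero_le_one (inv_nonneg.2 hb), ENNReal.ofReal_one]

variable {ρ σ}

lemma lintegral_mul_log_truncInv_rnDeriv (hac : ρ ≪ σ) {b : ℝ} (hb : Real.exp 1 ≤ b) :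
    ∫⁻ x, ENNReal.ofReal ((ρ.rnDeriv σ x).toReal *
        Real.log (truncInv b (ρ.rnDeriv σ x).toReal) - (ρ.rnDeriv σ x).toReal + 1) ∂σ =
      ENNReal.ofReal (∫ x, Real.log (truncInv b (ρ.rnDeriv σ x).toReal) ∂ρ) := by
  have hb1 : 1 ≤ b := (Real.one_le_exp zero_le_one).trans hb
  have hd : Integrable (fun x => (ρ.rnDeriv σ x).toReal) σ := Measure.integrable_toReal_rnDeriv
  have hdlog : Integrable (fun x => (ρ.rnDeriv σ x).toReal *
      Real.log (truncInv b (ρ.rnDeriv σ x).toReal)) σ :=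
    hd.mul_bdd (c := Real.log b) (measurable_truncInv_rnDeriv ρ σ b).log.aestronglyMeasurable
      (ae_of_all _ fun _ => (Real.norm_eq_abs _).trans_le (abs_log_truncInv_le hb1 _))
  have hchange : ∫ x, (ρ.rnDeriv σ x).toReal * Real.log (truncInv b (ρ.rnDeriv σ x).toReal) ∂σ =
      ∫ x, Real.log (truncInv b (ρ.rnDeriv σ x).toReal) ∂ρ := by
    simpa only [smul_eq_mul] using integral_rnDeriv_smul
      (f := fun x => Real.log (truncInv b (ρ.rnDeriv σ x).toReal)) hac
  refine (ofReal_integral_eq_lintegral_ofReal ((hdlog.sub hd).add (integrable_const 1))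
    (ae_of_all _ fun _ => mul_log_truncInv_sub_add_one_nonneg hb ENNReal.toReal_nonneg)).symm.trans
    (congrArg ENNReal.ofReal ?_)
  rw [integral_add' (hdlog.sub hd) (integrable_const 1), integral_sub' hdlog hd, hchange,
    Measure.integral_toReal_rnDeriv hac]
  simp

lemma klDiv_le_liminf_integral_log_truncInv_rnDeriv (hac : ρ ≪ σ) :
    klDiv ρ σ ≤ liminf (fun n : ℕ => ENNReal.ofReal
      (∫ x, Real.log (truncInv n (ρ.rnDeriv σ x).toReal) ∂ρ)) atTop := by
  have hmeas : ∀ n : ℕ, Measurable fun x => ENNReal.ofReal ((ρ.rnDeriv σ x).toReal *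
      Real.log (truncInv n (ρ.rnDeriv σ x).toReal) - (ρ.rnDeriv σ x).toReal + 1) := fun n =>
    have hd := (Measure.measurable_rnDeriv ρ σ).ennreal_toReal
    (((hd.mul (measurable_truncInv_rnDeriv ρ σ n).log).sub hd).add_const 1).ennreal_ofReal
  calc klDiv ρ σ = ∫⁻ x, liminf (fun n : ℕ => ENNReal.ofReal ((ρ.rnDeriv σ x).toReal *
        Real.log (truncInv n (ρ.rnDeriv σ x).toReal) - (ρ.rnDeriv σ x).toReal + 1)) atTop ∂σ := by
        rw [klDiv_eq_lintegral_klFun_of_ac hac]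
        exact lintegral_congr fun x => (ENNReal.tendsto_ofReal
          ((tendsto_mul_log_truncInv_sub_add_one ENNReal.toReal_nonneg).comp
            tendsto_natCast_atTop_atTop)).liminf_eq.symm
    _ ≤ _ := lintegral_liminf_le hmeas
    _ = _ := liminf_congr <| by
        filter_upwards [tendsto_natCast_atTop_atTop.eventually_ge_atTop (Real.exp 1)] with n hn
        exact lintegral_mul_log_truncInv_rnDeriv hac hn

lemma isBoundedScore_log_truncInv_rnDeriv (ρ σ : Measure α) [IsProbabilityMeasure ρ]
    [IsProbabilityMeasure σ] {b : ℝ} (hb : 1 ≤ b) :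
    IsBoundedScore
      (fun x => Real.log (truncInv b (ρ.rnDeriv σ x).toReal) - Real.log (1 + b⁻¹)) σ where
  measurable := (measurable_truncInv_rnDeriv ρ σ b).log.sub_const _
  exists_abs_le := ⟨Real.log b + |Real.log (1 + b⁻¹)|, fun x =>
    (abs_sub _ _).trans (add_le_add_left (abs_log_truncInv_le hb _) _)⟩
  lintegral_exp_le_one := by
    have hb0 : 0 < b := zero_lt_one.trans_le hb
    have hK : 0 < 1 + b⁻¹ := by positivity
    simp only [Real.exp_sub, Real.exp_log (truncInv_pos hb0 _), Real.exp_log hK,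
      ENNReal.ofReal_div_of_pos hK, ENNReal.div_eq_inv_mul]
    rw [lintegral_const_mul _ (measurable_truncInv_rnDeriv ρ σ b).ennreal_ofReal]
    exact (mul_le_mul_right (lintegral_truncInv_rnDeriv_le ρ σ hb0.le) _).trans
      (ENNReal.inv_mul_le_one _)

lemma exists_isBoundedScore_of_ac (hac : ρ ≪ σ) {a : ℝ≥0} (h : (a : ℝ≥0∞) < klDiv ρ σ) :
    ∃ g, IsBoundedScore g σ ∧ (a : ℝ) ≤ ∫ x, g x ∂ρ := by
  obtain ⟨b, hab, hb⟩ := ENNReal.lt_iff_exists_nnreal_btwn.1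
    (h.trans_le (klDiv_le_liminf_integral_log_truncInv_rnDeriv hac))
  have hlog : Tendsto (fun n : ℕ => Real.log (1 + (n : ℝ)⁻¹)) atTop (𝓝 0) := by
    have hinv : Tendsto (fun n : ℕ => 1 + (n : ℝ)⁻¹) atTop (𝓝 1) := by
      simpa using (tendsto_inv_atTop_nhds_zero_nat (𝕜 := ℝ)).const_add 1
    simpa using hinv.log one_ne_zero
  have hab' : (a : ℝ) < b := by exact_mod_cast hab
  obtain ⟨n, ⟨hbn, hlogn⟩, hn⟩ := (((eventually_lt_of_lt_liminf hb).and
    (hlog.eventually_lt_const (sub_pos.2 hab'))).and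
      (eventually_ge_atTop 1)).exists
  have hn1 : (1 : ℝ) ≤ n := by exact_mod_cast hn
  refine ⟨_, isBoundedScore_log_truncInv_rnDeriv ρ σ hn1, ?_⟩
  rw [integral_sub (integrable_log_truncInv_rnDeriv ρ σ ρ hn1) (integrable_const _)]
  have hbn' : (b : ℝ) < ∫ x, Real.log (truncInv n (ρ.rnDeriv σ x).toReal) ∂ρ :=
    ENNReal.lt_ofReal_iff_toReal_lt ENNReal.coe_ne_top |>.1 hbn
  simp only [integral_const, probReal_univ, one_smul]
  linarith

lemma exists_isBoundedScore_of_not_ac (hac : ¬ ρ ≪ σ) (a : ℝ≥0) :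
    ∃ g, IsBoundedScore g σ ∧ (a : ℝ) ≤ ∫ x, g x ∂ρ := by
  obtain ⟨A, hA, hσA, hρA⟩ : ∃ A, MeasurableSet A ∧ σ A = 0 ∧ ρ A ≠ 0 := by
    by_contra! hcon
    exact hac (Measure.AbsolutelyContinuous.mk hcon)
  have hpos : 0 < ρ.real A := ENNReal.toReal_pos hρA (measure_ne_top ρ A)
  refine ⟨A.indicator fun _ => a / ρ.real A, ⟨measurable_const.indicator hA,
    ⟨|a / ρ.real A|, fun x => ?_⟩, le_of_eq ?_⟩, le_of_eq ?_⟩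
  · exact norm_indicator_le_norm_self (fun _ => (a : ℝ) / ρ.real A) x
  · have hone : (fun x => ENNReal.ofReal (Real.exp (A.indicator (fun _ => (a : ℝ) / ρ.real A) x)))
        =ᵐ[σ] fun _ => 1 := by
      filter_upwards [measure_eq_zero_iff_ae_notMem.1 hσA] with x hx
      simp [hx]
    simp [lintegral_congr_ae hone]
  · rw [integral_indicator_const _ hA, smul_eq_mul, mul_div_cancel₀ _ hpos.ne']

/-- The lower half of the Donsker-Varadhan formula; `integral_le_klDiv_add_log` is the other one. -/
theorem exists_isBoundedScore {a : ℝ≥0} (h : (a : ℝ≥0∞) < klDiv ρ σ) :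
    ∃ g, IsBoundedScore g σ ∧ (a : ℝ) ≤ ∫ x, g x ∂ρ := by
  by_cases hac : ρ ≪ σ
  · exact exists_isBoundedScore_of_ac hac h
  · exact exists_isBoundedScore_of_not_ac hac a

end Test

/-! ### Random coding with threshold decoding -/

lemma measure_pi_setOf_sum_le_le {J : Type*} [Fintype J] [Nonempty J]
    {A : J → Type*} [∀ τ, MeasurableSpace (A τ)]
    (μ : ∀ τ, Measure (A τ)) [∀ τ, IsProbabilityMeasure (μ τ)] {X : ∀ τ, A τ → ℝ}
    (hX : ∀ τ, Measurable (X τ)) {B : ℝ} (hB : ∀ τ x, |X τ x| ≤ B) {c ε : ℝ} (hε : 0 < ε)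
    (hc : c + Fintype.card J * ε ≤ ∑ τ, ∫ x, X τ x ∂(μ τ)) :
    Measure.pi μ {x | ∑ τ, X τ (x τ) ≤ c} ≤ ENNReal.ofReal (B ^ 2 / (Fintype.card J * ε ^ 2)) := by
  set n : ℝ := (Fintype.card J : ℝ) with hn
  have hn0 : 0 < n := Nat.cast_pos.2 Fintype.card_pos
  set S : (∀ τ, A τ) → ℝ := ∑ τ, fun x => X τ (x τ)
  have hSapply : ∀ x, S x = ∑ τ, X τ (x τ) := fun x => Finset.sum_apply _ _ _
  have hLp : ∀ τ, MemLp (X τ) 2 (μ τ) := fun τ =>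
    MemLp.of_bound (hX τ).aestronglyMeasurable B (ae_of_all _ fun x => hB τ x)
  have hSLp : MemLp S 2 (Measure.pi μ) :=
    memLp_finsetSum' _ fun τ _ => (hLp τ).comp_measurePreserving (measurePreserving_eval μ τ)
  have hmean : ∫ x, S x ∂(Measure.pi μ) = ∑ τ, ∫ x, X τ x ∂(μ τ) := by
    simp only [hSapply]
    rw [integral_finsetSum _ fun τ _ => integrable_comp_eval ((hLp τ).integrable one_le_two)]
    exact Finset.sum_congr rfl fun τ _ => integral_comp_eval (hX τ).aestronglyMeasurable
  have hvar : Var[S; Measure.pi μ] ≤ n * B ^ 2 :=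
    calc Var[S; Measure.pi μ] = ∑ τ, Var[X τ; μ τ] := variance_sum_pi hLp
      _ ≤ ∑ _τ : J, ((B - -B) / 2) ^ 2 := Finset.sum_le_sum fun τ _ =>
          variance_le_sq_of_bounded (ae_of_all _ fun x => abs_le.1 (hB τ x)) (hX τ).aemeasurable
      _ = n * B ^ 2 := by simp [hn]
  calc Measure.pi μ {x | ∑ τ, X τ (x τ) ≤ c}
      ≤ Measure.pi μ {x | n * ε ≤ |S x - ∫ x, S x ∂(Measure.pi μ)|} := by
        refine measure_mono fun x (hx : ∑ τ, X τ (x τ) ≤ c) => ?_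
        rw [Set.mem_ofPred_eq, hmean, hSapply, abs_sub_comm]
        exact le_trans (by linarith) (le_abs_self _)
    _ ≤ ENNReal.ofReal (Var[S; Measure.pi μ] / (n * ε) ^ 2) :=
        meas_ge_le_variance_div_sq hSLp (mul_pos hn0 hε)
    _ ≤ ENNReal.ofReal (n * B ^ 2 / (n * ε) ^ 2) := by gcongr
    _ = ENNReal.ofReal (B ^ 2 / (n * ε ^ 2)) := by
        congr 1
        field_simp

lemma measure_setOf_lt_le_exp_neg {α : Type*} [MeasurableSpace α] (ν : Measure α) {G : α → ℝ}
    (hG : Measurable G) (hexp : ∫⁻ x, ENNReal.ofReal (Real.exp (G x)) ∂ν ≤ 1) (γ : ℝ) :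
    ν {x | γ < G x} ≤ ENNReal.ofReal (Real.exp (-γ)) := by
  have hpos : 0 < Real.exp γ := Real.exp_pos γ
  calc ν {x | γ < G x}
      ≤ ν {x | ENNReal.ofReal (Real.exp γ) ≤ ENNReal.ofReal (Real.exp (G x))} :=
        measure_mono fun x (hx : γ < G x) => ENNReal.ofReal_le_ofReal (Real.exp_le_exp.2 hx.le)
    _ ≤ (∫⁻ x, ENNReal.ofReal (Real.exp (G x)) ∂ν) / ENNReal.ofReal (Real.exp γ) :=
        meas_ge_le_lintegral_div hG.exp.ennreal_ofReal.aemeasurable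
          (ENNReal.ofReal_pos.2 hpos).ne' ENNReal.ofReal_ne_top
    _ ≤ 1 / ENNReal.ofReal (Real.exp γ) := by gcongr
    _ = ENNReal.ofReal (Real.exp (-γ)) := by
        rw [one_div, ← ENNReal.ofReal_inv_of_pos hpos, Real.exp_neg]

section RandomCoding

variable {A B M : Type*}

/-- The threshold decoder for the codebook `b` and the score `G`: it returns a message whose
codeword has a score above `γ` with the received word, and an arbitrary one if there is none. -/
def thresholdDec [Nonempty M] (G : A × B → ℝ) (γ : ℝ) (b : M → A) (y : B) : M :=
  Classical.epsilon fun i => γ < G (b i, y)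

lemma le_or_exists_lt_of_thresholdDec_ne [Nonempty M] {G : A × B → ℝ} {γ : ℝ} {b : M → A} {y : B}
    {w : M} (h : thresholdDec G γ b y ≠ w) :
    G (b w, y) ≤ γ ∨ ∃ i ≠ w, γ < G (b i, y) := by
  rcases le_or_gt (G (b w, y)) γ with hw | hw
  · exact Or.inl hw
  · exact Or.inr ⟨_, h, Classical.epsilon_spec (p := fun i => γ < G (b i, y)) ⟨w, hw⟩⟩

variable [MeasurableSpace A] [MeasurableSpace B]

lemma measurable_thresholdDec [Finite M] [Nonempty M] [MeasurableSpace M] {G : A × B → ℝ}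
    (hG : Measurable G) (γ : ℝ) :
    Measurable (Function.uncurry (thresholdDec (M := M) G γ)) := by
  have hscores : Measurable fun (z : (M → A) × B) (i : M) => γ < G (z.1 i, z.2) :=
    measurable_pi_iff.2 fun i => measurableSet_setOfPred.1 <|
      measurableSet_lt measurable_const (hG.comp (by fun_prop))
  exact (Measurable.of_discrete (f := Classical.epsilon)).comp hscores

variable [Fintype M] (P : Measure A) [IsProbabilityMeasure P] (K : Kernel A B) [IsMarkovKernel K]
  {S : Set (A × B)}

lemma lintegral_pi_kernel_prodMk_self (hS : MeasurableSet S) (w : M) :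
    ∫⁻ b : M → A, K (b w) (Prod.mk (b w) ⁻¹' S) ∂(Measure.pi fun _ => P) = (P ⊗ₘ K) S := by
  rw [Measure.compProd_apply hS]
  exact (measurePreserving_eval (fun _ : M => P) w).lintegral_comp
    (Kernel.measurable_kernel_prodMk_left hS)

omit [Fintype M] in
lemma measurable_kernel_apply_prodMk_apply (hS : MeasurableSet S) (w i : M) :
    Measurable fun b : M → A => K (b w) (Prod.mk (b i) ⁻¹' S) :=
  Kernel.measurable_kernel_prodMk_left (κ := K.comap _ (measurable_pi_apply w))
    (t := {z : (M → A) × B | (z.1 i, z.2) ∈ S}) (measurableSet_preimage (by fun_prop) hS)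

/-- A wrong codeword is independent of the received word. -/
lemma lintegral_pi_kernel_prodMk_of_ne (hS : MeasurableSet S) {w i : M} (hi : i ≠ w) :
    ∫⁻ b : M → A, K (b w) (Prod.mk (b i) ⁻¹' S) ∂(Measure.pi fun _ => P) =
      (P.prod (K ∘ₘ P)) S := by
  classical
  rw [lintegral_pi_update _ i (measurable_kernel_apply_prodMk_apply K hS w i),
    Measure.prod_apply hS]
  refine lintegral_congr fun a => ?_
  have hSa : MeasurableSet (Prod.mk a ⁻¹' S) := measurable_prodMk_left hS
  simp only [Function.update_of_ne hi.symm, Function.update_self]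
  rw [Measure.bind_apply hSa (Kernel.aemeasurable _)]
  exact (measurePreserving_eval (fun _ : M => P) w).lintegral_comp (K.measurable_coe hSa)

theorem lintegral_thresholdDec_ne_le [Nonempty M] {G : A × B → ℝ} (hG : Measurable G) (γ : ℝ)
    (w : M) :
    ∫⁻ b : M → A, K (b w) {y | thresholdDec G γ b y ≠ w} ∂(Measure.pi fun _ => P) ≤
      (P ⊗ₘ K) {z | G z ≤ γ} + Fintype.card M * (P.prod (K ∘ₘ P)) {z | γ < G z} := by
  classical
  have hle : MeasurableSet {z | G z ≤ γ} := measurableSet_le hG measurable_const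
  have hlt : MeasurableSet {z | γ < G z} := measurableSet_lt measurable_const hG
  have hunion : ∀ b : M → A, K (b w) {y | thresholdDec G γ b y ≠ w} ≤
      K (b w) (Prod.mk (b w) ⁻¹' {z | G z ≤ γ}) +
        ∑ i ∈ Finset.univ.erase w, K (b w) (Prod.mk (b i) ⁻¹' {z | γ < G z}) := by
    intro b
    refine (measure_mono (t := (Prod.mk (b w) ⁻¹' {z | G z ≤ γ}) ∪
      ⋃ i ∈ Finset.univ.erase w, Prod.mk (b i) ⁻¹' {z | γ < G z}) fun y hy => ?_).trans
      ((measure_union_le _ _).trans (add_le_add_right (measure_biUnion_finset_le _ _) _))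
    simpa using le_or_exists_lt_of_thresholdDec_ne hy
  calc ∫⁻ b : M → A, K (b w) {y | thresholdDec G γ b y ≠ w} ∂(Measure.pi fun _ => P)
      ≤ (P ⊗ₘ K) {z | G z ≤ γ} +
        ∑ _i ∈ Finset.univ.erase w, (P.prod (K ∘ₘ P)) {z | γ < G z} := by
        refine (lintegral_mono hunion).trans_eq ?_
        rw [lintegral_add_left (measurable_kernel_apply_prodMk_apply K hle w w),
          lintegral_finsetSum _ fun i _ => measurable_kernel_apply_prodMk_apply K hlt w i,
          lintegral_pi_kernel_prodMk_self P K hle]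
        congr 1
        exact Finset.sum_congr rfl fun i hi =>
          lintegral_pi_kernel_prodMk_of_ne P K hlt (Finset.ne_of_mem_erase hi)
    _ ≤ (P ⊗ₘ K) {z | G z ≤ γ} + Fintype.card M * (P.prod (K ∘ₘ P)) {z | γ < G z} := by
        rw [Finset.sum_const, nsmul_eq_mul]
        gcongr
        exact Finset.card_le_univ _

end RandomCoding

section BlockRandomCoding

variable {J : Type*} [Fintype J] {A B : J → Type*}

/-- The score of a pair of words: the sum of the scores of their letters. -/
def blockScore (g : ∀ τ, A τ × B τ → ℝ) (z : (∀ τ, A τ) × ∀ τ, B τ) : ℝ :=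
  ∑ τ, g τ (z.1 τ, z.2 τ)

variable [∀ τ, MeasurableSpace (A τ)] [∀ τ, MeasurableSpace (B τ)]
  {g : ∀ τ, A τ × B τ → ℝ} (hg : ∀ τ, Measurable (g τ))

include hg in
lemma measurable_blockScore : Measurable (blockScore g) :=
  Finset.measurable_sum _ fun τ _ => (hg τ).comp (by fun_prop)

include hg in
lemma lintegral_exp_blockScore (μ : ∀ τ, Measure (A τ)) [∀ τ, IsProbabilityMeasure (μ τ)]
    (ν : ∀ τ, Measure (B τ)) [∀ τ, IsProbabilityMeasure (ν τ)] :
    ∫⁻ z, ENNReal.ofReal (Real.exp (blockScore g z)) ∂((Measure.pi μ).prod (Measure.pi ν)) =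
      ∏ τ, ∫⁻ z, ENNReal.ofReal (Real.exp (g τ z)) ∂((μ τ).prod (ν τ)) := by
  have hexp : ∀ τ, Measurable fun z => ENNReal.ofReal (Real.exp (g τ z)) := fun τ =>
    (hg τ).exp.ennreal_ofReal
  have hprod : Measurable fun z : ∀ τ, A τ × B τ =>
      ∏ τ, ENNReal.ofReal (Real.exp (g τ (z τ))) :=
    Finset.measurable_prod _ fun τ _ => (hexp τ).comp (measurable_pi_apply τ)
  rw [← lintegral_prod_pi _ hexp, ← pi_prod_pi, lintegral_map hprod measurable_pi_prodMk]
  refine lintegral_congr fun z => ?_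
  rw [blockScore, Real.exp_sum, ENNReal.ofReal_prod_of_nonneg fun _ _ => (Real.exp_pos _).le]

include hg in
lemma compProd_piKernel_setOf_blockScore_le (μ : ∀ τ, Measure (A τ))
    [∀ τ, IsProbabilityMeasure (μ τ)] (U : ∀ τ, Kernel (A τ) (B τ)) [∀ τ, IsMarkovKernel (U τ)]
    (γ : ℝ) :
    (Measure.pi μ ⊗ₘ piKernel U) {z | blockScore g z ≤ γ} =
      (Measure.pi fun τ => μ τ ⊗ₘ U τ) {z | ∑ τ, g τ (z τ) ≤ γ} := by
  have hsum : Measurable fun z : ∀ τ, A τ × B τ => ∑ τ, g τ (z τ) := by fun_prop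
  rw [← pi_compProd_piKernel,
    Measure.map_apply measurable_pi_prodMk (measurableSet_le hsum measurable_const)]
  rfl

include hg in
theorem lintegral_thresholdDec_blockScore_ne_le {M : Type*} [Fintype M] [Nonempty M]
    (μ : ∀ τ, Measure (A τ)) [∀ τ, IsProbabilityMeasure (μ τ)] (U : ∀ τ, Kernel (A τ) (B τ))
    [∀ τ, IsMarkovKernel (U τ)]
    (hexp : ∀ τ, ∫⁻ z, ENNReal.ofReal (Real.exp (g τ z)) ∂((μ τ).prod (U τ ∘ₘ μ τ)) ≤ 1)
    (γ : ℝ) (w : M) :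
    ∫⁻ b : M → ∀ τ, A τ, piKernel U (b w) {y | thresholdDec (blockScore g) γ b y ≠ w}
        ∂(Measure.pi fun _ => Measure.pi μ) ≤
      (Measure.pi fun τ => μ τ ⊗ₘ U τ) {z | ∑ τ, g τ (z τ) ≤ γ} +
        Fintype.card M * ENNReal.ofReal (Real.exp (-γ)) := by
  refine (lintegral_thresholdDec_ne_le _ _ (measurable_blockScore hg) γ w).trans ?_
  rw [compProd_piKernel_setOf_blockScore_le hg, piKernel_comp_pi]
  gcongr
  refine measure_setOf_lt_le_exp_neg _ (measurable_blockScore hg) ?_ γ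
  rw [lintegral_exp_blockScore hg]
  exact Finset.prod_le_one' fun τ _ => hexp τ

end BlockRandomCoding

/-! ### Periodic sequences -/

lemma sum_range_mul_periodic {α : Type*} [AddCommMonoid α] {N : ℕ} (a : Fin (N + 1) → α)
    (n : ℕ) :
    ∑ τ ∈ Finset.range (n * (N + 1)), a (Fin.ofNat (N + 1) τ) = n • ∑ s, a s := by
  induction n with
  | zero => simp
  | succ n ih =>
    rw [add_mul, one_mul, Finset.sum_range_add, ih, succ_nsmul, Finset.sum_range]
    congr 1
    refine Finset.sum_congr rfl fun s _ => congrArg a (Fin.ext ?_)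
    simp [Fin.ofNat, Nat.mod_eq_of_lt s.2]

lemma mul_sum_le_sum_periodic {N : ℕ} {a : Fin (N + 1) → ℝ} (ha : ∀ s, 0 ≤ a s) (T : ℕ) :
    (T : ℝ) * ((∑ s, a s) / (N + 1)) - ∑ s, a s ≤ ∑ τ : Fin T, a (Fin.ofNat (N + 1) τ) := by
  set n := T / (N + 1)
  have hperiods : (n : ℝ) * ∑ s, a s ≤ ∑ τ : Fin T, a (Fin.ofNat (N + 1) τ) := by
    rw [← nsmul_eq_mul, ← sum_range_mul_periodic, ← Finset.sum_range
      (f := fun τ => a (Fin.ofNat (N + 1) τ))]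
    exact Finset.sum_le_sum_of_subset_of_nonneg
      (Finset.range_subset_range.2 (Nat.div_mul_le_self T (N + 1))) fun _ _ _ => ha _
  have hT : (T : ℝ) ≤ (n + 1) * (N + 1) := by
    rw [mul_comm]
    exact_mod_cast (Nat.lt_mul_div_succ T (Nat.succ_pos N)).le
  have hS : 0 ≤ ∑ s, a s := Finset.sum_nonneg fun s _ => ha s
  have hmean : (T : ℝ) * ((∑ s, a s) / (N + 1)) ≤ (n + 1) * ∑ s, a s := by
    rw [mul_div_assoc', div_le_iff₀ (by positivity)]
    nlinarith
  linarith

lemma sum_periodic_le {N : ℕ} (a : Fin (N + 1) → ℝ≥0∞) (T : ℕ) :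
    ∑ τ : Fin T, a (Fin.ofNat (N + 1) τ) ≤ ((T / (N + 1) + 1 : ℕ) : ℝ≥0∞) * ∑ s, a s := by
  rw [← nsmul_eq_mul, ← sum_range_mul_periodic, ← Finset.sum_range
    (f := fun τ => a (Fin.ofNat (N + 1) τ))]
  refine Finset.sum_le_sum_of_subset (Finset.range_subset_range.2 ?_)
  rw [mul_comm]
  exact (Nat.lt_mul_div_succ T (Nat.succ_pos N)).le

lemma tendsto_measure_pi_sum_periodic_le {α : Type*} [MeasurableSpace α] {N : ℕ}
    (ν : Fin (N + 1) → Measure α) [∀ s, IsProbabilityMeasure (ν s)] {g : Fin (N + 1) → α → ℝ}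
    (hg : ∀ s, Measurable (g s)) (hbdd : ∀ s, ∃ b, ∀ x, |g s x| ≤ b)
    (hmean : ∀ s, 0 ≤ ∫ x, g s x ∂(ν s)) {c : ℝ} (hc : c < (∑ s, ∫ x, g s x ∂(ν s)) / (N + 1)) :
    Tendsto (fun T : ℕ => (Measure.pi fun τ : Fin T => ν (Fin.ofNat (N + 1) τ))
      {x | ∑ τ : Fin T, g (Fin.ofNat (N + 1) τ) (x τ) ≤ T * c}) atTop (𝓝 0) := by
  choose b hb using hbdd
  set S := ∑ s, ∫ x, g s x ∂(ν s)
  set D := ∑ s, |b s|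
  have hD : ∀ s x, |g s x| ≤ D := fun s x => ((hb s x).trans (le_abs_self _)).trans
    (Finset.single_le_sum (f := fun s => |b s|) (fun _ _ => abs_nonneg _) (Finset.mem_univ s))
  obtain ⟨ε, hε0, hε⟩ : ∃ ε > 0, c + 2 * ε = S / (N + 1) :=
    ⟨(S / (N + 1) - c) / 2, half_pos (sub_pos.2 hc), by ring⟩
  have hlim : Tendsto (fun T : ℕ => ENNReal.ofReal (D ^ 2 / (T * ε ^ 2))) atTop (𝓝 0) := by
    simpa using ENNReal.tendsto_ofReal (Tendsto.const_div_atTop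
      (tendsto_natCast_atTop_atTop.atTop_mul_const (pow_pos hε0 2)) (D ^ 2))
  refine tendsto_of_tendsto_of_tendsto_of_le_of_le' tendsto_const_nhds hlim
    (Eventually.of_forall fun _ => zero_le) ?_
  filter_upwards [eventually_gt_atTop 0, (tendsto_natCast_atTop_atTop.atTop_mul_const
    hε0).eventually_ge_atTop S] with T hT hST
  have : Nonempty (Fin T) := ⟨⟨0, hT⟩⟩
  have hsum := mul_sum_le_sum_periodic hmean T
  rw [← hε] at hsum
  refine (measure_pi_setOf_sum_le_le _ (fun τ => hg _) (fun τ => hD _) hε0 ?_).trans_eq (by simp)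
  rw [Fintype.card_fin]
  linarith

/-! ### A single user over a periodic memoryless channel -/

lemma exists_lt_sum {ι : Type*} [Fintype ι] {f : ι → ℝ≥0∞} {R : ℝ≥0∞} (h : R < ∑ i, f i) :
    ∃ a : ι → ℝ≥0, (∀ i, a i = 0 ∨ (a i : ℝ≥0∞) < f i) ∧ R < ((∑ i, a i : ℝ≥0) : ℝ≥0∞) := by
  classical
  by_cases htop : ∃ i, f i = ∞
  · obtain ⟨i, hi⟩ := htop
    lift R to ℝ≥0 using h.ne_top
    refine ⟨Pi.single i (R + 1), fun j => ?_, ?_⟩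
    · rcases eq_or_ne j i with rfl | hj
      · exact Or.inr (hi ▸ ENNReal.coe_lt_top)
      · exact Or.inl (Pi.single_eq_of_ne hj _)
    · rw [Finset.sum_pi_single' i (R + 1) Finset.univ, if_pos (Finset.mem_univ i)]
      exact_mod_cast lt_add_one R
  · push Not at htop
    lift f to ι → ℝ≥0 using htop
    have hcont : Continuous fun ε : ℝ≥0 => ((∑ i, (f i - ε) : ℝ≥0) : ℝ≥0∞) := by fun_prop
    have hlim := hcont.tendsto 0 |>.mono_left (nhdsWithin_le_nhds (s := Set.Ioi 0))
    obtain ⟨ε, hε, hε0⟩ :=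
      ((hlim.eventually_const_lt (by simpa using h)).and self_mem_nhdsWithin).exists
    refine ⟨fun i => f i - ε, fun i => ?_, hε⟩
    rcases le_or_gt (f i) ε with hi | hi
    · exact Or.inl (tsub_eq_zero_of_le hi)
    · exact Or.inr (ENNReal.coe_lt_coe.2 (tsub_lt_self (zero_le.trans_lt hi) hε0))

lemma msgCount_pos (T : ℕ) (r : ℝ≥0) : 0 < msgCount T r :=
  Nat.ceil_pos.2 (Real.exp_pos _)

instance (T : ℕ) (r : ℝ≥0) : Nonempty (Fin (msgCount T r)) := ⟨⟨0, msgCount_pos T r⟩⟩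

lemma msgCount_zero (T : ℕ) : msgCount T 0 = 1 := by
  simp [msgCount]

lemma msgCount_le (T : ℕ) (r : ℝ≥0) : (msgCount T r : ℝ) ≤ 2 * Real.exp (T * r) := by
  have hceil : (msgCount T r : ℝ) < Real.exp (T * r) + 1 := Nat.ceil_lt_add_one (Real.exp_pos _).le
  have hexp : 1 ≤ Real.exp (T * r) := Real.one_le_exp (by positivity)
  linarith

lemma tendsto_msgCount_mul_exp_neg {r : ℝ≥0} {c : ℝ} (hc : r < c) :
    Tendsto (fun T : ℕ => (msgCount T r : ℝ≥0∞) * ENNReal.ofReal (Real.exp (-(T * c))))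
      atTop (𝓝 0) := by
  have hlim : Tendsto (fun T : ℕ => ENNReal.ofReal (2 * Real.exp (-(T * (c - r))))) atTop
      (𝓝 0) := by
    simpa using ENNReal.tendsto_ofReal ((Real.tendsto_exp_neg_atTop_nhds_zero.comp
      (tendsto_natCast_atTop_atTop.atTop_mul_const (sub_pos.2 hc))).const_mul 2)
  refine tendsto_of_tendsto_of_tendsto_of_le_of_le tendsto_const_nhds hlim
    (fun _ => zero_le) fun T => ?_
  rw [← ENNReal.ofReal_natCast, ← ENNReal.ofReal_mul (by positivity)]
  refine ENNReal.ofReal_le_ofReal ?_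
  calc (msgCount T r : ℝ) * Real.exp (-(T * c)) ≤ 2 * Real.exp (T * r) * Real.exp (-(T * c)) := by
        gcongr
        exact msgCount_le T r
    _ = 2 * Real.exp (-(T * (c - r))) := by
        rw [mul_assoc, ← Real.exp_add]
        congr 2
        ring

section SingleUser

variable {A B : Type*} [MeasurableSpace A] [MeasurableSpace B] {N : ℕ}
  (μ : Fin (N + 1) → Measure A) [∀ s, IsProbabilityMeasure (μ s)]
  (U : Fin (N + 1) → Kernel A B) [∀ s, IsMarkovKernel (U s)]

lemma exists_isBoundedScore_mean_gt {r : ℝ≥0}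
    (hr : (r : ℝ≥0∞) < ((N + 1 : ℕ) : ℝ≥0∞)⁻¹ * ∑ s, mutualInfo (μ s ⊗ₘ U s)) :
    ∃ g : Fin (N + 1) → A × B → ℝ, (∀ s, IsBoundedScore (g s) ((μ s).prod (U s ∘ₘ μ s))) ∧
      (∀ s, 0 ≤ ∫ z, g s z ∂(μ s ⊗ₘ U s)) ∧
      (r : ℝ) < (∑ s, ∫ z, g s z ∂(μ s ⊗ₘ U s)) / (N + 1) := by
  have hr' : (r : ℝ≥0∞) * (N + 1 : ℕ) < ∑ s, mutualInfo (μ s ⊗ₘ U s) := by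
    rwa [← ENNReal.lt_div_iff_mul_lt (by simp) (by simp), ENNReal.div_eq_inv_mul]
  obtain ⟨a, ha, hasum⟩ := exists_lt_sum hr'
  have hscore : ∀ s, ∃ g, IsBoundedScore g ((μ s).prod (U s ∘ₘ μ s)) ∧
      (a s : ℝ) ≤ ∫ z, g z ∂(μ s ⊗ₘ U s) := by
    intro s
    rcases ha s with h | h
    · exact ⟨fun _ => 0, isBoundedScore_zero _, by simp [h]⟩
    · rw [mutualInfo, Measure.fst_compProd, Measure.snd_compProd] at h
      exact exists_isBoundedScore h
  choose g hg hag using hscore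
  refine ⟨g, hg, fun s => (a s).2.trans (hag s), (lt_div_iff₀ (by positivity)).2 ?_⟩
  have hra : (r : ℝ) * (N + 1) < ∑ s, (a s : ℝ) := by
    exact_mod_cast NNReal.coe_lt_coe.2 (ENNReal.coe_lt_coe.1 (by exact_mod_cast hasum) :
      r * (N + 1 : ℕ) < ∑ s, a s)
  exact hra.trans_le (Finset.sum_le_sum fun s _ => hag s)

theorem exists_periodic_decoder {r : ℝ≥0} (hr : r = 0 ∨
      (r : ℝ≥0∞) < ((N + 1 : ℕ) : ℝ≥0∞)⁻¹ * ∑ s, mutualInfo (μ s ⊗ₘ U s)) :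
    ∃ (δ : ∀ T, (Fin (msgCount T r) → Fin T → A) → (Fin T → B) → Fin (msgCount T r))
      (e : ℕ → ℝ≥0∞), (∀ T, Measurable (Function.uncurry (δ T))) ∧ Tendsto e atTop (𝓝 0) ∧
      ∀ T w,
        ∫⁻ b, piKernel (fun τ : Fin T => U (Fin.ofNat (N + 1) τ)) (b w) {y | δ T b y ≠ w}
          ∂(Measure.pi fun _ => Measure.pi fun τ : Fin T => μ (Fin.ofNat (N + 1) τ)) ≤ e T := by
  rcases hr with rfl | hr
  · have hsub : ∀ T, Subsingleton (Fin (msgCount T 0)) := fun T => by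
      rw [msgCount_zero]
      infer_instance
    refine ⟨fun T _ _ => Classical.arbitrary _, 0, fun T => measurable_const, tendsto_const_nhds,
      fun T w => le_of_eq ?_⟩
    simp [(hsub T).elim _ w]
  · obtain ⟨g, hg, hmean, hrg⟩ := exists_isBoundedScore_mean_gt μ U hr
    obtain ⟨c, hrc, hcg⟩ := exists_between hrg
    refine ⟨fun T => thresholdDec (blockScore fun τ : Fin T => g (Fin.ofNat (N + 1) τ)) (T * c),
      fun T => _, fun T => measurable_thresholdDec (measurable_blockScore fun τ =>
        (hg _).measurable) _, ?_, fun T w => lintegral_thresholdDec_blockScore_ne_le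
        (fun τ => (hg _).measurable) _ _ (fun τ => (hg _).lintegral_exp_le_one) _ w⟩
    simpa only [Fintype.card_fin, add_zero] using (tendsto_measure_pi_sum_periodic_le
      (fun s => μ s ⊗ₘ U s) (fun s => (hg s).measurable) (fun s => (hg s).exists_abs_le)
      hmean hcg).add (tendsto_msgCount_mul_exp_neg hrc)

end SingleUser

/-! ### Separate random coding -/

section Carrier

variable {ι J : Type*} [Fintype ι] [DecidableEq ι] [Fintype J] {X Y : ι → Type*}
  [∀ i, MeasurableSpace (X i)] [∀ i, MeasurableSpace (Y i)]
  (W : Kernel (∀ i, X i) (∀ i, Y i)) [IsMarkovKernel W]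

omit [IsMarkovKernel W] in
lemma userChannel_apply_eq_comp (p : ∀ i, Measure (X i)) [∀ i, IsProbabilityMeasure (p i)] (i : ι)
    (a : X i) :
    userChannel W p i a =
      (W.map fun y => y i).comap (fun z => Function.update z i a) (measurable_update_const i a) ∘ₘ
        Measure.pi p := by
  rw [userChannel_apply, comp_map_eq_comap_comp _ (measurable_update_const i a)]

instance (i : ι) : IsMarkovKernel (W.map fun y => y i) :=
  Kernel.IsMarkovKernel.map _ (measurable_pi_apply i)

variable {M : ι → Type*} [∀ i, Fintype (M i)] (μ : J → ∀ i, Measure (X i))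
  [∀ τ i, IsProbabilityMeasure (μ τ i)]

omit [DecidableEq ι] in
lemma map_codewords (w : ∀ i, M i) :
    (Measure.pi fun i => Measure.pi fun _ : M i => Measure.pi fun τ => μ τ i).map
        (fun c τ i => c i (w i) τ) = Measure.pi fun τ => Measure.pi (μ τ) := by
  rw [← pi_pi_map_swap fun τ i => μ τ i]
  have hcodewords : (Measure.pi fun i => Measure.pi fun _ : M i => Measure.pi fun τ => μ τ i).map
      (fun c i => c i (w i)) = Measure.pi fun i => Measure.pi fun τ => μ τ i := by
    rw [Measure.pi_map_pi fun i => (measurable_pi_apply (w i)).aemeasurable]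
    simp only [map_eval_pi]
  rw [← hcodewords, Measure.map_map (by fun_prop) (by fun_prop)]
  rfl

lemma lintegral_piKernel_codewords_update (w : ∀ i, M i) (i : ι) (b : J → X i)
    {s : Set (J → Y i)} (hs : MeasurableSet s) :
    ∫⁻ c, piKernel (fun _ : J => W.map fun y => y i)
        (fun τ => Function.update (fun j => c j (w j) τ) i (b τ)) s
        ∂(Measure.pi fun j => Measure.pi fun _ : M j => Measure.pi fun τ => μ τ j) =
      piKernel (fun τ => userChannel W (μ τ) i) b s := by
  have hm : Measurable fun z : J → ∀ j, X j =>
      piKernel (fun _ : J => W.map fun y => y i) (fun τ => Function.update (z τ) i (b τ)) s :=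
    (Kernel.measurable_coe _ hs).comp (measurable_pi_iff.2 fun τ =>
      (measurable_update_const i (b τ)).comp (measurable_pi_apply τ))
  refine (lintegral_map (g := fun (c : ∀ j, M j → J → X j) τ j => c j (w j) τ) hm
    (by fun_prop)).symm.trans ?_
  rw [map_codewords, piKernel_apply]
  simp only [userChannel_apply_eq_comp]
  rw [← piKernel_comp_pi, Measure.bind_apply hs (Kernel.aemeasurable _)]
  rfl

omit [Fintype ι] [DecidableEq ι] [∀ i, Fintype (M i)] in
lemma measurable_piKernel_codewords (w : ∀ i, M i) (i : ι)
    {S : Set ((M i → J → X i) × (J → Y i))} (hS : MeasurableSet S) :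
    Measurable fun c : ∀ j, M j → J → X j =>
      piKernel (fun _ : J => W.map fun y => y i) (fun τ j => c j (w j) τ)
        (Prod.mk (c i) ⁻¹' S) := by
  have hwords : Measurable fun (c : ∀ j, M j → J → X j) (τ : J) j => c j (w j) τ := by fun_prop
  have hpre : Measurable fun z : (∀ j, M j → J → X j) × (J → Y i) => (z.1 i, z.2) := by fun_prop
  exact Kernel.measurable_kernel_prodMk_left
    (κ := (piKernel fun _ : J => W.map fun y => y i).comap _ hwords) (hpre hS)

theorem lintegral_piKernel_codewords (w : ∀ i, M i) (i : ι)
    {S : Set ((M i → J → X i) × (J → Y i))} (hS : MeasurableSet S) :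
    ∫⁻ c, piKernel (fun _ : J => W.map fun y => y i) (fun τ j => c j (w j) τ)
        (Prod.mk (c i) ⁻¹' S)
        ∂(Measure.pi fun j => Measure.pi fun _ : M j => Measure.pi fun τ => μ τ j) =
      ∫⁻ b, piKernel (fun τ => userChannel W (μ τ) i) (b (w i)) (Prod.mk b ⁻¹' S)
        ∂(Measure.pi fun _ : M i => Measure.pi fun τ => μ τ i) := by
  rw [lintegral_pi_update _ i (measurable_piKernel_codewords W w i hS)]
  refine lintegral_congr fun b => ?_
  rw [← lintegral_piKernel_codewords_update W μ w i (b (w i)) (measurable_prodMk_left hS)]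
  refine lintegral_congr fun c => ?_
  have hwords : (fun τ j => Function.update c i b j (w j) τ) =
      fun τ => Function.update (fun j => c j (w j) τ) i (b (w i) τ) := by
    funext τ j
    exact Function.apply_update (fun j d => d (w j) τ) c i b j
  rw [hwords, Function.update_self]

end Carrier

lemma measurableSet_setOf_uncurry_ne {α β γ : Type*} [MeasurableSpace α] [MeasurableSpace β]
    [MeasurableSpace γ] [MeasurableSingletonClass γ] {δ : α → β → γ}
    (hδ : Measurable (Function.uncurry δ)) (v : γ) :
    MeasurableSet {z : α × β | δ z.1 z.2 ≠ v} :=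
  (hδ (measurableSet_singleton v)).compl

section Separate

variable {ι κ : Type*} [Fintype ι] [Fintype κ] {X Y : ι → κ → Type*}
  [∀ i k, MeasurableSpace (X i k)] [∀ i k, MeasurableSpace (Y i k)]

instance {N : ℕ} (p : Fin (N + 1) → ∀ i k, ProbabilityMeasure (X i k)) (r : ι → κ → ℝ≥0) (T : ℕ) :
    IsProbabilityMeasure (randomCodebooks p r T) := by
  unfold randomCodebooks
  infer_instance

lemma randomCodebooks_map_carrier {N : ℕ} (p : Fin (N + 1) → ∀ i k, ProbabilityMeasure (X i k))
    (r : ι → κ → ℝ≥0) (T : ℕ) (k : κ) :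
    (randomCodebooks p r T).map (fun c i => c i k) =
      Measure.pi fun i => Measure.pi fun _ : Fin (msgCount T (r i k)) =>
        Measure.pi fun τ : Fin T => (p (Fin.ofNat (N + 1) τ) i k : Measure (X i k)) := by
  rw [randomCodebooks, Measure.pi_map_pi fun i => (measurable_pi_apply k).aemeasurable]
  simp only [map_eval_pi]

variable (W : ∀ k, Kernel (∀ i, X i k) (∀ i, Y i k)) [∀ k, IsMarkovKernel (W k)]

omit [Fintype ι] in
lemma blockLaw_parallel_map_eval_eval {T : ℕ} (x : Fin T → ∀ i k, X i k) (i : ι) (k : κ) :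
    (blockLaw (parallel W) x).map (fun y τ => y τ i k) =
      piKernel (fun _ : Fin T => (W k).map fun y => y i) fun τ j => x τ j k := by
  have hcarrier : Measurable fun (y : Fin T → ∀ k, Y i k) τ => y τ k := by fun_prop
  have huser : Measurable fun (y : Fin T → ∀ i k, Y i k) τ => y τ i := by fun_prop
  refine (Measure.map_map hcarrier huser).symm.trans ?_
  rw [blockLaw_map_eval, Measure.pi_map_pi fun τ => (measurable_pi_apply k).aemeasurable]
  simp only [map_eval_pi, piKernel_apply, Kernel.map_apply _ (measurable_pi_apply i)]

lemma blockLaw_separateDec_ne_le {r : ι → κ → ℝ≥0} {T : ℕ} (δ : TINDecoders X Y r T)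
    (hδ : ∀ i k, Measurable (Function.uncurry (δ i k))) (c : Codebooks X r T)
    (w : ∀ i k, Fin (msgCount T (r i k))) :
    blockLaw (parallel W) (fun τ i => separateEnc c i (w i) τ)
        {y | ∃ i, separateDec δ c i (fun τ => y τ i) ≠ w i} ≤
      ∑ i, ∑ k, piKernel (fun _ : Fin T => (W k).map fun y => y i) (fun τ j => c j k (w j k) τ)
        {y | δ i k (c i k) y ≠ w i k} := by
  set P := blockLaw (parallel W) fun τ i => separateEnc c i (w i) τ with hP
  have hmarginal (i : ι) (k : κ) : P {y | δ i k (c i k) (fun τ => y τ i k) ≠ w i k} =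
      piKernel (fun _ : Fin T => (W k).map fun y => y i) (fun τ j => c j k (w j k) τ)
        {y | δ i k (c i k) y ≠ w i k} := by
    have houtput : Measurable fun (y : Fin T → ∀ i k, Y i k) τ => y τ i k := by fun_prop
    refine Eq.trans (Measure.map_apply houtput
      (measurable_prodMk_left (measurableSet_setOf_uncurry_ne (hδ i k) (w i k)))).symm ?_
    rw [hP, blockLaw_parallel_map_eval_eval]
    rfl
  calc P {y | ∃ i, separateDec δ c i (fun τ => y τ i) ≠ w i}
      ≤ P (⋃ i, ⋃ k, {y | δ i k (c i k) (fun τ => y τ i k) ≠ w i k}) := by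
        refine measure_mono fun y ⟨i, hi⟩ => ?_
        obtain ⟨k, hk⟩ := Function.ne_iff.1 hi
        exact Set.mem_iUnion₂.2 ⟨i, k, hk⟩
    _ ≤ ∑ i, ∑ k, P {y | δ i k (c i k) (fun τ => y τ i k) ≠ w i k} :=
        (measure_iUnion_fintype_le _ _).trans
          (Finset.sum_le_sum fun i _ => measure_iUnion_fintype_le _ _)
    _ = _ := by simp only [hmarginal]

omit [Fintype ι] [Fintype κ] in
lemma measurable_carrier_error {r : ι → κ → ℝ≥0} {T : ℕ} {δ : TINDecoders X Y r T}
    (hδ : ∀ i k, Measurable (Function.uncurry (δ i k))) (w : ∀ i k, Fin (msgCount T (r i k)))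
    (i : ι) (k : κ) :
    Measurable fun c : Codebooks X r T =>
      piKernel (fun _ : Fin T => (W k).map fun y => y i) (fun τ j => c j k (w j k) τ)
        {y | δ i k (c i k) y ≠ w i k} := by
  have hcarrier : Measurable fun (c : Codebooks X r T) i => c i k := by fun_prop
  exact (measurable_piKernel_codewords (W k) (fun j => w j k) i
    (measurableSet_setOf_uncurry_ne (hδ i k) (w i k))).comp hcarrier

variable [DecidableEq ι]

lemma lintegral_carrier_error {N : ℕ} (p : Fin (N + 1) → ∀ i k, ProbabilityMeasure (X i k))
    {r : ι → κ → ℝ≥0} {T : ℕ} {δ : TINDecoders X Y r T}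
    (hδ : ∀ i k, Measurable (Function.uncurry (δ i k))) (w : ∀ i k, Fin (msgCount T (r i k)))
    (i : ι) (k : κ) :
    ∫⁻ c, piKernel (fun _ : Fin T => (W k).map fun y => y i) (fun τ j => c j k (w j k) τ)
        {y | δ i k (c i k) y ≠ w i k} ∂(randomCodebooks p r T) =
      ∫⁻ b, piKernel (fun τ : Fin T =>
          userChannel (W k) (fun j => (p (Fin.ofNat (N + 1) τ) j k : Measure (X j k))) i)
          (b (w i k)) {y | δ i k b y ≠ w i k}
        ∂(Measure.pi fun _ => Measure.pi fun τ : Fin T =>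
          (p (Fin.ofNat (N + 1) τ) i k : Measure (X i k))) := by
  have hS := measurableSet_setOf_uncurry_ne (hδ i k) (w i k)
  have hcarrier : Measurable fun (c : Codebooks X r T) i => c i k := by fun_prop
  refine Eq.trans ?_ (lintegral_piKernel_codewords (W k)
    (fun (τ : Fin T) j => (p (Fin.ofNat (N + 1) τ) j k : Measure (X j k))) (fun j => w j k) i hS)
  rw [← randomCodebooks_map_carrier,
    lintegral_map (measurable_piKernel_codewords (W k) (fun j => w j k) i hS) hcarrier]
  rfl

lemma lintegral_errorProb_separate_le {N : ℕ}
    (p : Fin (N + 1) → ∀ i k, ProbabilityMeasure (X i k)) {r : ι → κ → ℝ≥0} {T : ℕ}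
    {δ : TINDecoders X Y r T} (hδ : ∀ i k, Measurable (Function.uncurry (δ i k)))
    [DecidableEq κ] {e : ι → κ → ℝ≥0∞}
    (he : ∀ i k w, ∫⁻ b, piKernel (fun τ : Fin T =>
          userChannel (W k) (fun j => (p (Fin.ofNat (N + 1) τ) j k : Measure (X j k))) i) (b w)
          {y | δ i k b y ≠ w}
        ∂(Measure.pi fun _ => Measure.pi fun τ : Fin T =>
          (p (Fin.ofNat (N + 1) τ) i k : Measure (X i k))) ≤ e i k) :
    ∫⁻ c, errorProb (parallel W) (separateEnc c) (separateDec δ c) ∂(randomCodebooks p r T) ≤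
      ∑ i, ∑ k, e i k := by
  set n : ℝ≥0∞ := (Fintype.card (∀ i k, Fin (msgCount T (r i k))) : ℝ≥0∞)
  have hn : n ≠ 0 := Nat.cast_ne_zero.2 Fintype.card_ne_zero
  have hm (w : ∀ i k, Fin (msgCount T (r i k))) (i : ι) (k : κ) :=
    measurable_carrier_error W hδ w i k
  calc ∫⁻ c, errorProb (parallel W) (separateEnc c) (separateDec δ c) ∂(randomCodebooks p r T)
      ≤ ∫⁻ c, n⁻¹ * ∑ w : ∀ i k, Fin (msgCount T (r i k)), ∑ i, ∑ k,
          piKernel (fun _ : Fin T => (W k).map fun y => y i) (fun τ j => c j k (w j k) τ)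
            {y | δ i k (c i k) y ≠ w i k} ∂(randomCodebooks p r T) := by
        refine lintegral_mono fun c => ?_
        rw [errorProb]
        gcongr with w
        exact blockLaw_separateDec_ne_le W δ hδ c w
    _ = n⁻¹ * ∑ w : ∀ i k, Fin (msgCount T (r i k)), ∑ i, ∑ k,
          ∫⁻ c, piKernel (fun _ : Fin T => (W k).map fun y => y i) (fun τ j => c j k (w j k) τ)
            {y | δ i k (c i k) y ≠ w i k} ∂(randomCodebooks p r T) := by
        rw [lintegral_const_mul _ (by fun_prop), lintegral_finsetSum _ (by fun_prop)]
        congr! with w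
        rw [lintegral_finsetSum _ (by fun_prop)]
        congr! with i
        exact lintegral_finsetSum _ (by fun_prop)
    _ ≤ n⁻¹ * ∑ _w : ∀ i k, Fin (msgCount T (r i k)), ∑ i, ∑ k, e i k := by
        gcongr with w _ i _ k
        rw [lintegral_carrier_error W p hδ w i k]
        exact he i k (w i k)
    _ = ∑ i, ∑ k, e i k := by
        rw [Finset.sum_const, Finset.card_univ, nsmul_eq_mul, ← mul_assoc,
          ENNReal.inv_mul_cancel hn (ENNReal.natCast_ne_top _), one_mul]

theorem reliableTIN_of_lt_carrierInfo [DecidableEq κ] {N : ℕ}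
    (p : Fin (N + 1) → ∀ i k, ProbabilityMeasure (X i k)) (r : ι → κ → ℝ≥0)
    (hr : ∀ i k, r i k = 0 ∨ (r i k : ℝ≥0∞) < carrierInfo W p i k) :
    ReliableTIN W p r := by
  simp only [carrierInfo, userInfo_eq_mutualInfo_userChannel] at hr
  choose δ e hδ he hle using fun i k => exists_periodic_decoder
    (fun s => (p s i k : Measure (X i k)))
    (fun s => userChannel (W k) (fun j => (p s j k : Measure (X j k))) i) (hr i k)
  refine ⟨fun T i k => δ i k T, fun T i k => hδ i k T, ?_⟩
  have hlim : Tendsto (fun T => ∑ i, ∑ k, e i k T) atTop (𝓝 0) := by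
    simpa only [Finset.sum_const_zero] using tendsto_finsetSum Finset.univ fun i _ =>
      tendsto_finsetSum Finset.univ fun k _ => he i k
  exact tendsto_of_tendsto_of_tendsto_of_le_of_le tendsto_const_nhds hlim (fun _ => zero_le)
    fun T => lintegral_errorProb_separate_le W p (fun i k => hδ i k T) fun i k w => hle i k T w

end Separate

/-! ### The law of large numbers for costs -/

lemma tendsto_lintegral_sub_natCast {α : Type*} [MeasurableSpace α] (μ : Measure α)
    {b : α → ℝ≥0∞} (hb : Measurable b) (hfin : ∫⁻ x, b x ∂μ ≠ ∞) :
    Tendsto (fun n : ℕ => ∫⁻ x, b x - n ∂μ) atTop (𝓝 0) := by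
  have hlim : ∀ᵐ x ∂μ, Tendsto (fun n : ℕ => b x - n) atTop (𝓝 0) := by
    filter_upwards [ae_lt_top hb hfin] with x hx
    obtain ⟨n, hn⟩ := ENNReal.exists_nat_gt hx.ne
    refine tendsto_const_nhds.congr' ?_
    filter_upwards [eventually_ge_atTop n] with j hj
    exact (tsub_eq_zero_of_le (hn.le.trans (Nat.cast_le.2 hj))).symm
  simpa only [lintegral_zero] using tendsto_lintegral_of_dominated_convergence b
    (fun n => hb.sub_const _) (fun n => ae_of_all _ fun x => tsub_le_self) hfin hlim

section Truncation

variable {J : Type*} [Fintype J] {A : J → Type*} [∀ τ, MeasurableSpace (A τ)]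
  (μ : ∀ τ, Measure (A τ)) [∀ τ, IsProbabilityMeasure (μ τ)] {b : ∀ τ, A τ → ℝ≥0∞}

lemma measure_pi_setOf_le_sum_le (hb : ∀ τ, Measurable (b τ)) {c : ℝ≥0∞} (hc0 : c ≠ 0)
    (hc : c ≠ ∞) :
    Measure.pi μ {x | c ≤ ∑ τ, b τ (x τ)} ≤ (∑ τ, ∫⁻ x, b τ x ∂(μ τ)) / c := by
  have hbτ (τ : J) : Measurable fun x : ∀ τ, A τ => b τ (x τ) :=
    (hb τ).comp (measurable_pi_apply τ)
  refine (meas_ge_le_lintegral_div (Finset.aemeasurable_fun_sum _ fun τ _ => (hbτ τ).aemeasurable)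
    hc0 hc).trans_eq ?_
  rw [lintegral_finsetSum _ fun τ _ => hbτ τ]
  congr! 2 with τ
  exact (measurePreserving_eval μ τ).lintegral_comp (hb τ)

variable [Nonempty J]

lemma measure_pi_setOf_lt_sum_le_of_bounded (hb : ∀ τ, Measurable (b τ)) {B : ℝ≥0}
    (hB : ∀ τ x, b τ x ≤ B) {m ε : ℝ≥0} (hε : 0 < ε)
    (hm : ∑ τ, ∫⁻ x, b τ x ∂(μ τ) ≤ Fintype.card J * m) :
    Measure.pi μ {x | Fintype.card J * (m + ε : ℝ≥0∞) < ∑ τ, b τ (x τ)} ≤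
      ENNReal.ofReal (B ^ 2 / (Fintype.card J * ε ^ 2)) := by
  have hbtop (τ : J) (x : A τ) : b τ x ≠ ∞ := ne_top_of_le_ne_top ENNReal.coe_ne_top (hB τ x)
  have hint (τ : J) : ∫ x, (b τ x).toReal ∂(μ τ) = (∫⁻ x, b τ x ∂(μ τ)).toReal :=
    integral_toReal (hb τ).aemeasurable (ae_of_all _ fun x => (hbtop τ x).lt_top)
  have hmtop : (Fintype.card J * m : ℝ≥0∞) ≠ ∞ := by finiteness
  have hmean : ∑ τ, ∫ x, (b τ x).toReal ∂(μ τ) ≤ Fintype.card J * m := by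
    simp only [hint]
    rw [← ENNReal.toReal_sum fun τ hτ => ne_top_of_le_ne_top hmtop
      ((Finset.single_le_sum (fun _ _ => zero_le) hτ).trans hm)]
    simpa using ENNReal.toReal_mono hmtop hm
  refine (measure_mono fun x hx => ?_).trans (measure_pi_setOf_sum_le_le μ
    (X := fun τ x => -(b τ x).toReal) (c := -(Fintype.card J * (m + ε)))
    (fun τ => (hb τ).ennreal_toReal.neg) (fun τ x => ?_) (NNReal.coe_pos.2 hε) ?_)
  · have hlt := ENNReal.toReal_mono (ENNReal.sum_ne_top.2 fun τ _ => hbtop τ (x τ))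
      (le_of_lt hx)
    rw [ENNReal.toReal_sum fun τ _ => hbtop τ (x τ)] at hlt
    rw [Set.mem_ofPred_eq, Finset.sum_neg_distrib, neg_le_neg_iff]
    simpa [ENNReal.toReal_add] using hlt
  · rw [abs_neg, ENNReal.abs_toReal]
    exact ENNReal.toReal_le_coe_of_le_coe (hB τ x)
  · simp only [integral_neg, Finset.sum_neg_distrib]
    linarith

theorem measure_pi_setOf_lt_sum_le (hb : ∀ τ, Measurable (b τ)) {m ε : ℝ≥0} (hε : 0 < ε)
    (hm : ∑ τ, ∫⁻ x, b τ x ∂(μ τ) ≤ Fintype.card J * m) (B : ℝ≥0) :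
    Measure.pi μ {x | Fintype.card J * (m + 2 * ε : ℝ≥0∞) < ∑ τ, b τ (x τ)} ≤
      (∑ τ, ∫⁻ x, b τ x - B ∂(μ τ)) / (Fintype.card J * ε) +
        ENNReal.ofReal (B ^ 2 / (Fintype.card J * ε ^ 2)) := by
  set n : ℝ≥0∞ := (Fintype.card J : ℝ≥0∞)
  have hn : n ≠ 0 := Nat.cast_ne_zero.2 Fintype.card_ne_zero
  have hsub : {x : ∀ τ, A τ | n * (m + 2 * ε) < ∑ τ, b τ (x τ)} ⊆
      {x | n * ε ≤ ∑ τ, (b τ (x τ) - B)} ∪ {x | n * (m + ε) < ∑ τ, min (b τ (x τ)) B} := by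
    intro x hx
    contrapose! hx
    rw [Set.mem_union, not_or, Set.mem_ofPred_eq, Set.mem_ofPred_eq, not_le, not_lt] at hx
    rw [Set.mem_ofPred_eq, not_lt]
    calc ∑ τ, b τ (x τ) = ∑ τ, (b τ (x τ) - B) + ∑ τ, min (b τ (x τ)) B := by
          simp only [← Finset.sum_add_distrib, tsub_add_min]
      _ ≤ n * ε + n * (m + ε) := add_le_add hx.1.le hx.2
      _ = n * (m + 2 * ε) := by ring
  refine (measure_mono hsub).trans ((measure_union_le _ _).trans (add_le_add ?_ ?_))
  · exact measure_pi_setOf_le_sum_le μ (fun τ => (hb τ).sub_const _)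
      (mul_ne_zero hn (ENNReal.coe_ne_zero.2 hε.ne')) (by finiteness)
  · refine measure_pi_setOf_lt_sum_le_of_bounded μ (b := fun τ x => min (b τ x) B)
      (fun τ => (hb τ).min measurable_const) (fun τ x => min_le_right _ _) hε (le_trans ?_ hm)
    gcongr
    exact min_le_left _ _

end Truncation

section Costs

variable {A : Type*} [MeasurableSpace A] {N : ℕ} (μ : Fin (N + 1) → Measure A)
  [∀ s, IsProbabilityMeasure (μ s)] {b : A → ℝ≥0∞}

lemma sum_prod_periodic_le (a : Fin (N + 1) → ℝ≥0∞) (M T : ℕ) :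
    ∑ z : Fin M × Fin T, a (Fin.ofNat (N + 1) z.2) ≤
      M * (((T / (N + 1) + 1 : ℕ) : ℝ≥0∞) * ∑ s, a s) := by
  simp only [Fintype.sum_prod_type]
  rw [Finset.sum_const, Finset.card_univ, Fintype.card_fin, nsmul_eq_mul]
  gcongr
  exact sum_periodic_le a T

lemma sum_prod_periodic_div_le (a : Fin (N + 1) → ℝ≥0∞) {M T : ℕ} (hM : 0 < M) (hT : 0 < T)
    (ε : ℝ≥0∞) :
    (∑ z : Fin M × Fin T, a (Fin.ofNat (N + 1) z.2)) / (Fintype.card (Fin M × Fin T) * ε) ≤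
      2 * (∑ s, a s) / ε := by
  have hperiods : ((T / (N + 1) + 1 : ℕ) : ℝ≥0∞) ≤ T * 2 := by
    have := Nat.div_le_self T (N + 1)
    exact_mod_cast (by lia : T / (N + 1) + 1 ≤ T * 2)
  have hMT : ((M : ℝ≥0∞) * T) ≠ 0 :=
    mul_ne_zero (Nat.cast_ne_zero.2 hM.ne') (Nat.cast_ne_zero.2 hT.ne')
  rw [Fintype.card_prod, Fintype.card_fin, Fintype.card_fin, Nat.cast_mul,
    ← ENNReal.mul_div_mul_left (2 * _) _ hMT (by finiteness)]
  refine ENNReal.div_le_div_right ((sum_prod_periodic_le a M T).trans ?_) _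
  rw [mul_assoc (M : ℝ≥0∞), ← mul_assoc (T : ℝ≥0∞)]
  gcongr

lemma measure_codebook_lt_cost_le (hb : Measurable b) {M T : ℕ} (hM : 0 < M) (hT : 0 < T)
    {m ε : ℝ≥0} (hε : 0 < ε)
    (hm : ((T / (N + 1) + 1 : ℕ) : ℝ≥0∞) * ∑ s, ∫⁻ x, b x ∂(μ s) ≤ T * m) (B : ℝ≥0) :
    (Measure.pi fun _ : Fin M => Measure.pi fun τ : Fin T => μ (Fin.ofNat (N + 1) τ))
        {x | (m + 2 * ε : ℝ≥0∞) < ((M : ℝ≥0∞) * T)⁻¹ * ∑ v, ∑ τ, b (x v τ)} ≤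
      2 * (∑ s, ∫⁻ x, b x - B ∂(μ s)) / ε + ENNReal.ofReal (B ^ 2 / (T * ε ^ 2)) := by
  have : Nonempty (Fin M × Fin T) := ⟨⟨⟨0, hM⟩, ⟨0, hT⟩⟩⟩
  have hcard : (Fintype.card (Fin M × Fin T) : ℝ≥0∞) = M * T := by simp
  have hcurry : Measurable fun (x : Fin M × Fin T → A) v τ => x (v, τ) := by fun_prop
  have hset : MeasurableSet {x : Fin M → Fin T → A |
      (m + 2 * ε : ℝ≥0∞) < ((M : ℝ≥0∞) * T)⁻¹ * ∑ v, ∑ τ, b (x v τ)} :=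
    measurableSet_lt measurable_const (by fun_prop)
  have hmean : ∑ z : Fin M × Fin T, ∫⁻ x, b x ∂(μ (Fin.ofNat (N + 1) z.2)) ≤
      Fintype.card (Fin M × Fin T) * m := by
    rw [hcard, mul_assoc]
    refine (sum_prod_periodic_le (fun s => ∫⁻ x, b x ∂(μ s)) M T).trans ?_
    gcongr
  have hvar : (B : ℝ) ^ 2 / (Fintype.card (Fin M × Fin T) * ε ^ 2) ≤ B ^ 2 / (T * ε ^ 2) := by
    have hMT : (T : ℝ) ≤ Fintype.card (Fin M × Fin T) := by
      simpa using Nat.cast_le (α := ℝ).2 (Nat.le_mul_of_pos_left T hM)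
    have : (0 : ℝ) < T := Nat.cast_pos.2 hT
    gcongr
  rw [← pi_map_curry fun (_ : Fin M) (τ : Fin T) => μ (Fin.ofNat (N + 1) τ),
    Measure.map_apply hcurry hset]
  refine le_trans (measure_mono fun x hx => ?_) ((measure_pi_setOf_lt_sum_le
    (fun z : Fin M × Fin T => μ (Fin.ofNat (N + 1) z.2)) (fun _ => hb) hε hmean B).trans
      (add_le_add (sum_prod_periodic_div_le (fun s => ∫⁻ x, b x - B ∂(μ s)) hM hT ε)
        (ENNReal.ofReal_le_ofReal hvar)))
  rw [Set.mem_preimage, Set.mem_ofPred_eq, mul_comm _⁻¹, ← div_eq_mul_inv] at hx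
  rw [Set.mem_ofPred_eq, hcard, Fintype.sum_prod_type]
  exact ENNReal.mul_lt_of_lt_div' hx

lemma periods_mul_le (S : ℝ≥0∞) (T : ℕ) :
    ((T / (N + 1) + 1 : ℕ) : ℝ≥0∞) * S ≤ T * (((N + 1 : ℕ) : ℝ≥0∞)⁻¹ * S) + S := by
  have hdiv : ((T / (N + 1) : ℕ) : ℝ≥0∞) ≤ T * ((N + 1 : ℕ) : ℝ≥0∞)⁻¹ := by
    rw [← div_eq_mul_inv, ENNReal.le_div_iff_mul_le (by simp) (by simp)]
    exact_mod_cast Nat.div_mul_le_self T (N + 1)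
  rw [Nat.cast_add, Nat.cast_one, add_mul, one_mul, ← mul_assoc]
  gcongr

lemma eventually_periods_mul_le {S : ℝ≥0∞} (hS : S ≠ ∞) {m ε : ℝ≥0}
    (hm : ((N + 1 : ℕ) : ℝ≥0∞)⁻¹ * S = m) (hε : 0 < ε) :
    ∀ᶠ T : ℕ in atTop, ((T / (N + 1) + 1 : ℕ) : ℝ≥0∞) * S ≤ T * (m + ε : ℝ≥0) := by
  have hlim : Tendsto (fun T : ℕ => S / T) atTop (𝓝 0) := by
    simpa using ENNReal.Tendsto.const_div ENNReal.tendsto_nat_nhds_top (Or.inr hS)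
  filter_upwards [ENNReal.tendsto_nhds_zero.1 hlim ε (ENNReal.coe_pos.2 hε), eventually_gt_atTop 0]
    with T hSε hT
  refine (periods_mul_le S T).trans ?_
  rw [hm, ENNReal.coe_add, mul_add]
  gcongr
  exact (ENNReal.div_le_iff' (Nat.cast_ne_zero.2 hT.ne') (by finiteness)).1 hSε

omit [∀ s, IsProbabilityMeasure (μ s)] in
lemma exists_lintegral_sub_div_le (hb : Measurable b) (hfin : ∀ s, ∫⁻ x, b x ∂(μ s) ≠ ∞)
    {ε : ℝ≥0∞} (hε : ε ≠ 0) {η : ℝ≥0∞} (hη : 0 < η) :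
    ∃ B : ℕ, 2 * (∑ s, ∫⁻ x, b x - B ∂(μ s)) / ε ≤ η := by
  have htail : Tendsto (fun n : ℕ => ∑ s, ∫⁻ x, b x - n ∂(μ s)) atTop (𝓝 0) := by
    simpa only [Finset.sum_const_zero] using tendsto_finsetSum Finset.univ fun s _ =>
      tendsto_lintegral_sub_natCast (μ s) hb (hfin s)
  have hlim := ENNReal.Tendsto.div_const (ENNReal.Tendsto.const_mul (a := 2) htail (by simp))
    (Or.inr hε)
  rw [mul_zero, ENNReal.zero_div] at hlim
  exact (ENNReal.tendsto_nhds_zero.1 hlim η hη).exists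

theorem tendsto_measure_lt_cost (hb : Measurable b) {c : ℝ≥0∞}
    (hc : ((N + 1 : ℕ) : ℝ≥0∞)⁻¹ * ∑ s, ∫⁻ x, b x ∂(μ s) < c) {M : ℕ → ℕ} (hM : ∀ T, 0 < M T) :
    Tendsto (fun T => (Measure.pi fun _ : Fin (M T) => Measure.pi fun τ : Fin T =>
        μ (Fin.ofNat (N + 1) τ))
      {x | c < ((M T : ℝ≥0∞) * T)⁻¹ * ∑ v, ∑ τ, b (x v τ)}) atTop (𝓝 0) := by
  have hsum_ne_top : ∑ s, ∫⁻ x, b x ∂(μ s) ≠ ∞ := fun htop => by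
    rw [htop, ENNReal.mul_top (by simp)] at hc
    exact not_top_lt hc
  obtain ⟨ε, hε, hεc⟩ : ∃ ε : ℝ≥0,
      0 < ε ∧ ((N + 1 : ℕ) : ℝ≥0∞)⁻¹ * ∑ s, ∫⁻ x, b x ∂(μ s) + 3 * ε ≤ c := by
    obtain ⟨d, hd, hdc⟩ := ENNReal.lt_iff_exists_add_pos_lt.1 hc
    refine ⟨d / 3, by positivity, le_of_eq_of_le ?_ hdc.le⟩
    rw [ENNReal.coe_div (by norm_num), ENNReal.coe_ofNat,
      ENNReal.mul_div_cancel (by norm_num) (by norm_num)]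
  set S := ∑ s, ∫⁻ x, b x ∂(μ s)
  generalize hmean : ((N + 1 : ℕ) : ℝ≥0∞)⁻¹ * S = m at *
  lift m to ℝ≥0 using hc.ne_top
  refine ENNReal.tendsto_nhds_zero.2 fun η hη => ?_
  obtain ⟨B, hB⟩ := exists_lintegral_sub_div_le μ hb
    (ENNReal.sum_ne_top.1 hsum_ne_top · (Finset.mem_univ _)) (ENNReal.coe_ne_zero.2 hε.ne')
    (ENNReal.half_pos hη.ne')
  have hvar : Tendsto (fun T : ℕ => ENNReal.ofReal ((B : ℝ) ^ 2 / (T * (ε : ℝ) ^ 2))) atTop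
      (𝓝 0) := by
    have hden : Tendsto (fun T : ℕ => (T : ℝ) * (ε : ℝ) ^ 2) atTop atTop :=
      tendsto_natCast_atTop_atTop.atTop_mul_const (by positivity)
    simpa using ENNReal.tendsto_ofReal (hden.const_div_atTop _)
  filter_upwards [ENNReal.tendsto_nhds_zero.1 hvar (η / 2) (ENNReal.half_pos hη.ne'),
    eventually_periods_mul_le hsum_ne_top hmean hε, eventually_gt_atTop 0] with T hTvar hTmean hT
  calc (Measure.pi fun _ : Fin (M T) => Measure.pi fun τ : Fin T => μ (Fin.ofNat (N + 1) τ))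
        {x | c < ((M T : ℝ≥0∞) * T)⁻¹ * ∑ v, ∑ τ, b (x v τ)}
      ≤ (Measure.pi fun _ : Fin (M T) => Measure.pi fun τ : Fin T => μ (Fin.ofNat (N + 1) τ))
        {x | ((m + ε : ℝ≥0) + 2 * ε : ℝ≥0∞) <
          ((M T : ℝ≥0∞) * T)⁻¹ * ∑ v, ∑ τ, b (x v τ)} := by
        refine measure_mono fun x (hx : c < _) => lt_of_le_of_lt (le_of_eq_of_le ?_ hεc) hx
        rw [ENNReal.coe_add]
        ring
    _ ≤ 2 * (∑ s, ∫⁻ x, b x - B ∂(μ s)) / ε + ENNReal.ofReal (B ^ 2 / (T * ε ^ 2)) :=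
        measure_codebook_lt_cost_le μ hb (hM T) hT hε hTmean B
    _ ≤ η / 2 + η / 2 := add_le_add hB hTvar
    _ = η := ENNReal.add_halves η

end Costs

/-! ### Random codebooks under a constraint -/

lemma card_inv_mul_sum_eval {κ : Type*} [Fintype κ] [DecidableEq κ] (n : κ → Type*)
    [∀ k, Fintype (n k)] [∀ k, Nonempty (n k)] (k : κ) (f : n k → ℝ≥0∞) :
    (Fintype.card (∀ k, n k) : ℝ≥0∞)⁻¹ * ∑ w : ∀ k, n k, f (w k) =
      (Fintype.card (n k) : ℝ≥0∞)⁻¹ * ∑ v, f v := by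
  let _ (k : κ) : MeasurableSpace (n k) := ⊤
  have _ (k : κ) : MeasurableSingletonClass (n k) := ⟨fun _ => trivial⟩
  rw [← lintegral_uniformOn_univ fun w : ∀ k, n k => f (w k), ← lintegral_uniformOn_univ,
    ← pi_uniformOn_univ]
  exact (measurePreserving_eval (fun k => uniformOn (Set.univ : Set (n k))) k).lintegral_comp
    Measurable.of_discrete

lemma inv_mul_sum_sum_le {M T : ℕ} {a : Fin M → Fin T → ℝ≥0∞} {c : ℝ≥0∞}
    (ha : ∀ w τ, a w τ ≤ c) : ((M : ℝ≥0∞) * T)⁻¹ * ∑ w, ∑ τ, a w τ ≤ c := by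
  calc ((M : ℝ≥0∞) * T)⁻¹ * ∑ w, ∑ τ, a w τ
      ≤ ((M : ℝ≥0∞) * T)⁻¹ * ∑ _w : Fin M, ∑ _τ : Fin T, c := by gcongr with w _ τ; exact ha w τ
    _ = ((M : ℝ≥0∞) * T)⁻¹ * (M * T) * c := by
      simp only [Finset.sum_const, Finset.card_univ, Fintype.card_fin, nsmul_eq_mul, mul_assoc]
    _ ≤ c := mul_le_of_le_one_left' (ENNReal.inv_mul_le_one _)

lemma ae_codebook_cost_le {A : Type*} [MeasurableSpace A] {M T : ℕ} {μ : Fin T → Measure A}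
    [∀ τ, IsProbabilityMeasure (μ τ)] {b : A → ℝ≥0∞} {c : ℝ≥0∞}
    (h : ∀ τ, ∀ᵐ x ∂(μ τ), b x ≤ c) :
    ∀ᵐ x ∂(Measure.pi fun _ : Fin M => Measure.pi μ),
      ((M : ℝ≥0∞) * T)⁻¹ * ∑ w, ∑ τ, b (x w τ) ≤ c := by
  have hword : ∀ᵐ x ∂(Measure.pi μ), ∀ τ, b (x τ) ≤ c :=
    ae_all_iff.2 fun τ => (measurePreserving_eval μ τ).quasiMeasurePreserving.ae (h τ)
  have hcodebook : ∀ᵐ x ∂(Measure.pi fun _ : Fin M => Measure.pi μ), ∀ w τ, b (x w τ) ≤ c :=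
    ae_all_iff.2 fun w => (measurePreserving_eval (fun _ : Fin M => Measure.pi μ)
      w).quasiMeasurePreserving.ae hword
  filter_upwards [hcodebook] with x hx using inv_mul_sum_sum_le hx

section Constraint

variable {ι : Type*} [Fintype ι] {κ : Type*} [Fintype κ] {X Y : ι → κ → Type*}
  [∀ i k, MeasurableSpace (X i k)] [∀ i k, MeasurableSpace (Y i k)] (Q : CostConstraint X)

omit [Fintype ι] in
lemma codebookCost_separateEnc [DecidableEq κ] {r : ι → κ → ℝ≥0} {T : ℕ} (c : Codebooks X r T)
    (i : ι) (k : κ) :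
    Q.codebookCost i (separateEnc c i) k =
      ((msgCount T (r i k) : ℝ≥0∞) * T)⁻¹ * ∑ v, ∑ τ, Q.cost i k (c i k v τ) := by
  have hmean := card_inv_mul_sum_eval (fun k => Fin (msgCount T (r i k))) k
    fun v => ∑ τ, Q.cost i k (c i k v τ)
  rw [Fintype.card_fin] at hmean
  have hcard : (Fintype.card (∀ k, Fin (msgCount T (r i k))) : ℝ≥0∞) ≠ ∞ :=
    ENNReal.natCast_ne_top _
  rw [CostConstraint.codebookCost, ENNReal.mul_inv (Or.inr (by simp)) (Or.inl hcard),
    ENNReal.mul_inv (by simp) (by simp), mul_right_comm, mul_right_comm _ _ (∑ v, _), ← hmean]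
  rfl

lemma randomCodebooks_map_eval {N : ℕ} (p : Fin (N + 1) → ∀ i k, ProbabilityMeasure (X i k))
    (r : ι → κ → ℝ≥0) (T : ℕ) (i : ι) (k : κ) :
    (randomCodebooks p r T).map (fun c => c i k) =
      Measure.pi fun _ : Fin (msgCount T (r i k)) => Measure.pi fun τ : Fin T =>
        (p (Fin.ofNat (N + 1) τ) i k : Measure (X i k)) := by
  have hcomp : (randomCodebooks p r T).map (fun c => c i k) =
      ((randomCodebooks p r T).map fun c => c i).map fun c => c k :=
    (Measure.map_map (measurable_pi_apply _) (measurable_pi_apply _)).symm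
  rw [hcomp, randomCodebooks, map_eval_pi, map_eval_pi]

lemma tendsto_randomCodebooks_lt_cost {N : ℕ}
    (p : Fin (N + 1) → ∀ i k, ProbabilityMeasure (X i k)) (r : ι → κ → ℝ≥0) (i : ι) (k : κ)
    {c : ℝ≥0∞}
    (h : ((N + 1 : ℕ) : ℝ≥0∞)⁻¹ * ∑ s, ∫⁻ x, Q.cost i k x ∂(p s i k : Measure (X i k)) < c ∨
      ∀ s, ∀ᵐ x ∂(p s i k : Measure (X i k)), Q.cost i k x ≤ c) :
    Tendsto (fun T => randomCodebooks p r T {b : Codebooks X r T |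
      c < ((msgCount T (r i k) : ℝ≥0∞) * T)⁻¹ * ∑ w, ∑ τ, Q.cost i k (b i k w τ)}) atTop
      (𝓝 0) := by
  have hcost := Q.measurable_cost i k
  have hset : ∀ T, MeasurableSet {b : Fin (msgCount T (r i k)) → Fin T → X i k |
      c < ((msgCount T (r i k) : ℝ≥0∞) * T)⁻¹ * ∑ w, ∑ τ, Q.cost i k (b w τ)} := fun T =>
    measurableSet_lt measurable_const (by fun_prop)
  have hmarginal : ∀ T, randomCodebooks p r T {b : Codebooks X r T |
      c < ((msgCount T (r i k) : ℝ≥0∞) * T)⁻¹ * ∑ w, ∑ τ, Q.cost i k (b i k w τ)} =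
      (Measure.pi fun _ : Fin (msgCount T (r i k)) => Measure.pi fun τ : Fin T =>
        (p (Fin.ofNat (N + 1) τ) i k : Measure (X i k)))
        {b | c < ((msgCount T (r i k) : ℝ≥0∞) * T)⁻¹ * ∑ w, ∑ τ, Q.cost i k (b w τ)} := by
    intro T
    rw [← randomCodebooks_map_eval, Measure.map_apply (by fun_prop) (hset T)]
    rfl
  simp only [hmarginal]
  rcases h with hlt | hae
  · exact tendsto_measure_lt_cost (fun s => (p s i k : Measure (X i k))) hcost hlt
      fun T => msgCount_pos T _
  · refine tendsto_const_nhds.congr fun T => (measure_eq_zero_iff_ae_notMem.2 ?_).symm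
    filter_upwards [ae_codebook_cost_le fun τ : Fin T => hae (Fin.ofNat (N + 1) τ)] with b hb
    exact not_lt.2 hb

theorem meetsConstraint_of_slack [DecidableEq κ] {N : ℕ}
    (p : Fin (N + 1) → ∀ i k, ProbabilityMeasure (X i k)) (r : ι → κ → ℝ≥0)
    (h : ∀ i, ∃ v ∈ Q.region i, ∀ k,
      ((N + 1 : ℕ) : ℝ≥0∞)⁻¹ * ∑ s, ∫⁻ x, Q.cost i k x ∂(p s i k : Measure (X i k)) < v k ∨
      ∀ s, ∀ᵐ x ∂(p s i k : Measure (X i k)), Q.cost i k x ≤ v k) :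
    MeetsConstraint Q p r := by
  choose v hv hslack using h
  have hsum := tendsto_finsetSum (Finset.univ : Finset ι) fun i _ =>
    tendsto_finsetSum (Finset.univ : Finset κ) fun k _ =>
      tendsto_randomCodebooks_lt_cost Q p r i k (hslack i k)
  simp only [Finset.sum_const_zero] at hsum
  refine tendsto_of_tendsto_of_tendsto_of_le_of_le tendsto_const_nhds hsum (fun _ => zero_le)
    fun T => ?_
  calc randomCodebooks p r T {c | ¬ ∀ i, Q.codebookCost i (separateEnc c i) ∈ Q.region i}
      ≤ randomCodebooks p r T (⋃ i, ⋃ k, {c : Codebooks X r T |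
          v i k < ((msgCount T (r i k) : ℝ≥0∞) * T)⁻¹ * ∑ w, ∑ τ, Q.cost i k (c i k w τ)}) := by
        refine measure_mono fun c hc => ?_
        by_contra hcheap
        simp only [Set.mem_iUnion, Set.mem_ofPred_eq, not_exists, not_lt] at hcheap
        refine hc fun i => Q.isLowerSet_region i (fun k => ?_) (hv i)
        rw [codebookCost_separateEnc]
        exact hcheap i k
    _ ≤ ∑ i, ∑ k, randomCodebooks p r T {c : Codebooks X r T |
          v i k < ((msgCount T (r i k) : ℝ≥0∞) * T)⁻¹ * ∑ w, ∑ τ, Q.cost i k (c i k w τ)} :=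
        (measure_iUnion_fintype_le _ _).trans
          (Finset.sum_le_sum fun i _ => measure_iUnion_fintype_le _ _)

/-! ### Making room below the constraint -/

lemma ae_le_of_mean_le {A : Type*} [MeasurableSpace A] {N : ℕ}
    (μ : Fin (N + 1) → Measure A) [∀ s, IsProbabilityMeasure (μ s)] {b : A → ℝ≥0∞}
    (hb : Measurable b) {c : ℝ≥0∞} (hct : c ≠ ∞)
    (hc : ((N + 1 : ℕ) : ℝ≥0∞)⁻¹ * ∑ s, ∫⁻ x, b x ∂(μ s) = c) (hle : ∀ x, c ≤ b x)
    (s : Fin (N + 1)) : ∀ᵐ x ∂(μ s), b x ≤ c := by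
  have hsum : (N + 1 : ℕ) * c + ∑ s, ∫⁻ x, b x - c ∂(μ s) = (N + 1 : ℕ) * c + 0 := by
    have hsplit : ∀ s, c + ∫⁻ x, b x - c ∂(μ s) = ∫⁻ x, b x ∂(μ s) := fun s => by
      rw [← lintegral_congr fun x => add_tsub_cancel_of_le (hle x),
        lintegral_add_left measurable_const, lintegral_const, measure_univ, mul_one]
    calc (N + 1 : ℕ) * c + ∑ s, ∫⁻ x, b x - c ∂(μ s)
        = ∑ s, ∫⁻ x, b x ∂(μ s) := by
          simp only [← hsplit, Finset.sum_add_distrib, Finset.sum_const, Finset.card_univ,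
            Fintype.card_fin, nsmul_eq_mul]
      _ = (N + 1 : ℕ) * c + 0 := by
          rw [← hc, ← mul_assoc, ENNReal.mul_inv_cancel (by simp) (by simp), one_mul, add_zero]
  have hexcess : ∫⁻ x, b x - c ∂(μ s) = 0 := Finset.sum_eq_zero_iff.1
    ((ENNReal.add_right_inj (ENNReal.mul_ne_top (by simp) hct)).1 hsum) s (Finset.mem_univ s)
  filter_upwards [(lintegral_eq_zero_iff (hb.sub_const _)).1 hexcess] with x hx
  exact tsub_eq_zero_iff_le.1 hx

lemma exists_lt_mean_or_ae_le_mean {A : Type*} [MeasurableSpace A] {N : ℕ}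
    (μ : Fin (N + 1) → Measure A) [∀ s, IsProbabilityMeasure (μ s)] {b : A → ℝ≥0∞}
    (hb : Measurable b) {c : ℝ≥0∞} (hc : ((N + 1 : ℕ) : ℝ≥0∞)⁻¹ * ∑ s, ∫⁻ x, b x ∂(μ s) = c) :
    ∃ x, (c ≠ ∞ ∧ b x < c) ∨ (b x ≤ c ∧ ∀ s, ∀ᵐ x ∂(μ s), b x ≤ c) := by
  rcases eq_or_ne c ∞ with rfl | hct
  · exact ⟨(μ 0).nonempty_of_neZero.some, Or.inr ⟨le_top, fun s => ae_of_all _ fun x => le_top⟩⟩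
  by_cases hcheap : ∃ x, b x < c
  · exact hcheap.imp fun x hx => Or.inl ⟨hct, hx⟩
  · push Not at hcheap
    have hae := ae_le_of_mean_le μ hb hct hc hcheap
    exact (hae 0).exists.imp fun x hx => Or.inr ⟨hx, hae⟩

/-- The time slots of `p`, repeated `n` times, followed by one slot `d`: a time-sharing scheme that
is close to `p` for large `n`, and in which `d` makes room below a constraint. -/
def repeatThen {L : Type*} {N : ℕ} (p : Fin (N + 1) → L) (d : L) (n : ℕ)
    (s : Fin (n * (N + 1) + 1)) : L :=
  if (s : ℕ) < n * (N + 1) then p (Fin.ofNat (N + 1) s) else d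

lemma sum_repeatThen {L α : Type*} [AddCommMonoid α] {N : ℕ} (p : Fin (N + 1) → L) (d : L)
    (n : ℕ) (g : L → α) : ∑ s, g (repeatThen p d n s) = n • ∑ s, g (p s) + g d := by
  rw [Fin.sum_univ_castSucc, ← sum_range_mul_periodic (fun s => g (p s)), Finset.sum_range]
  simp [repeatThen]

lemma mean_repeatThen {L : Type*} {N : ℕ} (p : Fin (N + 1) → L) (d : L) (n : ℕ) (g : L → ℝ≥0∞) :
    ((n * (N + 1) + 1 : ℕ) : ℝ≥0∞)⁻¹ * ∑ s, g (repeatThen p d n s) =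
      ((n * (N + 1) + 1 : ℕ) : ℝ≥0∞)⁻¹ * (((n * (N + 1) : ℕ) : ℝ≥0∞) *
        (((N + 1 : ℕ) : ℝ≥0∞)⁻¹ * ∑ s, g (p s)) + g d) := by
  rw [sum_repeatThen, Nat.cast_mul n, mul_assoc (n : ℝ≥0∞), ← mul_assoc ((N + 1 : ℕ) : ℝ≥0∞),
    ENNReal.mul_inv_cancel (by simp) (by simp), one_mul, nsmul_eq_mul]

lemma inv_mul_mul_add_self (n : ℕ) (a : ℝ≥0∞) : ((n + 1 : ℕ) : ℝ≥0∞)⁻¹ * (n * a + a) = a := by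
  rw [← add_one_mul, ← Nat.cast_add_one, ← mul_assoc,
    ENNReal.inv_mul_cancel (by simp) (by simp), one_mul]

lemma mean_repeatThen_le {L : Type*} {N : ℕ} (p : Fin (N + 1) → L) {d : L} (n : ℕ)
    {g : L → ℝ≥0∞} (hd : g d ≤ ((N + 1 : ℕ) : ℝ≥0∞)⁻¹ * ∑ s, g (p s)) :
    ((n * (N + 1) + 1 : ℕ) : ℝ≥0∞)⁻¹ * ∑ s, g (repeatThen p d n s) ≤
      ((N + 1 : ℕ) : ℝ≥0∞)⁻¹ * ∑ s, g (p s) := by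
  rw [mean_repeatThen]
  exact (mul_le_mul_right (add_le_add le_rfl hd) _).trans (inv_mul_mul_add_self _ _).le

lemma mean_repeatThen_lt {L : Type*} {N : ℕ} (p : Fin (N + 1) → L) {d : L} (n : ℕ)
    {g : L → ℝ≥0∞} (hfin : ((N + 1 : ℕ) : ℝ≥0∞)⁻¹ * ∑ s, g (p s) ≠ ∞)
    (hd : g d < ((N + 1 : ℕ) : ℝ≥0∞)⁻¹ * ∑ s, g (p s)) :
    ((n * (N + 1) + 1 : ℕ) : ℝ≥0∞)⁻¹ * ∑ s, g (repeatThen p d n s) <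
      ((N + 1 : ℕ) : ℝ≥0∞)⁻¹ * ∑ s, g (p s) := by
  rw [mean_repeatThen]
  refine lt_of_lt_of_eq ?_ (inv_mul_mul_add_self (n * (N + 1)) _)
  refine (ENNReal.mul_lt_mul_iff_right (ENNReal.inv_ne_zero.2 (ENNReal.natCast_ne_top _))
    (by simp)).2 ?_
  exact ENNReal.add_lt_add_left (ENNReal.mul_ne_top (ENNReal.natCast_ne_top _) hfin) hd

lemma tendsto_inv_add_one_mul_natCast :
    Tendsto (fun n : ℕ => ((n + 1 : ℕ) : ℝ≥0∞)⁻¹ * n) atTop (𝓝 1) := by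
  have hsub : Tendsto (fun n : ℕ => 1 - ((n + 1 : ℕ) : ℝ≥0∞)⁻¹) atTop (𝓝 (1 - 0)) :=
    ENNReal.Tendsto.sub tendsto_const_nhds
      (ENNReal.tendsto_inv_nat_nhds_zero.comp (tendsto_add_atTop_nat 1)) (Or.inl ENNReal.one_ne_top)
  rw [tsub_zero] at hsub
  refine hsub.congr fun n => (ENNReal.eq_sub_of_add_eq (by simp) ?_).symm
  simpa [mul_add] using inv_mul_mul_add_self n 1

variable (W : ∀ k, Kernel (∀ i, X i k) (∀ i, Y i k))

lemma inv_mul_mul_sum_carrierInfo_le {N : ℕ} (p : Fin (N + 1) → ∀ i k, ProbabilityMeasure (X i k))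
    (d : ∀ i k, ProbabilityMeasure (X i k)) (n : ℕ) :
    ((n * (N + 1) + 1 : ℕ) : ℝ≥0∞)⁻¹ * ((n * (N + 1) : ℕ) : ℝ≥0∞) *
      ∑ k, ∑ i, carrierInfo W p i k ≤ ∑ k, ∑ i, carrierInfo W (repeatThen p d n) i k := by
  simp only [Finset.mul_sum]
  refine Finset.sum_le_sum fun k _ => Finset.sum_le_sum fun i _ => ?_
  rw [carrierInfo, carrierInfo, mean_repeatThen p d n fun l => userInfo (W k) (fun j => l j k) i,
    mul_assoc]
  exact mul_le_mul_right le_self_add _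

lemma exists_lt_sum_carrierInfo_repeatThen {N : ℕ}
    (p : Fin (N + 1) → ∀ i k, ProbabilityMeasure (X i k)) (d : ∀ i k, ProbabilityMeasure (X i k))
    {R : ℝ≥0∞} (hR : R < ∑ k, ∑ i, carrierInfo W p i k) :
    ∃ n, R < ∑ k, ∑ i, carrierInfo W (repeatThen p d n) i k := by
  have hlim : Tendsto (fun n : ℕ => ((n * (N + 1) + 1 : ℕ) : ℝ≥0∞)⁻¹ *
      ((n * (N + 1) : ℕ) : ℝ≥0∞) * ∑ k, ∑ i, carrierInfo W p i k) atTop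
      (𝓝 (1 * ∑ k, ∑ i, carrierInfo W p i k)) :=
    ENNReal.Tendsto.mul_const (tendsto_inv_add_one_mul_natCast.comp
      (tendsto_id.atTop_mul_const' N.succ_pos)) (Or.inl one_ne_zero)
  rw [one_mul] at hlim
  obtain ⟨n, hn⟩ := (hlim.eventually (lt_mem_nhds hR)).exists
  exact ⟨n, hn.trans_le (inv_mul_mul_sum_carrierInfo_le W p d n)⟩

theorem exists_feasible_lt_sum_carrierInfo_meetsConstraint [DecidableEq κ] {N : ℕ}
    {p : Fin (N + 1) → ∀ i k, ProbabilityMeasure (X i k)} (hp : Q.Feasible p) {R : ℝ≥0∞}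
    (hR : R < ∑ k, ∑ i, carrierInfo W p i k) :
    ∃ (N' : ℕ) (p' : Fin (N' + 1) → ∀ i k, ProbabilityMeasure (X i k)), Q.Feasible p' ∧
      R < ∑ k, ∑ i, carrierInfo W p' i k ∧ ∀ r, MeetsConstraint Q p' r := by
  choose x hx using fun i k => exists_lt_mean_or_ae_le_mean
    (fun s => (p s i k : Measure (X i k))) (Q.measurable_cost i k) rfl
  set d : ∀ i k, ProbabilityMeasure (X i k) := fun i k => ⟨Measure.dirac (x i k), inferInstance⟩
  have hcost_d : ∀ i k, ∫⁻ y, Q.cost i k y ∂(d i k : Measure (X i k)) = Q.cost i k (x i k) :=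
    fun i k => lintegral_dirac' _ (Q.measurable_cost i k)
  have hle : ∀ i k, ∫⁻ y, Q.cost i k y ∂(d i k : Measure (X i k)) ≤
      ((N + 1 : ℕ) : ℝ≥0∞)⁻¹ * ∑ s, ∫⁻ y, Q.cost i k y ∂(p s i k : Measure (X i k)) :=
    fun i k => (hcost_d i k).trans_le ((hx i k).elim (fun h => h.2.le) fun h => h.1)
  obtain ⟨n, hn⟩ := exists_lt_sum_carrierInfo_repeatThen W p d hR
  refine ⟨n * (N + 1), repeatThen p d n, fun i => Q.isLowerSet_region i (fun k => ?_) (hp i), hn,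
    fun r => meetsConstraint_of_slack Q _ r fun i => ⟨_, hp i, fun k => ?_⟩⟩
  · exact mean_repeatThen_le p n (g := fun l => ∫⁻ y, Q.cost i k y ∂(l i k : Measure (X i k)))
      (hle i k)
  · rcases hx i k with ⟨hfin, hlt⟩ | ⟨hle, hae⟩
    · exact Or.inl (mean_repeatThen_lt p n
        (g := fun l => ∫⁻ y, Q.cost i k y ∂(l i k : Measure (X i k))) hfin
        ((hcost_d i k).trans_lt hlt))
    · refine Or.inr fun s => ?_
      rw [repeatThen]
      split_ifs
      · exact hae _
      · exact (ae_dirac_iff (measurableSet_le (Q.measurable_cost i k) measurable_const)).2 hle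

end Constraint

/-! ### Achievability -/

lemma exists_notMem_le_lintegral {Ω : Type*} [MeasurableSpace Ω] (μ : Measure Ω)
    [IsProbabilityMeasure μ] {s : Set Ω} (hs : μ s ≤ 2⁻¹) {f : Ω → ℝ≥0∞} {e : ℝ≥0∞}
    (he : ∫⁻ x, f x ∂μ < e) : ∃ x ∉ s, f x ≤ 2 * e := by
  by_contra! h
  set t := toMeasurable μ s
  have ht : MeasurableSet t := measurableSet_toMeasurable μ s
  have hhalf : 2⁻¹ ≤ μ tᶜ := by
    rw [prob_compl_eq_one_sub ht, measure_toMeasurable, ← ENNReal.one_sub_inv_two]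
    exact tsub_le_tsub_left hs 1
  refine he.not_ge ?_
  calc e = 2 * e * 2⁻¹ := by
        rw [mul_right_comm, ENNReal.mul_inv_cancel (by simp) (by simp), one_mul]
    _ ≤ 2 * e * μ tᶜ := mul_le_mul_right hhalf _
    _ = ∫⁻ _ in tᶜ, 2 * e ∂μ := (setLIntegral_const _ _).symm
    _ ≤ ∫⁻ x in tᶜ, f x ∂μ := setLIntegral_mono' ht.compl fun x hx =>
        (h x fun hxs => hx (subset_toMeasurable μ s hxs)).le
    _ ≤ ∫⁻ x, f x ∂μ := setLIntegral_le_lintegral _ _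

lemma exists_eventually_notMem_tendsto {Ω : ℕ → Type*} [∀ n, MeasurableSpace (Ω n)]
    (μ : ∀ n, Measure (Ω n)) [∀ n, IsProbabilityMeasure (μ n)] {s : ∀ n, Set (Ω n)}
    (hs : Tendsto (fun n => μ n (s n)) atTop (𝓝 0)) {f : ∀ n, Ω n → ℝ≥0∞}
    (hf : Tendsto (fun n => ∫⁻ x, f n x ∂(μ n)) atTop (𝓝 0)) :
    ∃ x : ∀ n, Ω n, (∀ᶠ n in atTop, x n ∉ s n) ∧ Tendsto (fun n => f n (x n)) atTop (𝓝 0) := by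
  have hchoice : ∀ n, ∃ x : Ω n, μ n (s n) ≤ 2⁻¹ → ∫⁻ x, f n x ∂(μ n) ≤ 1 →
      x ∉ s n ∧ f n x ≤ 2 * (∫⁻ x, f n x ∂(μ n) + (n : ℝ≥0∞)⁻¹) := fun n => by
    by_cases hn : μ n (s n) ≤ 2⁻¹ ∧ ∫⁻ x, f n x ∂(μ n) ≤ 1
    · obtain ⟨x, hx⟩ := exists_notMem_le_lintegral (μ n) hn.1 (ENNReal.lt_add_right
        (ne_top_of_le_ne_top ENNReal.one_ne_top hn.2)
        (ENNReal.inv_ne_zero.2 (ENNReal.natCast_ne_top n)))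
      exact ⟨x, fun _ _ => hx⟩
    · exact ⟨(μ n).nonempty_of_neZero.some, fun h h' => absurd ⟨h, h'⟩ hn⟩
  choose x hx using hchoice
  have hgood := ((ENNReal.tendsto_nhds_zero.1 hs 2⁻¹ (by simp)).and
    (ENNReal.tendsto_nhds_zero.1 hf 1 one_pos)).mono fun n hn => hx n hn.1 hn.2
  have hbound : Tendsto (fun n => 2 * (∫⁻ x, f n x ∂(μ n) + (n : ℝ≥0∞)⁻¹)) atTop
      (𝓝 (2 * (0 + 0))) :=
    ENNReal.Tendsto.const_mul (hf.add ENNReal.tendsto_inv_nat_nhds_zero) (Or.inr (by simp))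
  rw [add_zero, mul_zero] at hbound
  exact ⟨x, hgood.mono fun n hn => hn.1, tendsto_of_tendsto_of_tendsto_of_le_of_le'
    tendsto_const_nhds hbound (Eventually.of_forall fun _ => zero_le) (hgood.mono fun n hn => hn.2)⟩

lemma tendsto_floor_div_mul_div (a : ℝ≥0) {l : ℝ≥0} (hl : l ≠ 0) :
    Tendsto (fun n : ℕ => (⌊a / l * n⌋₊ : ℝ≥0) * l / n) atTop (𝓝 a) := by
  have hfloor : Tendsto (fun n : ℕ => (⌊a / l * n⌋₊ : ℝ≥0) / n) atTop (𝓝 (a / l)) := by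
    refine NNReal.tendsto_coe.1 (((tendsto_nat_floor_mul_div_atTop (R := ℝ)
      (a / l : ℝ≥0).2).comp tendsto_natCast_atTop_atTop).congr fun n => ?_)
    have hcast : ⌊((a / l : ℝ≥0) : ℝ) * n⌋₊ = ⌊a / l * n⌋₊ := by
      rw [← NNReal.coe_natCast, ← NNReal.coe_mul]
      exact Nonneg.nat_floor_coe _
    change (⌊((a / l : ℝ≥0) : ℝ) * n⌋₊ : ℝ) / n = _
    rw [hcast, NNReal.coe_div, NNReal.coe_natCast, NNReal.coe_natCast]
  refine ((hfloor.mul_const l).congr fun n => div_mul_eq_mul_div _ _ _).trans_eq ?_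
  rw [div_mul_cancel₀ _ hl]

lemma exists_natCast_mul_div_le {ι : Type*} [Fintype ι] (a : ι → ℝ≥0) {l : ℝ≥0} (hl : l ≠ 0)
    {R : ℝ≥0∞} (hR : R < (∑ i, a i : ℝ≥0)) :
    ∃ (b : ℕ) (z : ι → ℕ), 0 < b ∧ (∀ i, (z i : ℝ≥0) * l / b ≤ a i) ∧
      R < (∑ i, (z i : ℝ≥0) * l / b : ℝ≥0) := by
  have hsum : Tendsto (fun n : ℕ => ((∑ i, (⌊a i / l * n⌋₊ : ℝ≥0) * l / n : ℝ≥0) : ℝ≥0∞)) atTop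
      (𝓝 ((∑ i, a i : ℝ≥0) : ℝ≥0∞)) :=
    ENNReal.tendsto_coe.2 (tendsto_finsetSum _ fun i _ => tendsto_floor_div_mul_div (a i) hl)
  obtain ⟨b, hbR, hb⟩ := ((hsum.eventually (lt_mem_nhds hR)).and (eventually_gt_atTop 0)).exists
  refine ⟨b, fun i => ⌊a i / l * b⌋₊, hb, fun i => ?_, hbR⟩
  calc (⌊a i / l * b⌋₊ : ℝ≥0) * l / b ≤ a i / l * b * l / b := by
        gcongr
        exact Nat.floor_le zero_le
    _ = a i := by
        rw [mul_right_comm, div_mul_cancel₀ _ hl,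
          mul_div_cancel_right₀ _ (Nat.cast_ne_zero.2 hb.ne')]

/-- The rates `r` are rational multiples of `log 2` with the denominator `b`. At the block lengths
`b * t`, the ceiling in `msgCount` is then exact, so that codes have exactly these rates. -/
def IsDyadicRate {ι : Type*} (b : ℕ) (r : ι → ℝ≥0) : Prop :=
  ∀ i, ∃ z : ℕ, (b : ℝ) * r i = z * Real.log 2

lemma exists_isDyadicRate {ι : Type*} [Fintype ι] {f : ι → ℝ≥0∞} {R : ℝ≥0∞}
    (h : R < ∑ i, f i) :
    ∃ (b : ℕ) (r : ι → ℝ≥0), 0 < b ∧ IsDyadicRate b r ∧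
      (∀ i, r i = 0 ∨ (r i : ℝ≥0∞) < f i) ∧ R < (∑ i, r i : ℝ≥0) := by
  obtain ⟨a, ha, hR⟩ := exists_lt_sum h
  have hlog : (Real.log 2).toNNReal ≠ 0 := (Real.toNNReal_pos.2 (Real.log_pos one_lt_two)).ne'
  obtain ⟨b, z, hb, hza, hzR⟩ := exists_natCast_mul_div_le a hlog hR
  refine ⟨b, fun i => z i * (Real.log 2).toNNReal / b, hb, fun i => ⟨z i, ?_⟩, fun i => ?_, hzR⟩
  · rw [NNReal.coe_div, NNReal.coe_mul, NNReal.coe_natCast, NNReal.coe_natCast,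
      Real.coe_toNNReal _ (Real.log_nonneg one_le_two),
      mul_div_cancel₀ _ (Nat.cast_ne_zero.2 hb.ne')]
  · exact (ha i).imp (fun h0 => le_antisymm ((hza i).trans h0.le) zero_le)
      fun hlt => (ENNReal.coe_le_coe.2 (hza i)).trans_lt hlt

lemma log_msgCount_eq {b : ℕ} {r : ℝ≥0} (h : ∃ z : ℕ, (b : ℝ) * r = z * Real.log 2) (t : ℕ) :
    Real.log (msgCount (b * t) r) = (b * t : ℕ) * r := by
  obtain ⟨z, hz⟩ := h
  have hexponent : ((b * t : ℕ) : ℝ) * r = (z * t : ℕ) * Real.log 2 := by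
    push_cast
    linear_combination (t : ℝ) * hz
  have hpow : Real.exp ((b * t : ℕ) * r) = (2 ^ (z * t) : ℕ) := by
    rw [hexponent, Real.exp_nat_mul, Real.exp_log two_pos, Nat.cast_pow, Nat.cast_ofNat]
  rw [msgCount, hpow, Nat.ceil_natCast, ← hpow, Real.log_exp]

section SeparateCode

variable {ι : Type*} [Fintype ι]

lemma errorProb_comp_equiv [DecidableEq ι] {X Y : ι → Type*} [∀ i, MeasurableSpace (X i)]
    [∀ i, MeasurableSpace (Y i)] (W : Kernel (∀ i, X i) (∀ i, Y i)) {T : ℕ} {M M' : ι → Type*}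
    [∀ i, Fintype (M i)] [∀ i, Fintype (M' i)] (e : ∀ i, M' i ≃ M i)
    (enc : ∀ i, M i → Fin T → X i) (dec : ∀ i, (Fin T → Y i) → M i) :
    errorProb W (fun i w => enc i (e i w)) (fun i y => (e i).symm (dec i y)) =
      errorProb W enc dec := by
  rw [errorProb, errorProb, Fintype.card_congr (Equiv.piCongrRight e),
    ← (Equiv.piCongrRight e).sum_comp]
  simp only [ne_eq, Equiv.symm_apply_eq, Equiv.piCongrRight_apply, Pi.map_apply]

variable {κ : Type*} [Fintype κ] {X Y : ι → κ → Type*}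
  [∀ i k, MeasurableSpace (X i k)] [∀ i k, MeasurableSpace (Y i k)]

omit [Fintype ι] [Fintype κ] in
lemma codebookCost_comp_equiv (Q : CostConstraint X) (i : ι) {M M' : Type*} [Fintype M]
    [Fintype M'] (e : M' ≃ M) {T : ℕ} (c : M → Fin T → ∀ k, X i k) :
    Q.codebookCost i (fun w => c (e w)) = Q.codebookCost i c := by
  funext k
  rw [CostConstraint.codebookCost, CostConstraint.codebookCost, Fintype.card_congr e,
    ← e.sum_comp]

variable [DecidableEq κ]

/-- The code that consists of separate codebooks and decoding rules; the tuples of the messages on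
the carriers are enumerated. -/
def separateCode {r : ι → κ → ℝ≥0} {T : ℕ} (δ : TINDecoders X Y r T)
    (hδ : ∀ i k, Measurable (Function.uncurry (δ i k))) (c : Codebooks X r T) :
    Code (fun i => ∀ k, X i k) (fun i => ∀ k, Y i k) T where
  numMsg i := Fintype.card (∀ k, Fin (msgCount T (r i k)))
  numMsg_pos _ := Fintype.card_pos
  enc i w := separateEnc c i ((Fintype.equivFin _).symm w)
  dec i y := Fintype.equivFin _ (separateDec δ c i y)
  measurable_dec i := by
    have hdec : Measurable fun y : Fin T → ∀ k, Y i k => separateDec δ c i y :=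
      measurable_pi_iff.2 fun k => ((hδ i k).comp measurable_prodMk_left).comp (by fun_prop)
    exact Measurable.of_discrete.comp hdec

omit [Fintype ι] in
lemma separateCode_rate {r : ι → κ → ℝ≥0} {b t : ℕ} (hb : 0 < b) (ht : 0 < t) {i : ι}
    (hr : IsDyadicRate b (r i)) (δ : TINDecoders X Y r (b * t))
    (hδ : ∀ i k, Measurable (Function.uncurry (δ i k))) (c : Codebooks X r (b * t)) :
    (separateCode δ hδ c).rate i = ∑ k, (r i k : ℝ) := by
  have hnum : ((separateCode δ hδ c).numMsg i : ℝ) = ∏ k, (msgCount (b * t) (r i k) : ℝ) := by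
    simp only [separateCode, Fintype.card_pi, Fintype.card_fin, Nat.cast_prod]
  rw [Code.rate, hnum, Real.log_prod fun k _ => Nat.cast_ne_zero.2 (msgCount_pos _ _).ne',
    Finset.sum_div]
  refine Finset.sum_congr rfl fun k _ => ?_
  rw [log_msgCount_eq (hr k),
    mul_div_cancel_left₀ _ (Nat.cast_ne_zero.2 (Nat.mul_pos hb ht).ne')]

variable [DecidableEq ι] (W : ∀ k, Kernel (∀ i, X i k) (∀ i, Y i k)) [∀ k, IsMarkovKernel (W k)]
  (Q : CostConstraint X) {N : ℕ} {p : Fin (N + 1) → ∀ i k, ProbabilityMeasure (X i k)}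

theorem achievable_of_reliableTIN {r : ι → κ → ℝ≥0} {b : ℕ} (hb : 0 < b)
    (hr : ∀ i, IsDyadicRate b (r i)) (hrel : ReliableTIN W p r)
    (hmeets : MeetsConstraint Q p r) : Achievable W Q fun i => ∑ k, (r i k : ℝ) := by
  obtain ⟨δ, hδ, hlim⟩ := hrel
  obtain ⟨c, hcost, herror⟩ := exists_eventually_notMem_tendsto (randomCodebooks p r) hmeets hlim
  obtain ⟨T₀, hT₀⟩ := eventually_atTop.1 hcost
  refine ⟨fun n => b * (T₀ + n + 1), fun n => separateCode (δ _) (hδ _) (c _),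
    fun n => Nat.mul_pos hb (Nat.succ_pos _),
    fun n i => separateCode_rate hb (Nat.succ_pos _) (hr i) _ _ _, fun n i => ?_, ?_⟩
  · have hmem := not_not.1 (hT₀ (b * (T₀ + n + 1)) (by nlinarith)) i
    rwa [← codebookCost_comp_equiv Q i (Fintype.equivFin _).symm] at hmem
  · have hT : Tendsto (fun n : ℕ => b * (T₀ + n + 1)) atTop atTop :=
      tendsto_atTop_mono (fun n => (by simp only [id]; lia : id n ≤ T₀ + n + 1).trans
        (Nat.le_mul_of_pos_left _ hb)) tendsto_id
    refine (herror.comp hT).congr fun n => (errorProb_comp_equiv (parallel W) (fun i =>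
      (Fintype.equivFin (∀ k, Fin (msgCount (b * (T₀ + n + 1)) (r i k)))).symm) _ _).symm

theorem exists_reliableTIN_achievable (hp : Q.Feasible p) {R : ℝ≥0∞}
    (hR : R < ∑ k, ∑ i, carrierInfo W p i k) :
    ∃ (N' : ℕ) (p' : Fin (N' + 1) → ∀ i k, ProbabilityMeasure (X i k)) (r : ι → κ → ℝ≥0),
      Q.Feasible p' ∧ R < ((∑ k, ∑ i, r i k : ℝ≥0) : ℝ≥0∞) ∧ ReliableTIN W p' r ∧
      MeetsConstraint Q p' r ∧ Achievable W Q fun i => ∑ k, (r i k : ℝ) := by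
  obtain ⟨N', p', hp', hR', hmeets⟩ := exists_feasible_lt_sum_carrierInfo_meetsConstraint Q W hp hR
  rw [← Fintype.sum_prod_type' (f := fun k i => carrierInfo W p' i k)] at hR'
  obtain ⟨b, r, hb, hdyadic, hr, hRr⟩ := exists_isDyadicRate hR'
  have hrel : ReliableTIN W p' fun i k => r (k, i) :=
    reliableTIN_of_lt_carrierInfo W p' _ fun i k => hr (k, i)
  refine ⟨N', p', fun i k => r (k, i), hp', ?_, hrel, hmeets _,
    achievable_of_reliableTIN W Q hb (fun i k => hdyadic (k, i)) hrel (hmeets _)⟩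
  rwa [← Fintype.sum_prod_type' (f := fun k i => r (k, i))]

omit [DecidableEq κ] in
theorem separateSumInfo_le_sumCapacity : separateSumInfo W Q ≤ sumCapacity W Q := by
  classical
  refine iSup_le fun N => iSup₂_le fun p hp => le_of_forall_lt fun R hR => ?_
  obtain ⟨N', p', r, -, hRr, -, -, hach⟩ := exists_reliableTIN_achievable W Q hp hR
  refine hRr.trans_le (le_iSup₂_of_le _ (subset_closure hach) (le_of_eq ?_))
  rw [Finset.sum_comm, ← ENNReal.ofReal_coe_nnreal]
  push_cast
  rfl

lemma exists_reliableTIN_of_lt_separateSumInfo {R : ℝ≥0∞} (hR : R < separateSumInfo W Q) :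
    ∃ (N : ℕ) (p : Fin (N + 1) → ∀ i k, ProbabilityMeasure (X i k)) (r : ι → κ → ℝ≥0),
      Q.Feasible p ∧ R < ((∑ k, ∑ i, r i k : ℝ≥0) : ℝ≥0∞) ∧ ReliableTIN W p r ∧
      MeetsConstraint Q p r := by
  simp only [separateSumInfo, lt_iSup_iff] at hR
  obtain ⟨N, p, hp, hR⟩ := hR
  obtain ⟨N', p', r, hp', hRr, hrel, hmeets, -⟩ := exists_reliableTIN_achievable W Q hp hR
  exact ⟨N', p', r, hp', hRr, hrel, hmeets⟩

end SeparateCode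

/-! ### A single slot -/

section SingleSlot

variable {ι : Type*} [Fintype ι] {κ : Type*} {X Y : ι → κ → Type*}
  [∀ i k, MeasurableSpace (X i k)] [∀ i k, MeasurableSpace (Y i k)]
  (W : ∀ k, Kernel (∀ i, X i k) (∀ i, Y i k))

lemma carrierInfo_const (p : ∀ i k, ProbabilityMeasure (X i k)) (i : ι) (k : κ) :
    carrierInfo W (N := 0) (fun _ => p) i k = userInfo (W k) (fun j => p j k) i := by
  simp [carrierInfo]

variable [Fintype κ]

lemma sum_carrierInfo_le_iSup {N : ℕ} (p : Fin (N + 1) → ∀ i k, ProbabilityMeasure (X i k)) :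
    ∑ k, ∑ i, carrierInfo W p i k ≤
      ⨆ p : ∀ i k, ProbabilityMeasure (X i k), ∑ k, ∑ i, userInfo (W k) (fun j => p j k) i := by
  set S : (∀ i k, ProbabilityMeasure (X i k)) → ℝ≥0∞ :=
    fun p => ∑ k, ∑ i, userInfo (W k) (fun j => p j k) i
  calc ∑ k, ∑ i, carrierInfo W p i k = ((N + 1 : ℕ) : ℝ≥0∞)⁻¹ * ∑ s, S (p s) := by
        simp only [carrierInfo, ← Finset.mul_sum]
        congr 1
        exact (Finset.sum_congr rfl fun k _ => Finset.sum_comm).trans Finset.sum_comm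
    _ ≤ ((N + 1 : ℕ) : ℝ≥0∞)⁻¹ * ∑ _s : Fin (N + 1), ⨆ p, S p := by
        gcongr with s
        exact le_iSup S (p s)
    _ = ⨆ p, S p := by
        rw [Finset.sum_const, Finset.card_univ, Fintype.card_fin, nsmul_eq_mul, ← mul_assoc,
          ENNReal.inv_mul_cancel (by simp) (by simp), one_mul]

theorem separateSumInfo_eq_iSup_sum_userInfo {Q : CostConstraint X}
    (hQ : ∀ i, Q.region i = Set.univ) :
    separateSumInfo W Q =
      ⨆ p : ∀ i k, ProbabilityMeasure (X i k), ∑ k, ∑ i, userInfo (W k) (fun j => p j k) i := by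
  refine le_antisymm (iSup_le fun N => iSup₂_le fun p _ => sum_carrierInfo_le_iSup W p)
    (iSup_le fun p => ?_)
  have hfeasible : Q.Feasible (N := 0) fun _ => p := fun i => hQ i ▸ Set.mem_univ _
  have hle : ∑ k, ∑ i, carrierInfo W (N := 0) (fun _ => p) i k ≤ separateSumInfo W Q :=
    le_iSup₂_of_le 0 (fun _ => p) (le_iSup_of_le hfeasible le_rfl)
  simpa only [carrierInfo_const] using hle

variable [∀ k, IsMarkovKernel (W k)]

lemma exists_reliableTIN_of_lt_iSup_sum_userInfo [DecidableEq ι] [DecidableEq κ] {R : ℝ≥0∞}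
    (hR : R < ⨆ p : ∀ i k, ProbabilityMeasure (X i k),
      ∑ k, ∑ i, userInfo (W k) (fun j => p j k) i) :
    ∃ (p : ∀ i k, ProbabilityMeasure (X i k)) (r : ι → κ → ℝ≥0),
      R < ((∑ k, ∑ i, r i k : ℝ≥0) : ℝ≥0∞) ∧ ReliableTIN W (N := 0) (fun _ => p) r := by
  obtain ⟨p, hp⟩ := lt_iSup_iff.1 hR
  rw [← Fintype.sum_prod_type' (f := fun k i => userInfo (W k) (fun j => p j k) i)] at hp
  obtain ⟨r, hr, hRr⟩ := exists_lt_sum hp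
  refine ⟨p, fun i k => r (k, i), ?_, reliableTIN_of_lt_carrierInfo W _ _ fun i k => ?_⟩
  · rwa [← Fintype.sum_prod_type' (f := fun k i => r (k, i))]
  · simpa only [carrierInfo_const] using hr (k, i)

end SingleSlot

/-! ### Finite input alphabets -/

section Mixture

variable {B Z : Type*} [MeasurableSpace B] [Fintype Z] [MeasurableSpace Z]
  [MeasurableSingletonClass Z] {m : Measure B} [IsProbabilityMeasure m] {V : Kernel Z B}

lemma ae_rnDeriv_le {ν : Measure B} {C : ℝ≥0} (h : ν ≤ C • m) :
    ∀ᵐ y ∂m, ν.rnDeriv m y ≤ C := by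
  refine ae_le_of_forall_setLIntegral_le_of_sigmaFinite (Measure.measurable_rnDeriv _ _)
    fun s _ _ => (Measure.setLIntegral_rnDeriv_le s).trans ?_
  rw [setLIntegral_const]
  exact h s

variable [IsFiniteKernel V]

lemma comp_eq_withDensity_sum_rnDeriv (hV : ∀ z, V z ≪ m) (P : Measure Z) :
    V ∘ₘ P = m.withDensity fun y => ∑ z, P {z} * (V z).rnDeriv m y := by
  ext s hs
  rw [Measure.bind_apply hs (Kernel.aemeasurable _), lintegral_fintype, withDensity_apply _ hs,
    lintegral_finsetSum _ fun z _ => (Measure.measurable_rnDeriv _ _).const_mul _]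
  refine Finset.sum_congr rfl fun z _ => ?_
  rw [lintegral_const_mul _ (Measure.measurable_rnDeriv _ _),
    Measure.setLIntegral_rnDeriv (hV z), mul_comm]

lemma klDiv_comp_eq_lintegral (hV : ∀ z, V z ≪ m) (P : Measure Z) [IsFiniteMeasure P] :
    klDiv (V ∘ₘ P) m =
      ∫⁻ y, ENNReal.ofReal (klFun (∑ z, P {z} * (V z).rnDeriv m y).toReal) ∂m := by
  have hdens := comp_eq_withDensity_sum_rnDeriv hV P
  have hac : V ∘ₘ P ≪ m := hdens ▸ withDensity_absolutelyContinuous _ _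
  have hrn : (V ∘ₘ P).rnDeriv m =ᵐ[m] fun y => ∑ z, P {z} * (V z).rnDeriv m y :=
    hdens ▸ Measure.rnDeriv_withDensity _
      (Finset.measurable_fun_sum _ fun z _ => (Measure.measurable_rnDeriv _ _).const_mul _)
  rw [klDiv_eq_lintegral_klFun_of_ac hac]
  refine lintegral_congr_ae ?_
  filter_upwards [hrn] with y hy
  rw [hy]

variable {C : ℝ≥0} (hV : ∀ z, V z ≤ C • m)
include hV

omit [IsFiniteKernel V] in
lemma exists_ae_klFun_mixture_le :
    ∃ M : ℝ≥0, ∀ P : Measure Z, IsProbabilityMeasure P → ∀ᵐ y ∂m,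
      ENNReal.ofReal (klFun (∑ z, P {z} * (V z).rnDeriv m y).toReal) ≤ M := by
  obtain ⟨M, hM⟩ := (isCompact_Icc (a := (0 : ℝ)) (b := C)).exists_bound_of_continuousOn
    continuous_klFun.continuousOn
  refine ⟨M.toNNReal, fun P _ => ?_⟩
  filter_upwards [ae_all_iff.2 fun z => ae_rnDeriv_le (hV z)] with y hy
  have hle : ∑ z, P {z} * (V z).rnDeriv m y ≤ C := calc
    ∑ z, P {z} * (V z).rnDeriv m y ≤ ∑ z, P {z} * C := by gcongr with z; exact hy z
    _ = C := by rw [← Finset.sum_mul, sum_measure_singleton, Finset.coe_univ, measure_univ, one_mul]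
  exact ENNReal.ofReal_le_ofReal ((le_abs_self _).trans
    (hM _ ⟨ENNReal.toReal_nonneg, ENNReal.toReal_le_coe_of_le_coe hle⟩))

omit [Fintype Z] in
lemma klDiv_comp_ne_top [Finite Z] (P : Measure Z) [IsProbabilityMeasure P] :
    klDiv (V ∘ₘ P) m ≠ ∞ := by
  have := Fintype.ofFinite Z
  obtain ⟨M, hM⟩ := exists_ae_klFun_mixture_le hV
  rw [klDiv_comp_eq_lintegral fun z => Measure.absolutelyContinuous_of_le_smul (hV z)]
  refine ne_top_of_le_ne_top ?_ (lintegral_mono_ae (hM P inferInstance))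
  rw [lintegral_const, measure_univ, mul_one]
  exact ENNReal.coe_ne_top

omit [Fintype Z] in
theorem continuous_klDiv_comp [Finite Z] {Θ : Type*} [TopologicalSpace Θ] [FirstCountableTopology Θ]
    {P : Θ → Measure Z} [∀ θ, IsProbabilityMeasure (P θ)]
    (hP : ∀ z, Continuous fun θ => P θ {z}) : Continuous fun θ => klDiv (V ∘ₘ P θ) m := by
  have := Fintype.ofFinite Z
  obtain ⟨M, hM⟩ := exists_ae_klFun_mixture_le hV
  simp only [klDiv_comp_eq_lintegral fun z => Measure.absolutelyContinuous_of_le_smul (hV z)]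
  refine continuous_iff_continuousAt.2 fun θ => tendsto_lintegral_filter_of_dominated_convergence
    (fun _ => (M : ℝ≥0∞)) (Eventually.of_forall fun θ => ?_)
    (Eventually.of_forall fun θ => hM (P θ) inferInstance) (by simp) ?_
  · exact (measurable_klFun.comp (Finset.measurable_fun_sum _ fun z _ =>
      (Measure.measurable_rnDeriv _ _).const_mul _).ennreal_toReal).ennreal_ofReal
  filter_upwards [ae_all_iff.2 fun z => ae_rnDeriv_le (hV z)] with y hy
  have hfin (z : Z) : (V z).rnDeriv m y ≠ ∞ := ne_top_of_le_ne_top ENNReal.coe_ne_top (hy z)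
  have hsum : Tendsto (fun θ => ∑ z, P θ {z} * (V z).rnDeriv m y) (𝓝 θ)
      (𝓝 (∑ z, P θ {z} * (V z).rnDeriv m y)) :=
    tendsto_finsetSum _ fun z _ => ENNReal.Tendsto.mul_const (hP z).continuousAt (Or.inr (hfin z))
  have htop : ∑ z, P θ {z} * (V z).rnDeriv m y ≠ ∞ :=
    ENNReal.sum_ne_top.2 fun z _ => ENNReal.mul_ne_top (measure_ne_top _ _) (hfin z)
  exact ENNReal.tendsto_ofReal
    ((continuous_klFun.tendsto _).comp ((ENNReal.tendsto_toReal htop).comp hsum))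

end Mixture

section Continuity

lemma le_card_smul_comp_uniformOn {Z B : Type*} [Fintype Z] [Nonempty Z] [MeasurableSpace Z]
    [MeasurableSingletonClass Z] [MeasurableSpace B] (V : Kernel Z B) (z : Z) :
    V z ≤ (Fintype.card Z : ℝ≥0) • (V ∘ₘ uniformOn Set.univ) := by
  refine Measure.le_iff.2 fun s hs => ?_
  rw [Measure.smul_apply, Measure.bind_apply hs (Kernel.aemeasurable _), lintegral_uniformOn_univ,
    ENNReal.smul_def, smul_eq_mul, ENNReal.coe_natCast, ← mul_assoc,
    ENNReal.mul_inv_cancel (Nat.cast_ne_zero.2 Fintype.card_ne_zero) (ENNReal.natCast_ne_top _),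
    one_mul]
  exact Finset.single_le_sum (f := fun z => V z s) (fun _ _ => zero_le) (Finset.mem_univ z)

lemma continuous_pi_singleton {ι : Type*} [Fintype ι] {X : ι → Type*} [∀ i, MeasurableSpace (X i)]
    {Θ : Type*} [TopologicalSpace Θ] {p : Θ → ∀ i, ProbabilityMeasure (X i)}
    (hp : ∀ i x, Continuous fun θ => (p θ i : Measure (X i)) {x}) (x : ∀ i, X i) :
    Continuous fun θ => Measure.pi (fun j => (p θ j : Measure (X j))) {x} := by
  simp only [Measure.pi_singleton]
  exact continuous_iff_continuousAt.2 fun θ => ENNReal.tendsto_finsetProd_of_ne_top _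
    (fun j _ => (hp j (x j)).continuousAt) fun j _ => measure_ne_top _ _

variable {ι : Type*} [Fintype ι] [DecidableEq ι] {X Y : ι → Type*} [∀ i, MeasurableSpace (X i)]
  [∀ i, MeasurableSpace (Y i)] (W : Kernel (∀ i, X i) (∀ i, Y i)) [IsMarkovKernel W]

lemma userChannel_comp_self (p : ∀ i, Measure (X i)) [∀ i, IsProbabilityMeasure (p i)] (i : ι) :
    userChannel W p i ∘ₘ p i = (W.map fun y => y i) ∘ₘ Measure.pi p := by
  rw [← Measure.snd_compProd, ← pi_compProd_map_eval,
    ← Measure.map_comp _ _ (measurable_pi_apply i),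
    ← Measure.snd_compProd, Measure.snd, Measure.snd,
    Measure.map_map measurable_snd (by fun_prop), Measure.map_map (by fun_prop) measurable_snd]
  rfl

variable [∀ i, Fintype (X i)] [∀ i, MeasurableSingletonClass (X i)]

lemma userInfo_add_klDiv_eq_sum (p : ∀ i, ProbabilityMeasure (X i)) (i : ι) (m : Measure (Y i))
    [IsProbabilityMeasure m] :
    userInfo W p i + klDiv ((W.map fun y => y i) ∘ₘ Measure.pi fun j => (p j : Measure (X j))) m =
      ∑ a, klDiv (userChannel W (fun j => (p j : Measure (X j))) i a) m *
        (p i : Measure (X i)) {a} := by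
  rw [userInfo_eq_mutualInfo_userChannel, ← userChannel_comp_self, ← klDiv_compProd_prod,
    ← Measure.compProd_const, klDiv_compProd_eq_lintegral, lintegral_fintype]
  rfl

omit [∀ i, Fintype (X i)]

section Dominated

variable [∀ i, Finite (X i)] {i : ι} {C : ℝ≥0} {m : Measure (Y i)} [IsProbabilityMeasure m]
  (hV : ∀ x, (W.map fun y => y i) x ≤ C • m)
include hV

lemma klDiv_userChannel_ne_top (p : ∀ i, ProbabilityMeasure (X i)) (a : X i) :
    klDiv (userChannel W (fun j => (p j : Measure (X j))) i a) m ≠ ∞ := by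
  rw [userChannel_apply_eq_comp]
  exact klDiv_comp_ne_top (fun x => hV (Function.update x i a)) _

variable {Θ : Type*} [TopologicalSpace Θ] [FirstCountableTopology Θ]
  {p : Θ → ∀ i, ProbabilityMeasure (X i)}
  (hp : ∀ i x, Continuous fun θ => (p θ i : Measure (X i)) {x})
include hp

lemma continuous_klDiv_userChannel (a : X i) : Continuous fun θ =>
    klDiv (userChannel W (fun j => (p θ j : Measure (X j))) i a) m := by
  simp only [userChannel_apply_eq_comp]
  exact continuous_klDiv_comp (fun x => hV (Function.update x i a)) (continuous_pi_singleton hp)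

end Dominated

omit [DecidableEq ι] in
theorem continuous_userInfo [∀ i, Finite (X i)] [∀ i, Nonempty (X i)] {Θ : Type*}
    [TopologicalSpace Θ] [FirstCountableTopology Θ] {p : Θ → ∀ i, ProbabilityMeasure (X i)}
    (hp : ∀ i x, Continuous fun θ => (p θ i : Measure (X i)) {x}) (i : ι) :
    Continuous fun θ => userInfo W (p θ) i := by
  classical
  have (i : ι) : Fintype (X i) := Fintype.ofFinite _
  have hV := le_card_smul_comp_uniformOn (W.map fun y => y i)
  set m := (W.map fun y => y i) ∘ₘ uniformOn (Set.univ : Set (∀ j, X j))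
  have hinput (a : X i) (θ : Θ) := klDiv_userChannel_ne_top W hV (p θ) a
  have houtput (θ : Θ) := klDiv_comp_ne_top hV (Measure.pi fun j => (p θ j : Measure (X j)))
  simp only [fun θ => ENNReal.eq_sub_of_add_eq (houtput θ) (userInfo_add_klDiv_eq_sum W (p θ) i m)]
  refine continuous_iff_continuousAt.2 fun θ => ENNReal.Tendsto.sub (tendsto_finsetSum _ fun a _ =>
    ENNReal.Tendsto.mul (continuous_klDiv_userChannel W hV hp a).continuousAt
      (Or.inr (measure_ne_top _ _)) (hp i a).continuousAt (Or.inr (hinput a θ)))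
    (continuous_klDiv_comp hV (continuous_pi_singleton hp)).continuousAt (Or.inr (houtput θ))

end Continuity

theorem exists_sum_userInfo_eq_iSup {ι : Type*} [Fintype ι] {κ : Type*} [Fintype κ]
    {X Y : ι → κ → Type*} [∀ i k, Finite (X i k)] [∀ i k, Nonempty (X i k)]
    [∀ i k, MeasurableSpace (X i k)] [∀ i k, MeasurableSingletonClass (X i k)]
    [∀ i k, MeasurableSpace (Y i k)]
    (W : ∀ k, Kernel (∀ i, X i k) (∀ i, Y i k)) [∀ k, IsMarkovKernel (W k)] :
    ∃ p : ∀ i k, ProbabilityMeasure (X i k),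
      ⨆ p : ∀ i k, ProbabilityMeasure (X i k), ∑ k, ∑ i, userInfo (W k) (fun j => p j k) i =
        ∑ k, ∑ i, userInfo (W k) (fun j => p j k) i := by
  classical
  have (i : ι) (k : κ) : Fintype (X i k) := Fintype.ofFinite _
  have (i : ι) (k : κ) : Nonempty (ProbabilityMeasure (X i k)) :=
    ⟨⟨Measure.dirac (Classical.arbitrary _), inferInstance⟩⟩
  let _ (i : ι) (k : κ) : TopologicalSpace (X i k) := ⊥
  have (i : ι) (k : κ) : DiscreteTopology (X i k) := ⟨rfl⟩
  have hsingleton (j : ι) (k : κ) (x : X j k) :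
      Continuous fun p : ∀ i k, ProbabilityMeasure (X i k) => (p j k : Measure (X j k)) {x} := by
    have heval : Continuous fun p : ∀ i k, ProbabilityMeasure (X i k) => p j k := by fun_prop
    refine continuous_iff_continuousAt.2 fun p => ?_
    simpa [ContinuousAt] using ENNReal.tendsto_coe.2
      (ProbabilityMeasure.tendsto_measure_of_isClopen_of_tendsto heval.continuousAt
        (isClopen_discrete {x}))
  have hcont : Continuous fun p : ∀ i k, ProbabilityMeasure (X i k) =>
      ∑ k, ∑ i, userInfo (W k) (fun j => p j k) i :=
    continuous_finsetSum _ fun k _ => continuous_finsetSum _ fun i _ =>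
      continuous_userInfo (W k) (fun j x => hsingleton j k x) i
  obtain ⟨p, -, hp⟩ := isCompact_univ.exists_isMaxOn Set.univ_nonempty hcont.continuousOn
  exact ⟨p, le_antisymm (iSup_le fun q => hp (Set.mem_univ q))
    (le_iSup (fun p : ∀ i k, ProbabilityMeasure (X i k) =>
      ∑ k, ∑ i, userInfo (W k) (fun j => p j k) i) p)⟩

theorem sumCapacity_eq_separateSumInfo {m : ℕ} {κ : Type*} [Fintype κ]
    {X Y : Fin (m + 1) → κ → Type*} {V : κ → Type*} [∀ i k, MeasurableSpace (X i k)]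
    [∀ i k, MeasurableSpace (Y i k)] [∀ i k, MeasurableSpace.CountablyGenerated (Y i k)]
    [∀ k, MeasurableSpace (V k)] (C : ∀ k, ManyToOne (fun i => X i k) (fun i => Y i k) (V k))
    (hC : ∀ k, (C k).Degraded) (Q : CostConstraint X) :
    sumCapacity (fun k => (C k).kernel) Q = separateSumInfo (fun k => (C k).kernel) Q :=
  (sumCapacity_le_separateSumInfo C hC Q).antisymm (separateSumInfo_le_sumCapacity _ Q)

end ParallelIC

end

theorem mainTheorem3_general {m : ℕ} {κ : Type*} [Fintype κ] [DecidableEq κ]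
    {X Y : Fin (m + 1) → κ → Type*} {V : κ → Type*} [∀ i k, MeasurableSpace (X i k)]
    [∀ i k, MeasurableSpace (Y i k)] [∀ i k, MeasurableSpace.CountablyGenerated (Y i k)]
    [∀ k, MeasurableSpace (V k)] (C : ∀ k, ManyToOne (fun i => X i k) (fun i => Y i k) (V k))
    (hC : ∀ k, (C k).Degraded) (Q : CostConstraint X) :
    sumCapacity (fun k => (C k).kernel) Q = separateSumInfo (fun k => (C k).kernel) Q ∧
    (∀ (N : ℕ) (p : Fin (N + 1) → ∀ i k, ProbabilityMeasure (X i k)) (r : Fin (m + 1) → κ → ℝ≥0),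
      (∀ i k, r i k = 0 ∨ (r i k : ℝ≥0∞) < carrierInfo (fun k => (C k).kernel) p i k) →
      ReliableTIN (fun k => (C k).kernel) p r) ∧
    (∀ R < sumCapacity (fun k => (C k).kernel) Q,
      ∃ (N : ℕ) (p : Fin (N + 1) → ∀ i k, ProbabilityMeasure (X i k))
        (r : Fin (m + 1) → κ → ℝ≥0),
        Q.Feasible p ∧ R < ((∑ k, ∑ i, r i k : ℝ≥0) : ℝ≥0∞) ∧
        ReliableTIN (fun k => (C k).kernel) p r ∧ MeetsConstraint Q p r) ∧
    (∀ q : ∀ i, ProbabilityMeasure (∀ k, X i k),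
      ∑ i, userInfo (parallel fun k => (C k).kernel) q i ≤
        ∑ k, ∑ i, userInfo (C k).kernel (fun j => carrierMarginal (q j) k) i) ∧
    ((∀ i, Q.region i = Set.univ) →
      sumCapacity (fun k => (C k).kernel) Q =
        (⨆ p : ∀ i k, ProbabilityMeasure (X i k),
          ∑ k, ∑ i, userInfo (C k).kernel (fun j => p j k) i) ∧
      (∀ R < sumCapacity (fun k => (C k).kernel) Q,
        ∃ (p : ∀ i k, ProbabilityMeasure (X i k)) (r : Fin (m + 1) → κ → ℝ≥0),
          R < ((∑ k, ∑ i, r i k : ℝ≥0) : ℝ≥0∞) ∧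
          ReliableTIN (fun k => (C k).kernel) (N := 0) (fun _ => p) r) ∧
      ∀ [∀ i k, Finite (X i k)] [∀ i k, Nonempty (X i k)] [∀ i k, MeasurableSingletonClass (X i k)],
        ∃ p : ∀ i k, ProbabilityMeasure (X i k),
          sumCapacity (fun k => (C k).kernel) Q =
            ∑ k, ∑ i, userInfo (C k).kernel (fun j => p j k) i) := by
  rw [sumCapacity_eq_separateSumInfo C hC Q]
  refine ⟨rfl, fun N p r => reliableTIN_of_lt_carrierInfo _ p r,
    fun R => exists_reliableTIN_of_lt_separateSumInfo _ Q,
    fun q => ManyToOne.sum_userInfo_parallel_le C q hC, fun hQ => ?_⟩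
  rw [separateSumInfo_eq_iSup_sum_userInfo _ hQ]
  exact ⟨rfl, fun R => exists_reliableTIN_of_lt_iSup_sum_userInfo _,
    exists_sum_userInfo_eq_iSup fun k => (C k).kernel⟩

theorem mainTheorem3 {m F : ℕ} {X Y : Fin (m + 1) → Fin F → Type*} {V : Fin F → Type*}
    [∀ i k, MeasurableSpace (X i k)] [∀ i k, StandardBorelSpace (X i k)] [∀ i k, Nonempty (X i k)]
    [∀ i k, MeasurableSpace (Y i k)] [∀ i k, StandardBorelSpace (Y i k)]
    [∀ k, MeasurableSpace (V k)] [∀ k, StandardBorelSpace (V k)]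
    (C : ∀ k, ManyToOne (fun i => X i k) (fun i => Y i k) (V k))
    (hC : ∀ k, (C k).Degraded) (Q : CostConstraint X) :
    -- the sum-capacity under the constraint
    sumCapacity (fun k => (C k).kernel) Q =
      (⨆ (N : ℕ) (p : Fin (N + 1) → ∀ i k, ProbabilityMeasure (X i k)) (_ : Q.Feasible p),
        ∑ k, ∑ i, carrierInfo (fun k => (C k).kernel) p i k) ∧
    -- separate random coding with interference treated as noise is reliable on every carrier at
    -- all rates below the mutual information
    (∀ (N : ℕ) (p : Fin (N + 1) → ∀ i k, ProbabilityMeasure (X i k)) (r : Fin (m + 1) → Fin F → ℝ≥0),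
      (∀ i k, r i k = 0 ∨ (r i k : ℝ≥0∞) < carrierInfo (fun k => (C k).kernel) p i k) →
      ReliableTIN (fun k => (C k).kernel) p r) ∧
    -- and it achieves the sum-capacity
    (∀ R < sumCapacity (fun k => (C k).kernel) Q,
      ∃ (N : ℕ) (p : Fin (N + 1) → ∀ i k, ProbabilityMeasure (X i k))
        (r : Fin (m + 1) → Fin F → ℝ≥0),
        Q.Feasible p ∧ R < ((∑ k, ∑ i, r i k : ℝ≥0) : ℝ≥0∞) ∧
        ReliableTIN (fun k => (C k).kernel) p r ∧ MeetsConstraint Q p r) ∧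
    -- vector inputs are not better than inputs with the same marginals that are independent
    -- across carriers
    (∀ q : ∀ i, ProbabilityMeasure (∀ k, X i k),
      ∑ i, userInfo (parallel fun k => (C k).kernel) q i ≤
        ∑ k, ∑ i, userInfo (C k).kernel (fun j => carrierMarginal (q j) k) i) ∧
    -- without a constraint, one input law for each user and each carrier is enough
    ((∀ i, Q.region i = Set.univ) →
      sumCapacity (fun k => (C k).kernel) Q =
        (⨆ p : ∀ i k, ProbabilityMeasure (X i k),
          ∑ k, ∑ i, userInfo (C k).kernel (fun j => p j k) i) ∧
      (∀ R < sumCapacity (fun k => (C k).kernel) Q,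
        ∃ (p : ∀ i k, ProbabilityMeasure (X i k)) (r : Fin (m + 1) → Fin F → ℝ≥0),
          R < ((∑ k, ∑ i, r i k : ℝ≥0) : ℝ≥0∞) ∧
          ReliableTIN (fun k => (C k).kernel) (N := 0) (fun _ => p) r) ∧
      -- and for finite input alphabets the maximum is attained
      ((∀ i k, Finite (X i k)) →
        ∃ p : ∀ i k, ProbabilityMeasure (X i k),
          sumCapacity (fun k => (C k).kernel) Q =
            ∑ k, ∑ i, userInfo (C k).kernel (fun j => p j k) i)) := by
  obtain ⟨hcapacity, hreliable, hachieves, hcarriers, hunconstrained⟩ := mainTheorem3_general C hC Q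
  exact ⟨hcapacity, hreliable, hachieves, hcarriers, fun hQ =>
    have ⟨hsingle, hsingle_achieves, hmax⟩ := hunconstrained hQ
    ⟨hsingle, hsingle_achieves, fun _ => hmax⟩⟩
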